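/- Fix integers $d\ge 2$ and $0\le j\le d-2$. The $d$-process on $n$ labelled vertices starts with the empty graph and adds edges one by one, each chosen uniformly at random from the pairs of distinct vertices that are not yet edges and whose two vertices both have current degree less than $d$ (if there is no such pair, the process stays at its final graph). Let $G_s$ be its graph after $s$ steps and let $D_j(s)$ be the number of vertices of degree $j$ in $G_s$. Let $N=\lfloor dn/2\rfloor$, and write $[x]_k=x(x-1)\cdots(x-k+1)$. Let $\gamma>0$ be a constant and let $t=t(n)$ be a sequence of non-negative integers with $t\to\infty$ as $n\to\infty$ and $t<(\log n)^\gamma$ for all sufficiently large $n$. Then for every fixed integer $i\ge 0$, as $n\to\infty$, $$\Pr\big(D_j(N-t)=i\big)=e^{-\lambda}\frac{\lambda^i}{i!}+o(1),\qquad\text{where }\ \lambda=\lambda(n)=\frac{2\,[d-1]_{d-1-j}\;t}{(\log n)^{d-1-j}} .$$ (For the finitely many $n$ with $t>N$, where $D_j(N-t)$ is not defined, any value may be used.) -/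

import Mathlib

open Filter Topology

namespace DGraphs

open Classical in
/-- The pairs that may be added to `G` in the `d`-process: pairs of distinct vertices which are not
yet edges and whose both vertices have current degree less than `d`. -/
noncomputable def addable {n : ℕ} (d : ℕ) (G : SimpleGraph (Fin n)) : Finset (Sym2 (Fin n)) :=
  Finset.univ.filter fun e => ¬ e.IsDiag ∧ e ∉ G.edgeSet ∧ ∀ v ∈ e, G.degree v < d

open Classical in
/-- One step of the `d`-process from `G`: an edge chosen uniformly at random from the addable pairs
is added. If there is no such pair, the process is stuck and stays at its final graph `G`. -/
noncomputable def step {n : ℕ} (d : ℕ) (G : SimpleGraph (Fin n)) : PMF (SimpleGraph (Fin n)) :=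
  if h : (addable d G).Nonempty then
    (PMF.uniformOfFinset (addable d G) h).map fun e => G ⊔ SimpleGraph.fromEdgeSet {e}
  else PMF.pure G

/-- The law of the graph `G_s` of the `d`-process on `n` vertices after `s` steps, starting from
the empty graph. -/
noncomputable def graphLaw (d n : ℕ) : ℕ → PMF (SimpleGraph (Fin n))
  | 0 => PMF.pure ⊥
  | s + 1 => (graphLaw d n s).bind (step d)

open Classical in
/-- The number of vertices of degree `j` in `G`. -/
noncomputable def degreeCount {n : ℕ} (j : ℕ) (G : SimpleGraph (Fin n)) : ℕ :=
  (Finset.univ.filter fun v => G.degree v = j).card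

/-- The law of `D_j(s)`, the number of vertices of degree `j` in the graph `G_s` of the `d`-process
on `n` vertices. -/
noncomputable def degreeCountLaw (d n j s : ℕ) : PMF ℕ :=
  (graphLaw d n s).map (degreeCount j)

/-- `f_j(d,t,n) = 2 [d-1]_{d-1-j} t / (log n)^{d-1-j}`, with `[x]_k` the falling factorial. -/
noncomputable def poissonParam (j d t n : ℕ) : ℝ :=
  2 * ((d - 1).descFactorial (d - 1 - j) : ℝ) * (t : ℝ) / Real.log (n : ℝ) ^ (d - 1 - j)

end DGraphs

open Filter Topology

namespace DGraphs
-- The process is split at the moment when `t₀ = splitSize a n`, a power of `log n`, edges are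
-- missing.
--
-- Early phase. Every unsaturated vertex is covered by the next edge with chance about `rate`, that
-- is 2 divided by the number of unsaturated vertices (`abs_hit_sub_rate_le`). In the internal time
-- `τ`, the running sum of these rates, degrees below `d` therefore behave like Poisson processes of
-- rate one. Since Poisson weights solve the matching differential equation (`hasDerivAt_poiShift`),
-- the sums `poiSum i` are martingales up to a small drift. Second moments of the martingale part
-- and first moments of the drift, both controlled by the potential `timedPot`, show that `poiSum 0`
-- stays near `n` and the others near 0, outside an event of probability `O(1 / log n)`
-- (`iterate_not_typical_le`). Inverting the Poisson convolution (`degreeCount_eq_sum_poiSum`) gives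
-- `D_i ≈ n e^{-τ} τ^i / i!`. At the split `τ` is `log n` up to `O(log log n)`, and the total degree
-- deficit is `2 t₀` up to parity, so `D_i ≈ 2 t₀ ((d-1)! / i!) / (log n)^{d-1-i}`
-- (`Typical.abs_degreeCount_mul_sub_le`).
--
-- Late phase. Almost all unsaturated vertices now have degree `d - 1`, and with `r` edges missing a
-- vertex is covered with chance about `1 / r`. A vertex of degree `j` thus keeps its degree from
-- `t₀` down to `t` missing edges with chance about `∏ (1 - 1/r) = t / t₀`, and different vertices
-- are nearly independent. Precisely, one step acts on binomial functionals of the number of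
-- survivors as a thinning by `1 - 1/r` (`abs_graphStep_thin_sub_le`). Hence the survivors are
-- nearly binomial with parameters `D_j` and `t / t₀`, so nearly Poisson with mean `t D_j / t₀ ≈ λ`.
-- Vertices arriving from lower degrees are too rare to matter.
--
-- This needs a bounded `λ`. If `λ` is large, following only about `L t₀ / t` of the vertices
-- already shows that `D_j = i` is unlikely, and so does the Poisson weight
-- (`Concentrated.degreeCount_le_sum_poi`).
--
-- Expectations are written as iterates of the averaging operator `avgStep` on functions, so no
-- measure is needed on the infinite state space `TimedGraph`.
/-- The degree of a vertex, with the decidability instances used in the frozen definitions. -/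
noncomputable def deg {n : ℕ} (G : SimpleGraph (Fin n)) (v : Fin n) : ℕ :=
  open Classical in G.degree v

/-- The graph obtained from `G` by adding the pair `e`. -/
def addEdge {n : ℕ} (G : SimpleGraph (Fin n)) (e : Sym2 (Fin n)) : SimpleGraph (Fin n) :=
  G ⊔ SimpleGraph.fromEdgeSet {e}

/-- The vertices of degree less than `d`. -/
noncomputable def unsat {n : ℕ} (d : ℕ) (G : SimpleGraph (Fin n)) : Finset (Fin n) :=
  Finset.univ.filter fun v => deg G v < d

/-! ### Counting addable pairs and the chance that a vertex is covered. -/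

section

open Classical

variable {n d : ℕ} {G : SimpleGraph (Fin n)}

theorem mem_addable {e : Sym2 (Fin n)} :
    e ∈ addable d G ↔ ¬ e.IsDiag ∧ e ∉ G.edgeSet ∧ ∀ v ∈ e, deg G v < d := by
  simp [addable, deg]

theorem mk_mem_addable {a b : Fin n} :
    s(a, b) ∈ addable d G ↔ a ≠ b ∧ ¬ G.Adj a b ∧ deg G a < d ∧ deg G b < d := by
  simp [mem_addable]

theorem deg_eq_card (v : Fin n) : deg G v = (Finset.univ.filter fun w => G.Adj v w).card := by
  rw [deg, ← SimpleGraph.card_neighborFinset_eq_degree]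
  congr 1
  ext w
  simp

theorem deg_addEdge {e : Sym2 (Fin n)} (he : e ∈ addable d G) (v : Fin n) :
    deg (addEdge G e) v = deg G v + if v ∈ e then 1 else 0 := by
  induction e using Sym2.ind with
  | _ a b =>
    obtain ⟨hab, hadj, -, -⟩ := mk_mem_addable.1 he
    have hadj' : ¬ G.Adj b a := fun h => hadj h.symm
    rw [deg_eq_card, deg_eq_card]
    by_cases hva : v = a
    · subst hva
      have : (Finset.univ.filter fun w => (addEdge G s(v, b)).Adj v w)
          = insert b (Finset.univ.filter fun w => G.Adj v w) := by
        ext w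
        simp only [addEdge, SimpleGraph.sup_adj, SimpleGraph.fromEdgeSet_adj, Finset.mem_filter,
          Finset.mem_univ, true_and, Finset.mem_insert, Set.mem_singleton_iff]
        constructor
        · rintro (h | ⟨h, -⟩)
          · exact Or.inr h
          · exact Or.inl (Sym2.congr_right.1 h)
        · rintro (rfl | h)
          · exact Or.inr ⟨rfl, hab⟩
          · exact Or.inl h
      rw [this, Finset.card_insert_of_notMem (by simpa using hadj)]
      simp
    · by_cases hvb : v = b
      · subst hvb
        have : (Finset.univ.filter fun w => (addEdge G s(a, v)).Adj v w)
            = insert a (Finset.univ.filter fun w => G.Adj v w) := by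
          ext w
          simp only [addEdge, SimpleGraph.sup_adj, SimpleGraph.fromEdgeSet_adj, Finset.mem_filter,
            Finset.mem_univ, true_and, Finset.mem_insert, Set.mem_singleton_iff]
          constructor
          · rintro (h | ⟨h, -⟩)
            · exact Or.inr h
            · left
              rw [Sym2.eq_swap (a := a)] at h
              exact Sym2.congr_right.1 h
          · rintro (rfl | h)
            · exact Or.inr ⟨Sym2.eq_swap, hva⟩
            · exact Or.inl h
        rw [this, Finset.card_insert_of_notMem (by simpa using hadj')]
        simp
      · have : (Finset.univ.filter fun w => (addEdge G s(a, b)).Adj v w)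
            = (Finset.univ.filter fun w => G.Adj v w) := by
          ext w
          simp only [addEdge, SimpleGraph.sup_adj, SimpleGraph.fromEdgeSet_adj, Finset.mem_filter,
            Finset.mem_univ, true_and, Set.mem_singleton_iff]
          constructor
          · rintro (h | ⟨h, -⟩)
            · exact h
            · simp [hva, hvb] at h
          · exact Or.inl
        rw [this]
        simp [hva, hvb]

theorem mem_unsat {v : Fin n} : v ∈ unsat d G ↔ deg G v < d := by simp [unsat]

/-- The pairs containing a fixed unsaturated vertex. -/
theorem card_addable_filter_mem {v : Fin n} (hv : deg G v < d) :
    ((addable d G).filter fun e => v ∈ e).card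
      = ((unsat d G).filter fun w => w ≠ v ∧ ¬ G.Adj v w).card := by
  symm
  apply Finset.card_bij (fun w _ => s(v, w))
  · intro w hw
    simp only [Finset.mem_filter, mem_unsat] at hw
    simp only [Finset.mem_filter, mk_mem_addable]
    exact ⟨⟨hw.2.1.symm, hw.2.2, hv, hw.1⟩, by simp⟩
  · intro a _ b _ h
    exact Sym2.congr_right.1 h
  · intro e he
    simp only [Finset.mem_filter] at he
    obtain ⟨he, hve⟩ := he
    obtain ⟨w, rfl⟩ := Sym2.mem_iff_exists.1 hve
    obtain ⟨h1, h2, h3, h4⟩ := mk_mem_addable.1 he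
    exact ⟨w, by simp [mem_unsat, h1.symm, h2, h4], rfl⟩

theorem card_addable_filter_mem_le {v : Fin n} (hv : deg G v < d) :
    ((addable d G).filter fun e => v ∈ e).card + 1 ≤ (unsat d G).card := by
  rw [card_addable_filter_mem hv]
  have : ((unsat d G).filter fun w => w ≠ v ∧ ¬ G.Adj v w) ⊆ (unsat d G).erase v := by
    intro w hw
    simp only [Finset.mem_filter] at hw
    exact Finset.mem_erase.2 ⟨hw.2.1, hw.1⟩
  have h2 := Finset.card_le_card this
  have h3 := Finset.card_erase_add_one (mem_unsat.2 hv)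
  omega

/-- Only `v` and its at most `d - 1` neighbours are barred from being the partner of `v`. -/
theorem card_unsat_le_addable_filter_mem {v : Fin n} (hv : deg G v < d) :
    (unsat d G).card ≤ ((addable d G).filter fun e => v ∈ e).card + d := by
  rw [card_addable_filter_mem hv]
  have : unsat d G ⊆ ((unsat d G).filter fun w => w ≠ v ∧ ¬ G.Adj v w)
      ∪ insert v (Finset.univ.filter fun w => G.Adj v w) := by
    intro w hw
    simp only [Finset.mem_union, Finset.mem_filter, Finset.mem_insert, Finset.mem_univ, true_and]
    tauto
  have h2 := Finset.card_le_card this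
  have h3 := Finset.card_union_le ((unsat d G).filter fun w => w ≠ v ∧ ¬ G.Adj v w)
    (insert v (Finset.univ.filter fun w => G.Adj v w))
  have h4 := Finset.card_insert_le v (Finset.univ.filter fun w => G.Adj v w)
  rw [← deg_eq_card] at h4
  omega

theorem addable_filter_mem_eq_empty {v : Fin n} (hv : ¬ deg G v < d) :
    ((addable d G).filter fun e => v ∈ e) = ∅ := by
  rw [Finset.filter_eq_empty_iff]
  intro e he hve
  exact hv ((mem_addable.1 he).2.2 v hve)

theorem card_filter_mem_of_addable {e : Sym2 (Fin n)} (he : e ∈ addable d G) :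
    (Finset.univ.filter fun v => v ∈ e).card = 2 := by
  induction e using Sym2.ind with
  | _ a b =>
    obtain ⟨hab, -⟩ := mk_mem_addable.1 he
    have : (Finset.univ.filter fun v => v ∈ s(a, b)) = {a, b} := by
      ext w; simp
    rw [this, Finset.card_pair hab]

theorem sum_card_addable_filter_mem :
    ∑ v ∈ unsat d G, ((addable d G).filter fun e => v ∈ e).card = 2 * (addable d G).card := by
  have h1 : ∑ v ∈ unsat d G, ((addable d G).filter fun e => v ∈ e).card
      = ∑ v, ((addable d G).filter fun e => v ∈ e).card := by
    apply Finset.sum_subset (Finset.subset_univ _)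
    intro v _ hv
    rw [mem_unsat] at hv
    rw [addable_filter_mem_eq_empty hv, Finset.card_empty]
  rw [h1]
  simp_rw [Finset.card_filter]
  rw [Finset.sum_comm]
  simp_rw [← Finset.card_filter]
  rw [Finset.sum_congr rfl fun e he => card_filter_mem_of_addable he]
  simp [mul_comm]

theorem card_addable_filter_mem_mem_le_one {v w : Fin n} (hvw : v ≠ w) :
    ((addable d G).filter fun e => v ∈ e ∧ w ∈ e).card ≤ 1 := by
  apply Finset.card_le_one.2
  intro a ha b hb
  simp only [Finset.mem_filter] at ha hb
  rw [(Sym2.mem_and_mem_iff hvw).1 ha.2, (Sym2.mem_and_mem_iff hvw).1 hb.2]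

theorem two_mul_card_addable_le :
    2 * (addable d G).card + (unsat d G).card ≤ (unsat d G).card * (unsat d G).card := by
  rw [← sum_card_addable_filter_mem]
  have : ∑ v ∈ unsat d G, (((addable d G).filter fun e => v ∈ e).card + 1)
      ≤ ∑ v ∈ unsat d G, (unsat d G).card :=
    Finset.sum_le_sum fun v hv => card_addable_filter_mem_le (mem_unsat.1 hv)
  simpa [Finset.sum_add_distrib] using this

theorem le_two_mul_card_addable :
    (unsat d G).card * (unsat d G).card ≤ 2 * (addable d G).card + (unsat d G).card * d := by
  rw [← sum_card_addable_filter_mem]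
  have : ∑ v ∈ unsat d G, (unsat d G).card
      ≤ ∑ v ∈ unsat d G, (((addable d G).filter fun e => v ∈ e).card + d) :=
    Finset.sum_le_sum fun v hv => card_unsat_le_addable_filter_mem (mem_unsat.1 hv)
  simpa [Finset.sum_add_distrib] using this

/-- The probability that the vertex `v` is covered by the next edge. -/
noncomputable def hit (d : ℕ) (G : SimpleGraph (Fin n)) (v : Fin n) : ℝ :=
  (((addable d G).filter fun e => v ∈ e).card : ℝ) / (addable d G).card

/-- Twice the inverse of the number of unsaturated vertices. -/
noncomputable def rate (d : ℕ) (G : SimpleGraph (Fin n)) : ℝ := 2 / (unsat d G).card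

theorem hit_nonneg (v : Fin n) : 0 ≤ hit d G v := by unfold hit; positivity

theorem addable_pos (hd : 1 ≤ d) (hU : 2 * d ≤ (unsat d G).card) : 0 < (addable d G).card := by
  have := le_two_mul_card_addable (d := d) (G := G)
  by_contra h
  have h0 : (addable d G).card = 0 := by omega
  rw [h0] at this
  have : (unsat d G).card * (2 * d) ≤ (unsat d G).card * (unsat d G).card :=
    Nat.mul_le_mul_left _ hU
  nlinarith

/-- With `u` unsaturated vertices and `E` addable pairs, `2E ≥ u(u - d) ≥ u²/2` once `u ≥ 2d`. -/
theorem inv_card_addable_le (hd : 1 ≤ d) (hU : 2 * d ≤ (unsat d G).card) :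
    ((addable d G).card : ℝ)⁻¹ ≤ rate d G ^ 2 := by
  have h1 := le_two_mul_card_addable (d := d) (G := G)
  have h2 := addable_pos hd hU
  have h3 : ((unsat d G).card : ℝ) * (unsat d G).card
    ≤ 2 * (addable d G).card + (unsat d G).card * d := by exact_mod_cast h1
  have h4 : (2 * d : ℝ) ≤ (unsat d G).card := by exact_mod_cast hU
  have h5 : (1 : ℝ) ≤ d := by exact_mod_cast hd
  have h6 : (0 : ℝ) < (addable d G).card := by exact_mod_cast h2
  unfold rate
  set u : ℝ := ((unsat d G).card : ℝ)
  have hu : 0 < u := by linarith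
  rw [div_pow, inv_eq_one_div, div_le_div_iff₀ h6 (by positivity)]
  nlinarith

theorem rate_nonneg : 0 ≤ rate d G := by unfold rate; positivity

theorem rate_le_one (hd : 1 ≤ d) (hU : 2 * d ≤ (unsat d G).card) : rate d G ≤ 1 := by
  have h4 : (2 * d : ℝ) ≤ (unsat d G).card := by exact_mod_cast hU
  have h5 : (1 : ℝ) ≤ d := by exact_mod_cast hd
  unfold rate
  rw [div_le_one (by linarith)]
  linarith

/-- With `c` partners of `v`, both `c` and the mean `2E/u` lie in `[u - d, u - 1]`, so they differ
by at most `d`; dividing by `E ≥ u²/4` gives the bound. -/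
theorem abs_hit_sub_rate_le (hd : 1 ≤ d) (hU : 2 * d ≤ (unsat d G).card) {v : Fin n}
    (hv : deg G v < d) : |hit d G v - rate d G| ≤ d * rate d G ^ 2 := by
  have h1 := le_two_mul_card_addable (d := d) (G := G)
  have h1' := two_mul_card_addable_le (d := d) (G := G)
  have h2 := addable_pos hd hU
  have h3 : ((unsat d G).card : ℝ) * (unsat d G).card
    ≤ 2 * (addable d G).card + (unsat d G).card * d := by exact_mod_cast h1
  have h3' : 2 * (addable d G).card + (unsat d G).card
    ≤ ((unsat d G).card : ℝ) * (unsat d G).card := by exact_mod_cast h1'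
  have h4 : (2 * d : ℝ) ≤ (unsat d G).card := by exact_mod_cast hU
  have h5 : (1 : ℝ) ≤ d := by exact_mod_cast hd
  have h6 : (0 : ℝ) < (addable d G).card := by exact_mod_cast h2
  have h7 : (((addable d G).filter fun e => v ∈ e).card : ℝ) + 1 ≤ (unsat d G).card := by
    exact_mod_cast card_addable_filter_mem_le hv
  have h8 : ((unsat d G).card : ℝ) ≤ ((addable d G).filter fun e => v ∈ e).card + d := by
    exact_mod_cast card_unsat_le_addable_filter_mem hv
  unfold rate hit
  set u : ℝ := ((unsat d G).card : ℝ)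
  set c : ℝ := (((addable d G).filter fun e => v ∈ e).card : ℝ)
  set E : ℝ := ((addable d G).card : ℝ)
  have hu : 0 < u := by linarith
  have h9 : c / E - 2 / u = (c * u - 2 * E) / (E * u) := by field_simp
  have h10 : |c * u - 2 * E| ≤ d * u := by
    rw [abs_le]; constructor <;> nlinarith
  rw [h9, abs_div, abs_of_pos (show 0 < E * u by positivity), div_pow, div_le_iff₀ (by positivity)]
  refine h10.trans ?_
  have : (d : ℝ) * (2 ^ 2 / u ^ 2) * (E * u) = d * (4 * E / u) := by field_simp; ring
  rw [this]
  have h11 : u ≤ 4 * E / u := by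
    rw [le_div_iff₀ hu]; nlinarith
  nlinarith

/-- The average of a function on a finite set. -/
noncomputable def favg {α : Type*} (E : Finset α) (F : α → ℝ) : ℝ := (∑ e ∈ E, F e) / E.card

section favg

variable {α : Type*} {E : Finset α} {F H : α → ℝ}

theorem favg_mono (h : ∀ e ∈ E, F e ≤ H e) : favg E F ≤ favg E H := by
  unfold favg
  have := Finset.sum_le_sum h
  gcongr

theorem favg_congr (h : ∀ e ∈ E, F e = H e) : favg E F = favg E H := by
  unfold favg
  rw [Finset.sum_congr rfl h]

theorem favg_add : favg E (fun e => F e + H e) = favg E F + favg E H := by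
  simp [favg, Finset.sum_add_distrib, add_div]

theorem favg_sub : favg E (fun e => F e - H e) = favg E F - favg E H := by
  simp [favg, Finset.sum_sub_distrib, sub_div]

theorem favg_const_mul (c : ℝ) : favg E (fun e => c * F e) = c * favg E F := by
  simp [favg, ← Finset.mul_sum, mul_div_assoc]

theorem favg_const (hE : 0 < E.card) (c : ℝ) : favg E (fun _ => c) = c := by
  have : (E.card : ℝ) ≠ 0 := by positivity
  simp [favg]
  field_simp

theorem favg_sum {ι : Type*} (s : Finset ι) (f : ι → α → ℝ) :
    favg E (fun e => ∑ i ∈ s, f i e) = ∑ i ∈ s, favg E (f i) := by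
  simp only [favg]
  rw [Finset.sum_comm, Finset.sum_div]

end favg

theorem favg_mem (v : Fin n) :
    favg (addable d G) (fun e => if v ∈ e then 1 else 0) = hit d G v := by
  simp [favg, hit]

theorem favg_mem_mem_le (hd : 1 ≤ d) (hU : 2 * d ≤ (unsat d G).card) {v w : Fin n} (hvw : v ≠ w) :
    favg (addable d G) (fun e => (if v ∈ e then 1 else 0) * (if w ∈ e then 1 else 0))
      ≤ rate d G ^ 2 := by
  refine le_trans ?_ (inv_card_addable_le hd hU)
  have h2 := addable_pos hd hU
  have h6 : (0 : ℝ) < (addable d G).card := by exact_mod_cast h2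
  have h1 : (((addable d G).filter fun e => v ∈ e ∧ w ∈ e).card : ℝ) ≤ 1 := by
    exact_mod_cast card_addable_filter_mem_mem_le_one hvw
  have : favg (addable d G) (fun e => (if v ∈ e then (1 : ℝ) else 0) * (if w ∈ e then 1 else 0))
      = (((addable d G).filter fun e => v ∈ e ∧ w ∈ e).card : ℝ) / (addable d G).card := by
    simp only [favg, Finset.card_filter]
    push_cast
    congr 1
    apply Finset.sum_congr rfl
    intro e _
    by_cases h1 : v ∈ e <;> by_cases h2 : w ∈ e <;> simp [h1, h2]
  rw [this, inv_eq_one_div]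
  gcongr

end

/-! ### The process as an averaging operator on functions of the state. -/

section

open Classical

variable {n d : ℕ} {σ : Type*}

/-- The averaging operator of a chain on `σ` driven by the `d`-process: `gr` reads off the current
graph, and `upd` updates the state once the next edge is known. -/
noncomputable def avgStep (d : ℕ) (gr : σ → SimpleGraph (Fin n)) (upd : σ → Sym2 (Fin n) → σ)
    (F : σ → ℝ) (x : σ) : ℝ :=
  if (addable d (gr x)).Nonempty then favg (addable d (gr x)) (fun e => F (upd x e)) else F x

/-- The averaging operator of the `d`-process itself. -/
noncomputable def graphStep (d : ℕ) : (SimpleGraph (Fin n) → ℝ) → SimpleGraph (Fin n) → ℝ :=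
  avgStep d id addEdge

section avgStep

variable {gr : σ → SimpleGraph (Fin n)} {upd : σ → Sym2 (Fin n) → σ} {F H : σ → ℝ}

theorem avgStep_eq {x : σ} (h : 0 < (addable d (gr x)).card) :
    avgStep d gr upd F x = favg (addable d (gr x)) (fun e => F (upd x e)) := by
  rw [avgStep, if_pos (Finset.card_pos.1 h)]

/-- `Inv k x` is preserved by the chain up to time `s`, and the chain is never stuck. -/
structure Invariant (d : ℕ) (gr : σ → SimpleGraph (Fin n)) (upd : σ → Sym2 (Fin n) → σ)
    (Inv : ℕ → σ → Prop) (s : ℕ) : Prop where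
  pos : ∀ k < s, ∀ x, Inv k x → 0 < (addable d (gr x)).card
  next : ∀ k < s, ∀ x, Inv k x → ∀ e ∈ addable d (gr x), Inv (k + 1) (upd x e)

theorem Invariant.mono {Inv : ℕ → σ → Prop} {s s' : ℕ} (h : Invariant d gr upd Inv s)
    (hs : s' ≤ s) : Invariant d gr upd Inv s' :=
  ⟨fun k hk => h.pos k (by omega), fun k hk => h.next k (by omega)⟩

theorem Invariant.shift {Inv : ℕ → σ → Prop} {s : ℕ} (h : Invariant d gr upd Inv (s + 1)) :
    Invariant d gr upd (fun k => Inv (k + 1)) s :=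
  ⟨fun k hk => h.pos (k + 1) (by omega), fun k hk => h.next (k + 1) (by omega)⟩

/-- Only states satisfying the invariant can be reached, so the comparison is needed only there. The
induction peels off the first step, hence the shift of the time index. -/
theorem iterate_mono {Inv : ℕ → σ → Prop} {s : ℕ} (hI : Invariant d gr upd Inv s) {x : σ}
    (hx : Inv 0 x) (h : ∀ y, Inv s y → F y ≤ H y) :
    (avgStep d gr upd)^[s] F x ≤ (avgStep d gr upd)^[s] H x := by
  induction s generalizing Inv x with
  | zero => simpa using h x hx
  | succ s ih =>
    rw [Function.iterate_succ_apply', Function.iterate_succ_apply',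
      avgStep_eq (hI.pos 0 (by omega) x hx), avgStep_eq (hI.pos 0 (by omega) x hx)]
    apply favg_mono
    intro e he
    exact ih hI.shift (hI.next 0 (by omega) x hx e he) h

theorem avgStep_add : avgStep d gr upd (F + H) = avgStep d gr upd F + avgStep d gr upd H := by
  funext x
  by_cases h : (addable d (gr x)).Nonempty
  · simp [avgStep, h, favg_add]
  · simp [avgStep, h]

theorem avgStep_const_mul (c : ℝ) :
    avgStep d gr upd (fun x => c * F x) = fun x => c * avgStep d gr upd F x := by
  funext x
  by_cases h : (addable d (gr x)).Nonempty
  · simp [avgStep, h, favg_const_mul]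
  · simp [avgStep, h]

theorem iterate_add (s : ℕ) : (avgStep d gr upd)^[s] (F + H)
    = (avgStep d gr upd)^[s] F + (avgStep d gr upd)^[s] H := by
  induction s generalizing F H with
  | zero => rfl
  | succ s ih => simp only [Function.iterate_succ_apply, avgStep_add, ih]

theorem iterate_const_mul (c : ℝ) (s : ℕ) : (avgStep d gr upd)^[s] (fun x => c * F x)
    = fun x => c * (avgStep d gr upd)^[s] F x := by
  induction s generalizing F with
  | zero => rfl
  | succ s ih => simp only [Function.iterate_succ_apply, avgStep_const_mul, ih]

theorem avgStep_const (c : ℝ) : avgStep d gr upd (fun _ => c) = fun _ => c := by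
  funext x
  by_cases h : (addable d (gr x)).Nonempty
  · simp [avgStep, h, favg_const (Finset.card_pos.2 h)]
  · simp [avgStep, h]

theorem iterate_const (c : ℝ) (s : ℕ) : (avgStep d gr upd)^[s] (fun _ => c) = fun _ => c := by
  induction s with
  | zero => rfl
  | succ s ih => simp only [Function.iterate_succ_apply, avgStep_const, ih]

theorem iterate_sum {ι : Type*} (t : Finset ι) (f : ι → σ → ℝ) (s : ℕ) (x : σ) :
    (avgStep d gr upd)^[s] (fun y => ∑ i ∈ t, f i y) x
      = ∑ i ∈ t, (avgStep d gr upd)^[s] (f i) x := by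
  induction t using Finset.induction_on with
  | empty => simp [iterate_const]
  | insert a t ha ih =>
    simp only [Finset.sum_insert ha]
    rw [← ih]
    exact congrFun (iterate_add (F := f a) (H := fun y => ∑ i ∈ t, f i y) s) x

/-- Summing up one-step errors along the chain. -/
theorem iterate_le_add_sum {Inv : ℕ → σ → Prop} {s : ℕ} (hI : Invariant d gr upd Inv s) {x : σ}
    (hx : Inv 0 x) (F E : ℕ → σ → ℝ)
    (h : ∀ k < s, ∀ y, Inv k y → avgStep d gr upd (F (k + 1)) y ≤ F k y + E k y) :
    (avgStep d gr upd)^[s] (F s) x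
      ≤ F 0 x + ∑ k ∈ Finset.range s, (avgStep d gr upd)^[k] (E k) x := by
  induction s with
  | zero => simp
  | succ s ih =>
    have h1 := ih (hI.mono (by omega)) fun k hk => h k (by omega)
    rw [Function.iterate_succ_apply, Finset.sum_range_succ, ← add_assoc]
    refine le_trans ?_ (add_le_add_left h1 _)
    have h2 := iterate_add (d := d) (gr := gr) (upd := upd) (F := F s) (H := E s) s
    have h3 : (avgStep d gr upd)^[s] (F s) x + (avgStep d gr upd)^[s] (E s) x
      = (avgStep d gr upd)^[s] (F s + E s) x := by rw [h2]; rfl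
    rw [h3]
    exact iterate_mono (hI.mono (by omega)) hx fun y hy => h s (by omega) y hy

theorem iterate_le_of_super {Inv : ℕ → σ → Prop} {s : ℕ} (hI : Invariant d gr upd Inv s) {x : σ}
    (hx : Inv 0 x) (F : ℕ → σ → ℝ)
    (h : ∀ k < s, ∀ y, Inv k y → avgStep d gr upd (F (k + 1)) y ≤ F k y) :
    (avgStep d gr upd)^[s] (F s) x ≤ F 0 x := by
  have := iterate_le_add_sum hI hx F (fun _ _ => 0) (by simpa using h)
  simpa [iterate_const] using this

/-- Additional coordinates of the state do not influence the law of the graph. -/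
theorem iterate_comp_gr (hupd : ∀ x e, gr (upd x e) = addEdge (gr x) e)
    (F : SimpleGraph (Fin n) → ℝ) (s : ℕ) :
    (avgStep d gr upd)^[s] (fun x => F (gr x)) = fun x => (graphStep d)^[s] F (gr x) := by
  induction s generalizing F with
  | zero => rfl
  | succ s ih =>
    rw [Function.iterate_succ_apply, Function.iterate_succ_apply]
    rw [← ih]
    congr 1
    funext x
    simp only [graphStep, avgStep, hupd]
    rfl

end avgStep

/-- Expectation of a real function on a finite type. -/
noncomputable def expect {α : Type*} [Fintype α] (p : PMF α) (F : α → ℝ) : ℝ :=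
  ∑ x, (p x).toReal * F x

section expect

variable {α β : Type*} [Fintype α] [Fintype β]

theorem expect_pure (x : α) (F : α → ℝ) : expect (PMF.pure x) F = F x := by
  unfold expect
  rw [Finset.sum_eq_single x]
  · simp
  · intro b _ hb
    simp [PMF.pure_apply, hb]
  · simp

theorem expect_bind (p : PMF α) (k : α → PMF β) (F : β → ℝ) :
    expect (p.bind k) F = expect p fun x => expect (k x) F := by
  unfold expect
  simp only [PMF.bind_apply, tsum_fintype, Finset.mul_sum]
  rw [Finset.sum_comm]
  apply Finset.sum_congr rfl
  intro G _
  rw [ENNReal.toReal_sum, Finset.sum_mul]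
  · apply Finset.sum_congr rfl
    intro G' _
    rw [ENNReal.toReal_mul, mul_assoc]
  · intro G' _
    exact ENNReal.mul_ne_top (PMF.apply_ne_top _ _) (PMF.apply_ne_top _ _)

theorem expect_map (p : PMF α) (f : α → β) (F : β → ℝ) :
    expect (p.map f) F = expect p fun x => F (f x) := by
  rw [PMF.map, expect_bind]
  simp only [Function.comp_apply, expect_pure]

theorem expect_uniformOfFinset (E : Finset α) (hE : E.Nonempty) (F : α → ℝ) :
    expect (PMF.uniformOfFinset E hE) F = favg E F := by
  unfold expect favg
  rw [Finset.sum_div, ← Finset.sum_subset (Finset.subset_univ E)]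
  · apply Finset.sum_congr rfl
    intro e he
    rw [PMF.uniformOfFinset_apply_of_mem hE he]
    simp [div_eq_inv_mul]
  · intro e _ he
    rw [PMF.uniformOfFinset_apply_of_notMem hE he]
    simp

end expect

theorem expect_step (G : SimpleGraph (Fin n)) (F : SimpleGraph (Fin n) → ℝ) :
    expect (step d G) F = graphStep d F G := by
  unfold step graphStep avgStep
  by_cases h : (addable d G).Nonempty
  · rw [dif_pos h, expect_map, expect_uniformOfFinset]
    exact (if_pos h).symm
  · rw [dif_neg h, expect_pure]
    exact (if_neg h).symm

/-- `graphLaw` appends the last step, and the last step is the one that acts first on `F`. -/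
theorem expect_graphLaw (s : ℕ) (F : SimpleGraph (Fin n) → ℝ) :
    expect (graphLaw d n s) F = (graphStep d)^[s] F ⊥ := by
  induction s generalizing F with
  | zero => simp [graphLaw, expect_pure]
  | succ s ih =>
    rw [graphLaw, expect_bind, Function.iterate_succ_apply, ← ih]
    simp only [expect_step]

theorem degreeCountLaw_toReal (j s i : ℕ) :
    (degreeCountLaw d n j s i).toReal
      = (graphStep d)^[s] (fun G : SimpleGraph (Fin n) => if degreeCount j G = i then 1 else 0) ⊥ := by
  rw [← expect_graphLaw, degreeCountLaw, PMF.map_apply, tsum_fintype, ENNReal.toReal_sum]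
  · unfold expect
    apply Finset.sum_congr rfl
    intro G _
    by_cases h : i = degreeCount j G
    · simp [h]
    · simp [h, Ne.symm h]
  · intro G _
    split_ifs
    · exact PMF.apply_ne_top _ _
    · simp

theorem degreeCount_eq (j : ℕ) (G : SimpleGraph (Fin n)) :
    degreeCount j G = (Finset.univ.filter fun v => deg G v = j).card := rfl

/-! ### Bounds that hold surely when the number of edges is known. -/

/-- The number of edges of `G` is `s` and all degrees are at most `d`. -/
structure Valid (d s : ℕ) (G : SimpleGraph (Fin n)) : Prop where
  le : ∀ v, deg G v ≤ d
  sum : ∑ v, deg G v = 2 * s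

theorem valid_bot : Valid d 0 (⊥ : SimpleGraph (Fin n)) := by
  constructor <;> simp [deg]

theorem Valid.addEdge {s : ℕ} {G : SimpleGraph (Fin n)} (h : Valid d s G) {e : Sym2 (Fin n)}
    (he : e ∈ addable d G) : Valid d (s + 1) (addEdge G e) := by
  constructor
  · intro v
    rw [deg_addEdge he]
    split_ifs with hv
    · exact (mem_addable.1 he).2.2 v hv
    · exact h.le v
  · simp only [deg_addEdge he, Finset.sum_add_distrib, h.sum]
    rw [← Finset.card_filter, card_filter_mem_of_addable he]
    ring

/-- When `s + r = d * n / 2`, the total deficit is `2r` or `2r + 1` according to the parity of `d *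
n`. All later bounds on the number of unsaturated vertices come from this. -/
theorem Valid.sum_deficit {s : ℕ} {G : SimpleGraph (Fin n)} (h : Valid d s G) :
    ∑ v, (d - deg G v) + 2 * s = d * n := by
  rw [← h.sum, ← Finset.sum_add_distrib]
  rw [Finset.sum_congr rfl fun v _ => Nat.sub_add_cancel (h.le v)]
  simp [mul_comm]

theorem Valid.card_unsat_le {s r : ℕ} {G : SimpleGraph (Fin n)} (h : Valid d s G)
    (hr : s + r = d * n / 2) : (unsat d G).card ≤ 2 * r + 1 := by
  have h1 := h.sum_deficit
  have h2 : (unsat d G).card ≤ ∑ v, (d - deg G v) := by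
    rw [Finset.card_eq_sum_ones]
    refine (Finset.sum_le_sum fun v hv => ?_).trans
      (Finset.sum_le_sum_of_subset (Finset.subset_univ (unsat d G)))
    have := mem_unsat.1 hv
    omega
  omega

theorem Valid.le_mul_card_unsat {s r : ℕ} {G : SimpleGraph (Fin n)} (h : Valid d s G)
    (hr : s + r = d * n / 2) : 2 * r ≤ d * (unsat d G).card := by
  have h1 := h.sum_deficit
  have h2 : ∑ v, (d - deg G v) ≤ d * (unsat d G).card := by
    have : ∑ v, (d - deg G v) = ∑ v ∈ unsat d G, (d - deg G v) := by
      symm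
      apply Finset.sum_subset (Finset.subset_univ _)
      intro v _ hv
      rw [mem_unsat] at hv
      omega
    rw [this]
    refine (Finset.sum_le_card_nsmul _ _ d fun v _ => Nat.sub_le _ _).trans ?_
    simp [mul_comm]
  omega

/-- The number of vertices of degree at most `d - 2`. -/
noncomputable def lowCount (d : ℕ) (G : SimpleGraph (Fin n)) : ℕ :=
  (Finset.univ.filter fun v => deg G v + 2 ≤ d).card

/-- A vertex of degree `d - 1` has deficit one, so only vertices of lower degree keep the number of
unsaturated vertices away from `2r`. -/
theorem Valid.le_card_unsat_add {s r : ℕ} {G : SimpleGraph (Fin n)} (h : Valid d s G)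
    (hr : s + r = d * n / 2) : 2 * r ≤ (unsat d G).card + d * lowCount d G := by
  have h1 := h.sum_deficit
  have h2 : ∑ v, (d - deg G v) ≤ (unsat d G).card + d * lowCount d G := by
    rw [unsat, lowCount, Finset.card_filter, Finset.card_filter, Finset.mul_sum,
      ← Finset.sum_add_distrib]
    apply Finset.sum_le_sum
    intro v _
    split_ifs <;> omega
  omega

/-- Source of the recurring condition `d * d ≤ r`: it guarantees that the process is not stuck. -/
theorem Valid.two_mul_le_card_unsat {s r : ℕ} {G : SimpleGraph (Fin n)} (hd : 1 ≤ d)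
    (h : Valid d s G)
    (hr : s + r = d * n / 2) (hrd : d * d ≤ r) : 2 * d ≤ (unsat d G).card := by
  have h1 := h.le_mul_card_unsat hr
  by_contra hlt
  have : d * (unsat d G).card < d * (2 * d) := Nat.mul_lt_mul_of_pos_left (by omega) (by omega)
  nlinarith

theorem Valid.rate_le {s r : ℕ} {G : SimpleGraph (Fin n)}
    (h : Valid d s G) (hr : s + r = d * n / 2) (hr0 : 0 < r) : rate d G ≤ d / r := by
  have h1 := h.le_mul_card_unsat hr
  have h2 : (2 * r : ℝ) ≤ d * (unsat d G).card := by exact_mod_cast h1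
  have hr' : (0 : ℝ) < r := by exact_mod_cast hr0
  have hu : (0 : ℝ) < (unsat d G).card := by
    rcases Nat.eq_zero_or_pos (unsat d G).card with h0 | h0
    · rw [h0] at h2; simp at h2; linarith
    · exact_mod_cast h0
  unfold rate
  rw [div_le_div_iff₀ hu hr']
  linarith

theorem Valid.le_rate {s r : ℕ} {G : SimpleGraph (Fin n)} (h : Valid d s G)
    (hr : s + r = d * n / 2) (hu : 0 < (unsat d G).card) :
    2 / (2 * r + 1) ≤ rate d G := by
  have h1 : ((unsat d G).card : ℝ) ≤ 2 * r + 1 := by exact_mod_cast h.card_unsat_le hr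
  have hu' : (0 : ℝ) < (unsat d G).card := by exact_mod_cast hu
  unfold rate
  gcongr

end

/-! ### Taylor estimates and Poisson weights. -/

theorem abs_sub_le_of_abs_deriv_le {f f' : ℝ → ℝ} {x y M : ℝ}
    (hf : ∀ z ∈ Set.uIcc x y, HasDerivAt f (f' z) z) (hM : ∀ z ∈ Set.uIcc x y, |f' z| ≤ M) :
    |f y - f x| ≤ M * |y - x| := by
  have := (convex_uIcc x y).norm_image_sub_le_of_norm_hasDerivWithin_le (f := f) (f' := f')
    (C := M) (fun z hz => (hf z hz).hasDerivWithinAt) (fun z hz => by simpa using hM z hz)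
    Set.left_mem_uIcc Set.right_mem_uIcc
  simpa using this

theorem abs_taylor_le {f f' f'' : ℝ → ℝ} {x y M : ℝ}
    (hf : ∀ z ∈ Set.uIcc x y, HasDerivAt f (f' z) z)
    (hf' : ∀ z ∈ Set.uIcc x y, HasDerivAt f' (f'' z) z)
    (hM : ∀ z ∈ Set.uIcc x y, |f'' z| ≤ M) :
    |f y - f x - (y - x) * f' x| ≤ M * (y - x) ^ 2 := by
  have hM0 : 0 ≤ M := (abs_nonneg _).trans (hM x Set.left_mem_uIcc)
  have h1 : ∀ z ∈ Set.uIcc x y, |f' z - f' x| ≤ M * |y - x| := by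
    intro z hz
    have hsub : Set.uIcc x z ⊆ Set.uIcc x y := Set.uIcc_subset_uIcc_left hz
    refine (abs_sub_le_of_abs_deriv_le (fun w hw => hf' w (hsub hw))
      (fun w hw => hM w (hsub hw))).trans ?_
    have := Set.abs_sub_left_of_mem_uIcc hz
    gcongr
  have h2 := abs_sub_le_of_abs_deriv_le (f := fun z => f z - z * f' x)
    (f' := fun z => f' z - f' x) (x := x) (y := y) (M := M * |y - x|)
    (fun z hz => ((hf z hz).sub ((hasDerivAt_id z).mul_const (f' x))).congr_deriv
      (by rw [one_mul])) h1
  have h3 : f y - f x - (y - x) * f' x = f y - y * f' x - (f x - x * f' x) := by ring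
  rw [h3]
  refine h2.trans (le_of_eq ?_)
  rw [mul_assoc, ← abs_mul, ← sq, abs_of_nonneg (sq_nonneg _)]

/-- The Poisson weight `e^{-x} x^m / m!`, for real `x`. -/
noncomputable def poi (m : ℕ) (x : ℝ) : ℝ := Real.exp (-x) * x ^ m / m.factorial

/-- The weight that `y` plus a Poisson variable of mean `x` equals `i`. -/
noncomputable def poiShift (i y : ℕ) (x : ℝ) : ℝ := if y ≤ i then poi (i - y) x else 0

theorem poiShift_zero (i : ℕ) (x : ℝ) : poiShift i 0 x = poi i x := by simp [poiShift]

theorem poiShift_of_lt {i y : ℕ} (h : i < y) (x : ℝ) : poiShift i y x = 0 := by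
  simp [poiShift, h]

theorem hasDerivAt_poi_zero (x : ℝ) : HasDerivAt (poi 0) (-poi 0 x) x := by
  have : poi 0 = fun x => Real.exp (-x) := by
    funext x; simp [poi]
  rw [this]
  simpa using (hasDerivAt_neg x).exp

theorem hasDerivAt_poi_succ (m : ℕ) (x : ℝ) :
    HasDerivAt (poi (m + 1)) (poi m x - poi (m + 1) x) x := by
  have h1 := (((hasDerivAt_neg x).exp).mul (hasDerivAt_pow (m + 1) x)).div_const
    ((m + 1).factorial : ℝ)
  refine h1.congr_deriv ?_
  have hm : (m.factorial : ℝ) ≠ 0 := by positivity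
  have hm' : ((m : ℝ) + 1) ≠ 0 := by positivity
  simp only [poi, Nat.factorial_succ]
  push_cast
  field_simp
  ring

/-- Differentiating in the mean is taking a forward difference in the starting point (the backward
equation of the Poisson process). This makes `poiSum` nearly a martingale, and it matches `thin`
with Poisson weights. -/
theorem hasDerivAt_poiShift (i y : ℕ) (x : ℝ) :
    HasDerivAt (poiShift i y) (poiShift i (y + 1) x - poiShift i y x) x := by
  rcases lt_trichotomy y i with h | h | h
  · obtain ⟨m, rfl⟩ : ∃ m, i = y + 1 + m := ⟨i - y - 1, by omega⟩
    have h1 : poiShift (y + 1 + m) y = poi (m + 1) := by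
      funext x
      rw [poiShift, if_pos (by omega)]
      congr 1; omega
    have h2 : poiShift (y + 1 + m) (y + 1) = poi m := by
      funext x
      rw [poiShift, if_pos (by omega)]
      congr 1; omega
    rw [h1, h2]
    exact hasDerivAt_poi_succ m x
  · subst h
    have h1 : poiShift y y = poi 0 := by
      funext x
      simp [poiShift]
    rw [h1, poiShift_of_lt (by omega), zero_sub]
    exact hasDerivAt_poi_zero x
  · have h1 : poiShift i y = fun _ => 0 := by
      funext x; exact poiShift_of_lt h x
    rw [h1, poiShift_of_lt (by omega), sub_zero]
    exact hasDerivAt_const x 0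

theorem abs_poiShift_taylor_le {i y : ℕ} {x x' M : ℝ}
    (hM : ∀ y, ∀ z ∈ Set.uIcc x x', |poiShift i y z| ≤ M) :
    |poiShift i y x' - poiShift i y x - (x' - x) * (poiShift i (y + 1) x - poiShift i y x)|
      ≤ 4 * M * (x' - x) ^ 2 := by
  apply abs_taylor_le (f' := fun z => poiShift i (y + 1) z - poiShift i y z)
    (f'' := fun z => (poiShift i (y + 1 + 1) z - poiShift i (y + 1) z)
      - (poiShift i (y + 1) z - poiShift i y z))
  · exact fun z _ => hasDerivAt_poiShift i y z
  · exact fun z _ => (hasDerivAt_poiShift i (y + 1) z).sub (hasDerivAt_poiShift i y z)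
  · intro z hz
    have h0 := abs_le.1 (hM y z hz)
    have h1 := abs_le.1 (hM (y + 1) z hz)
    have h2 := abs_le.1 (hM (y + 1 + 1) z hz)
    rw [abs_le]; constructor <;> linarith

theorem poi_nonneg (m : ℕ) {x : ℝ} (hx : 0 ≤ x) : 0 ≤ poi m x := by
  unfold poi; positivity

theorem poi_le_one (m : ℕ) {x : ℝ} (hx : 0 ≤ x) : poi m x ≤ 1 := by
  have := Real.pow_div_factorial_le_exp x hx m
  rw [poi, mul_div_assoc, Real.exp_neg]
  rw [inv_mul_le_iff₀ (Real.exp_pos x)]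
  simpa using this

theorem abs_poiShift_le_one (i y : ℕ) {x : ℝ} (hx : 0 ≤ x) : |poiShift i y x| ≤ 1 := by
  unfold poiShift
  split_ifs
  · rw [abs_of_nonneg (poi_nonneg _ hx)]
    exact poi_le_one _ hx
  · simp

/-- Negative arguments occur because `poiSum` runs the Poisson flow backwards by the time `τ`. -/
theorem abs_poiShift_neg_le {i d y : ℕ} (hi : i ≤ d) {x T : ℝ} (hx : 0 ≤ x) (hT : x ≤ T) :
    |poiShift i y (-x)| ≤ Real.exp T * (1 + T) ^ d := by
  unfold poiShift
  split_ifs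
  · rw [poi, neg_neg, abs_div, abs_mul, abs_pow, abs_neg, abs_of_nonneg hx,
      abs_of_pos (Real.exp_pos x), Nat.abs_cast]
    have h1 : (1 : ℝ) ≤ (i - y).factorial := by exact_mod_cast Nat.one_le_of_lt (Nat.factorial_pos _)
    have h2 : x ^ (i - y) ≤ (1 + T) ^ d :=
      calc x ^ (i - y) ≤ (1 + T) ^ (i - y) := by gcongr; linarith
        _ ≤ (1 + T) ^ d := pow_le_pow_right₀ (by linarith) (by omega)
    have h3 : Real.exp x ≤ Real.exp T := Real.exp_le_exp.2 hT
    refine (div_le_self (by positivity) h1).trans ?_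
    gcongr
  · have : 0 ≤ T := hx.trans hT
    rw [abs_zero]
    positivity

theorem abs_poi_sub_le (i : ℕ) {x y : ℝ} (hx : 0 ≤ x) (hy : 0 ≤ y) :
    |poi i y - poi i x| ≤ 2 * |y - x| := by
  have h := abs_sub_le_of_abs_deriv_le (f := poiShift i 0)
    (f' := fun z => poiShift i (0 + 1) z - poiShift i 0 z) (x := x) (y := y) (M := 2)
    (fun z _ => hasDerivAt_poiShift i 0 z) (fun z hz => by
      have hz0 : 0 ≤ z := le_trans (le_min hx hy) hz.1
      have h0 := abs_le.1 (abs_poiShift_le_one i 0 hz0)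
      have h1 := abs_le.1 (abs_poiShift_le_one i (0 + 1) hz0)
      rw [abs_le]; constructor <;> linarith)
  simpa [poiShift_zero] using h

theorem tendsto_poi_atTop (i : ℕ) : Tendsto (poi i) atTop (𝓝 0) := by
  have h := (Real.tendsto_pow_mul_exp_neg_atTop_nhds_zero i).div_const (i.factorial : ℝ)
  rw [zero_div] at h
  refine h.congr fun x => ?_
  rw [poi, mul_comm]

/-! ### Binomial thinning and its comparison with Poisson weights. -/

/-- `thin g q x y` is the mean of `g (y + X)` for a binomial variable `X` with `x` trials of
success probability `q`. -/
def thin (g : ℕ → ℝ) (q : ℝ) : ℕ → ℕ → ℝ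
  | 0, y => g y
  | x + 1, y => (1 - q) * thin g q x y + q * thin g q x (y + 1)

section thin

variable {g : ℕ → ℝ} {q : ℝ}

theorem thin_one (x y : ℕ) : thin g 1 x y = g (y + x) := by
  induction x generalizing y with
  | zero => rfl
  | succ x ih => simp [thin, ih]; congr 1; omega

theorem abs_convex_comb_le {a b M q : ℝ} (hq0 : 0 ≤ q) (hq1 : q ≤ 1) (ha : |a| ≤ M) (hb : |b| ≤ M) :
    |(1 - q) * a + q * b| ≤ M := by
  rw [abs_le] at *
  constructor <;> nlinarith

theorem abs_thin_le (hg : ∀ y, |g y| ≤ 1) (hq0 : 0 ≤ q) (hq1 : q ≤ 1) (x y : ℕ) :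
    |thin g q x y| ≤ 1 := by
  induction x generalizing y with
  | zero => exact hg y
  | succ x ih => exact abs_convex_comb_le hq0 hq1 (ih y) (ih (y + 1))

theorem thin_succ_sub (x y : ℕ) :
    thin g q (x + 1) y - thin g q x y = q * (thin g q x (y + 1) - thin g q x y) := by
  simp only [thin]; ring

theorem abs_thin_succ_sub_le (hg : ∀ y, |g y| ≤ 1) (hq0 : 0 ≤ q) (hq1 : q ≤ 1) (x y : ℕ) :
    |thin g q (x + 1) y - thin g q x y| ≤ 2 * q := by
  rw [thin_succ_sub, abs_mul, abs_of_nonneg hq0]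
  have h0 := abs_le.1 (abs_thin_le hg hq0 hq1 x y)
  have h1 := abs_le.1 (abs_thin_le hg hq0 hq1 x (y + 1))
  have : |thin g q x (y + 1) - thin g q x y| ≤ 2 := by
    rw [abs_le]; constructor <;> linarith
  nlinarith

theorem abs_thin_sub_le (hg : ∀ y, |g y| ≤ 1) {q' : ℝ} (hq0 : 0 ≤ q) (hq1 : q ≤ 1)
    (hq0' : 0 ≤ q') (hq1' : q' ≤ 1) (x y : ℕ) :
    |thin g q' x y - thin g q x y| ≤ 2 * x * |q' - q| := by
  induction x generalizing y with
  | zero => simp [thin]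
  | succ x ih =>
    have h1 : thin g q' (x + 1) y - thin g q (x + 1) y
        = ((1 - q) * (thin g q' x y - thin g q x y)
          + q * (thin g q' x (y + 1) - thin g q x (y + 1)))
          + (q' - q) * (thin g q' x (y + 1) - thin g q' x y) := by
      simp only [thin]; ring
    have h2 := abs_convex_comb_le hq0 hq1 (ih y) (ih (y + 1))
    have h0 := abs_le.1 (abs_thin_le hg hq0' hq1' x y)
    have h3 := abs_le.1 (abs_thin_le hg hq0' hq1' x (y + 1))
    have h4 : |thin g q' x (y + 1) - thin g q' x y| ≤ 2 := by
      rw [abs_le]; constructor <;> linarith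
    rw [h1]
    refine (abs_add_le _ _).trans ?_
    rw [abs_mul (q' - q)]
    push_cast
    nlinarith [abs_nonneg (q' - q)]

/-- `thinDeriv g q x y` is the derivative of `thin g q x y` in `q`. -/
noncomputable def thinDeriv (g : ℕ → ℝ) (q : ℝ) (x y : ℕ) : ℝ :=
  x * (thin g q (x - 1) (y + 1) - thin g q (x - 1) y)

theorem thinDeriv_comb (x y : ℕ) :
    (1 - q) * thinDeriv g q x y + q * thinDeriv g q x (y + 1)
      = x * (thin g q x (y + 1) - thin g q x y) := by
  cases x with
  | zero => simp [thinDeriv]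
  | succ x => simp only [thinDeriv, Nat.add_sub_cancel, thin]; ring

/-- Induction on the number of trials: an extra trial adds a cross term of size `4 x (q' - q)²`, and
`4x² + 4x ≤ 4(x + 1)²`. -/
theorem abs_thin_taylor_le (hg : ∀ y, |g y| ≤ 1) {q' : ℝ} (hq0 : 0 ≤ q) (hq1 : q ≤ 1)
    (hq0' : 0 ≤ q') (hq1' : q' ≤ 1) (x y : ℕ) :
    |thin g q' x y - thin g q x y - (q' - q) * thinDeriv g q x y|
      ≤ 4 * (x * (q' - q)) ^ 2 := by
  induction x generalizing y with
  | zero => simp [thin, thinDeriv]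
  | succ x ih =>
    have hc := thinDeriv_comb (g := g) (q := q) x y
    have h1 : thin g q' (x + 1) y - thin g q (x + 1) y - (q' - q) * thinDeriv g q (x + 1) y
        = ((1 - q) * (thin g q' x y - thin g q x y - (q' - q) * thinDeriv g q x y)
          + q * (thin g q' x (y + 1) - thin g q x (y + 1) - (q' - q) * thinDeriv g q x (y + 1)))
          + (q' - q) * ((thin g q' x (y + 1) - thin g q x (y + 1))
            - (thin g q' x y - thin g q x y)) := by
      have : thinDeriv g q (x + 1) y = (x + 1) * (thin g q x (y + 1) - thin g q x y) := by
        simp [thinDeriv]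
      rw [this]
      simp only [thin]
      linear_combination (q' - q) * hc
    have h2 := abs_convex_comb_le hq0 hq1 (ih y) (ih (y + 1))
    have h3 := abs_le.1 (abs_thin_sub_le hg hq0 hq1 hq0' hq1' x y)
    have h4 := abs_le.1 (abs_thin_sub_le hg hq0 hq1 hq0' hq1' x (y + 1))
    have h5 : |(thin g q' x (y + 1) - thin g q x (y + 1)) - (thin g q' x y - thin g q x y)|
        ≤ 4 * x * |q' - q| := by
      rw [abs_le]; constructor <;> linarith
    rw [h1]
    refine (abs_add_le _ _).trans ?_
    rw [abs_mul (q' - q)]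
    have h6 : |q' - q| * |(thin g q' x (y + 1) - thin g q x (y + 1))
        - (thin g q' x y - thin g q x y)| ≤ |q' - q| * (4 * x * |q' - q|) := by gcongr
    have h7 : |q' - q| * (4 * x * |q' - q|) = 4 * x * (q' - q) ^ 2 := by
      rw [← sq_abs (q' - q)]; ring
    rw [h7] at h6
    refine (add_le_add h2 h6).trans ?_
    push_cast
    have : (0 : ℝ) ≤ x := by positivity
    nlinarith [sq_nonneg (q' - q), mul_nonneg this (sq_nonneg (q' - q))]

/-- Expresses the derivative by the removal of one trial, which is what covering one surviving
vertex does. -/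
theorem thinDeriv_mul (x y : ℕ) :
    q * thinDeriv g q x y = x * (thin g q x y - thin g q (x - 1) y) := by
  cases x with
  | zero => simp [thinDeriv]
  | succ x =>
    simp only [thinDeriv, Nat.add_sub_cancel, thin_succ_sub]
    ring

/-- Poisson approximation one trial at a time: a trial raises the mean by `q`, the first-order terms
agree by `hasDerivAt_poiShift`, and a Taylor error `4q²` remains. -/
theorem abs_thin_sub_poiShift_le (i : ℕ) (hq0 : 0 ≤ q) (hq1 : q ≤ 1) (x y : ℕ) :
    |thin (fun k => if k = i then 1 else 0) q x y - poiShift i y (x * q)| ≤ 4 * x * q ^ 2 := by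
  induction x generalizing y with
  | zero =>
    simp only [thin, poiShift, poi]
    rcases lt_trichotomy y i with h | h | h
    · rw [if_neg (by omega), if_pos (by omega)]
      have : i - y ≠ 0 := by omega
      simp [this]
    · simp [h]
    · rw [if_neg (by omega), if_neg (by omega)]
      simp
  | succ x ih =>
    have hxq : (0 : ℝ) ≤ x * q := by positivity
    have hxq' : (0 : ℝ) ≤ (x + 1 : ℕ) * q := by positivity
    have ht := abs_poiShift_taylor_le (i := i) (y := y) (x := x * q) (x' := (x + 1 : ℕ) * q)
      (M := 1) (fun y z hz => abs_poiShift_le_one i y (le_trans (le_min hxq hxq') hz.1))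
    have hdiff : ((x + 1 : ℕ) : ℝ) * q - x * q = q := by push_cast; ring
    rw [hdiff] at ht
    have h2 := abs_convex_comb_le hq0 hq1 (ih y) (ih (y + 1))
    set g : ℕ → ℝ := fun k => if k = i then 1 else 0
    have h1 : thin g q (x + 1) y - poiShift i y ((x + 1 : ℕ) * q)
        = ((1 - q) * (thin g q x y - poiShift i y (x * q))
            + q * (thin g q x (y + 1) - poiShift i (y + 1) (x * q)))
          - (poiShift i y ((x + 1 : ℕ) * q) - poiShift i y (x * q)
            - q * (poiShift i (y + 1) (x * q) - poiShift i y (x * q))) := by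
      simp only [thin]; ring
    rw [h1]
    refine (abs_sub _ _).trans ((add_le_add h2 ht).trans ?_)
    push_cast
    linarith

end thin

/-! ### Early phase: internal time, almost-martingales and the potential. -/

section

open Classical

variable {n d : ℕ} {G : SimpleGraph (Fin n)}

/-- Mean of an additive functional of the degrees after one step. -/
theorem favg_sum_deg (hE : 0 < (addable d G).card) (φ : Fin n → ℕ → ℝ) (s : Finset (Fin n)) :
    favg (addable d G) (fun e => ∑ v ∈ s, φ v (deg (addEdge G e) v))
      = ∑ v ∈ s, (φ v (deg G v) + hit d G v * (φ v (deg G v + 1) - φ v (deg G v))) := by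
  rw [favg_sum]
  apply Finset.sum_congr rfl
  intro v _
  have h1 : favg (addable d G) (fun e => φ v (deg (addEdge G e) v))
      = favg (addable d G) (fun e => φ v (deg G v)
        + (φ v (deg G v + 1) - φ v (deg G v)) * (if v ∈ e then 1 else 0)) := by
    apply favg_congr
    intro e he
    rw [deg_addEdge he]
    split_ifs <;> simp
  rw [h1, favg_add, favg_const hE, favg_const_mul, favg_mem]
  ring

/-- A functional changed at the two ends of the new edge only moves by a bounded amount. -/
theorem abs_sum_deg_sub_le {e : Sym2 (Fin n)} (he : e ∈ addable d G) (φ : ℕ → ℝ) {M : ℝ}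
    (hM : ∀ a, |φ a| ≤ M) :
    |∑ v, φ (deg (addEdge G e) v) - ∑ v, φ (deg G v)| ≤ 4 * M := by
  rw [← Finset.sum_sub_distrib]
  refine (Finset.abs_sum_le_sum_abs _ _).trans ?_
  have h1 : ∀ v : Fin n, |φ (deg (addEdge G e) v) - φ (deg G v)|
      ≤ 2 * M * if v ∈ e then 1 else 0 := by
    intro v
    rw [deg_addEdge he]
    split_ifs
    · have h1 := abs_le.1 (hM (deg G v))
      have h2 := abs_le.1 (hM (deg G v + 1))
      rw [abs_le]; constructor <;> linarith
    · simp
  refine (Finset.sum_le_sum fun v _ => h1 v).trans ?_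
  rw [← Finset.mul_sum, Finset.sum_boole, card_filter_mem_of_addable he]
  norm_num
  linarith

/-- The mean minimises the mean square deviation, so a variance can be bounded around any convenient
constant. -/
theorem favg_sq_sub_favg_le {α : Type*} {E : Finset α} (hE : 0 < E.card) (F : α → ℝ) (c : ℝ) :
    favg E (fun e => (F e - favg E F) ^ 2) ≤ favg E (fun e => (F e - c) ^ 2) := by
  set μ := favg E F with hμ
  have h1 : favg E (fun e => (F e - c) ^ 2)
      = favg E (fun e => (F e - μ) ^ 2 + (2 * (μ - c) * F e + -((μ - c) * (μ + c)))) := by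
    congr 1; funext e; ring
  have h2 : favg E (fun e => 2 * (μ - c) * F e + -((μ - c) * (μ + c))) = (μ - c) ^ 2 := by
    rw [favg_add, favg_const_mul, favg_const hE, ← hμ]; ring
  rw [h1, favg_add, h2]
  nlinarith [sq_nonneg (μ - c)]

/-- A graph, together with the internal time of the process and the accumulated drifts of the
functionals `poiSum`. -/
structure TimedGraph (n : ℕ) where
  graph : SimpleGraph (Fin n)
  time : ℝ
  drift : ℕ → ℝ

/-- The linear functional of the degree counts that is almost a martingale in internal time. -/
noncomputable def poiSum (i : ℕ) (G : SimpleGraph (Fin n)) (τ : ℝ) : ℝ :=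
  ∑ v, poiShift i (deg G v) (-τ)

/-- The one-step drift of `poiSum`. -/
noncomputable def poiDrift (d i : ℕ) (G : SimpleGraph (Fin n)) (τ : ℝ) : ℝ :=
  favg (addable d G) (fun e => poiSum i (addEdge G e) (τ + rate d G)) - poiSum i G τ

/-- Update of a timed graph by a new edge. -/
noncomputable def TimedGraph.next (d : ℕ) (x : TimedGraph n) (e : Sym2 (Fin n)) : TimedGraph n :=
  ⟨addEdge x.graph e, x.time + rate d x.graph, fun i => x.drift i + poiDrift d i x.graph x.time⟩

/-- The averaging operator on timed graphs. -/
noncomputable def timedStep (d : ℕ) : (TimedGraph n → ℝ) → TimedGraph n → ℝ :=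
  avgStep d TimedGraph.graph (TimedGraph.next d)

/-- The initial timed graph. -/
def TimedGraph.init (n : ℕ) : TimedGraph n := ⟨⊥, 0, fun _ => 0⟩

/-- The facts which hold surely after `k` steps. -/
structure TimedValid (d k : ℕ) (x : TimedGraph n) : Prop where
  valid : Valid d k x.graph
  time_nonneg : 0 ≤ x.time
  le_time : Real.log (2 * (d * n / 2 : ℕ) + 3) - Real.log (2 * ((d * n / 2 : ℕ) - k) + 3) ≤ x.time

theorem timedValid_init : TimedValid d 0 (TimedGraph.init n) := by
  refine ⟨valid_bot, le_rfl, ?_⟩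
  simp [TimedGraph.init]

theorem timedInvariant (hd : 1 ≤ d) {s t : ℕ} (hst : s + t = d * n / 2) (ht : d * d ≤ t) :
    Invariant d TimedGraph.graph (TimedGraph.next d) (TimedValid (n := n) d) s := by
  have hU : ∀ k < s, ∀ x : TimedGraph n, TimedValid d k x → 2 * d ≤ (unsat d x.graph).card := by
    intro k hk x hx
    exact hx.valid.two_mul_le_card_unsat (r := t + (s - k)) hd (by omega) (by omega)
  refine ⟨fun k hk x hx => addable_pos hd (hU k hk x hx), fun k hk x hx e he => ?_⟩
  refine ⟨hx.valid.addEdge he, add_nonneg hx.time_nonneg rate_nonneg, ?_⟩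
  have h1 := hx.le_time
  have hN : (t : ℝ) = ((d * n / 2 : ℕ) : ℝ) - s := by rw [← hst]; push_cast; ring
  have hr0 : ((t + (s - k) : ℕ) : ℝ) = ((d * n / 2 : ℕ) : ℝ) - k := by
    push_cast [Nat.cast_sub hk.le]; linarith
  have h2 := hx.valid.le_rate (r := t + (s - k)) (by omega) (by have := hU k hk x hx; omega)
  have hr1 : (1 : ℝ) ≤ (t + (s - k) : ℕ) := by exact_mod_cast (by omega : 1 ≤ t + (s - k))
  simp only [TimedGraph.next]
  rw [hr0] at h2 hr1
  set r : ℝ := ((d * n / 2 : ℕ) : ℝ) - k with hr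
  have h3 : 2 * (((d * n / 2 : ℕ) : ℝ) - (k + 1 : ℕ)) + 3 = 2 * r + 1 := by
    push_cast; rw [hr]; ring
  rw [h3]
  -- At most `2r + 1` vertices are unsaturated, so the time grows by at least `2 / (2r + 1)`. The
  -- shift by 3 in `le_time` is chosen so that this dominates one logarithmic increment.
  have h4 : Real.log (2 * r + 3) - Real.log (2 * r + 1) ≤ 2 / (2 * r + 1) := by
    rw [← Real.log_div (by linarith) (by linarith)]
    refine (Real.log_le_sub_one_of_pos (by positivity)).trans (le_of_eq ?_)
    field_simp
    ring
  linarith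

/-- A weight decaying geometrically in the degree and vanishing above `m`. -/
noncomputable def geoWeight (m : ℕ) (β : ℝ) (a : ℕ) : ℝ := if a ≤ m then β ^ (m - a) else 0

theorem geoWeight_nonneg {m a : ℕ} {β : ℝ} (hβ : 1 ≤ β) : 0 ≤ geoWeight m β a := by
  have : 0 ≤ β := by linarith
  unfold geoWeight
  split_ifs <;> positivity

/-- Every hit divides the weight by at least `β`, whether or not it carries the vertex above `m`.
For large `β` the total weight therefore decays almost at the full hitting rate. -/
theorem geoWeight_succ_le {m a : ℕ} {β : ℝ} (hβ : 1 ≤ β) :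
    geoWeight m β (a + 1) ≤ geoWeight m β a * (1 / β) := by
  have hβ0 : 0 < β := by linarith
  unfold geoWeight
  split_ifs with h1 h2 h2
  · have : m - a = (m - (a + 1)) + 1 := by omega
    rw [this, pow_succ]
    apply le_of_eq
    field_simp
  · omega
  · positivity
  · simp

theorem geoWeight_drop_le {m a : ℕ} {β p : ℝ} (hβ : 1 ≤ β) (hp : 0 ≤ p) :
    geoWeight m β a + p * (geoWeight m β (a + 1) - geoWeight m β a)
      ≤ (1 - p * (1 - 1 / β)) * geoWeight m β a := by
  have := mul_le_mul_of_nonneg_left (geoWeight_succ_le (m := m) (a := a) hβ) hp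
  linarith

/-- The exponentially weighted potential controlling the number of unsaturated vertices. -/
noncomputable def timedPot (d : ℕ) (K : ℝ) (x : TimedGraph n) : ℝ :=
  Real.exp (x.time * (1 - 1 / K)) * ∑ v, geoWeight (d - 1) K (deg x.graph v)

theorem timedPot_nonneg {K : ℝ} (hK : 1 ≤ K) (x : TimedGraph n) : 0 ≤ timedPot d K x := by
  unfold timedPot
  exact mul_nonneg (Real.exp_pos _).le (Finset.sum_nonneg fun v _ => geoWeight_nonneg hK)

/-- With `h` the rate and `κ = 1 - 1/K`, the weights shrink by `1 - hκ` and the prefactor grows by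
`exp (hκ)`. The product is at most one, and only the error `d h²` in the hit chance survives, times
`e ≤ 3`. -/
theorem timedStep_timedPot_le (hd : 1 ≤ d) {K : ℝ} (hK : 1 ≤ K) {x : TimedGraph n}
    (hU : 2 * d ≤ (unsat d x.graph).card) :
    timedStep d (timedPot d K) x ≤ timedPot d K x * (1 + 3 * d * rate d x.graph ^ 2) := by
  have hE := addable_pos hd hU
  rw [timedStep, avgStep_eq hE]
  simp only [timedPot, TimedGraph.next]
  rw [favg_const_mul, favg_sum_deg hE (fun _ => geoWeight (d - 1) K)]
  set h := rate d x.graph with hh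
  set κ := 1 - 1 / K with hκ
  have hKpos : 0 < K := by linarith
  have hκ0 : 0 ≤ κ := by
    rw [hκ, sub_nonneg, div_le_one hKpos]; exact hK
  have hκ1 : κ ≤ 1 := by
    rw [hκ]; have : 0 < 1 / K := by positivity
    linarith
  have hh0 : 0 ≤ h := rate_nonneg
  have hh1 : h ≤ 1 := rate_le_one hd hU
  have hd0 : (0 : ℝ) ≤ d := by positivity
  have hsum : ∑ v, (geoWeight (d - 1) K (deg x.graph v) + hit d x.graph v *
        (geoWeight (d - 1) K (deg x.graph v + 1) - geoWeight (d - 1) K (deg x.graph v)))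
      ≤ (1 - h * κ + d * h ^ 2) * ∑ v, geoWeight (d - 1) K (deg x.graph v) := by
    rw [Finset.mul_sum]
    apply Finset.sum_le_sum
    intro v _
    have hp0 := hit_nonneg (d := d) (G := x.graph) v
    have hw0 := geoWeight_nonneg (m := d - 1) (a := deg x.graph v) hK
    refine (geoWeight_drop_le hK hp0).trans ?_
    rw [← hκ]
    by_cases hv : deg x.graph v < d
    · have hp := abs_le.1 (abs_hit_sub_rate_le hd hU hv)
      set p := hit d x.graph v
      have h4 : (h - d * h ^ 2) * κ ≤ p * κ := by
        have : h - d * h ^ 2 ≤ p := by linarith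
        gcongr
      have h5 : d * h ^ 2 * κ ≤ d * h ^ 2 := by
        have h6 : 0 ≤ d * h ^ 2 := by positivity
        nlinarith
      apply mul_le_mul_of_nonneg_right _ hw0
      linarith
    · rw [geoWeight, if_neg (by omega)]; simp
  set W := ∑ v, geoWeight (d - 1) K (deg x.graph v) with hW
  have hW0 : 0 ≤ W := Finset.sum_nonneg fun v _ => geoWeight_nonneg hK
  rw [add_mul, Real.exp_add]
  have hexp1 : Real.exp (h * κ) * (1 - h * κ) ≤ 1 := by
    have h1 := Real.add_one_le_exp (-(h * κ))
    have h2 : Real.exp (h * κ) * (1 - h * κ) ≤ Real.exp (h * κ) * Real.exp (-(h * κ)) := by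
      have := Real.exp_pos (h * κ)
      gcongr; linarith
    rwa [← Real.exp_add, add_neg_cancel, Real.exp_zero] at h2
  have hexp2 : Real.exp (h * κ) ≤ 3 := by
    have h1 : h * κ ≤ 1 := by nlinarith
    have h2 := Real.exp_le_exp.2 h1
    have := Real.exp_one_lt_d9
    linarith
  have hmain : Real.exp (h * κ) * (1 - h * κ + d * h ^ 2) ≤ 1 + 3 * d * h ^ 2 := by
    have : Real.exp (h * κ) * (d * h ^ 2) ≤ 3 * (d * h ^ 2) := by gcongr
    nlinarith
  have he := Real.exp_pos (x.time * κ)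
  calc Real.exp (x.time * κ) * Real.exp (h * κ) * _
      ≤ Real.exp (x.time * κ) * Real.exp (h * κ) * ((1 - h * κ + d * h ^ 2) * W) := by gcongr
    _ = Real.exp (x.time * κ) * W * (Real.exp (h * κ) * (1 - h * κ + d * h ^ 2)) := by ring
    _ ≤ Real.exp (x.time * κ) * W * (1 + 3 * d * h ^ 2) := by gcongr

theorem inv_sq_le_sub {r : ℝ} (hr : 1 < r) : 1 / r ^ 2 ≤ 1 / (r - 1) - 1 / r := by
  have h1 : 0 < r - 1 := by linarith
  have h2 : 1 / (r - 1) - 1 / r = 1 / ((r - 1) * r) := by field_simp; ring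
  rw [h2]
  apply one_div_le_one_div_of_le (by positivity)
  nlinarith

/-- Since the rate is at most `d / r`, the factors `1 + 3d³/r²` have a bounded product. It is
absorbed by `exp (-c / r)` with `c = 3d³`, because `1/r² ≤ 1/(r-1) - 1/r`. -/
theorem iterate_timedPot_le (hd : 1 ≤ d) {K : ℝ} (hK : 1 ≤ K) {s t : ℕ}
    (hst : s + t = d * n / 2) (ht : d * d ≤ t) {k : ℕ} (hk : k ≤ s) :
    (timedStep d)^[k] (timedPot d K) (TimedGraph.init n)
      ≤ Real.exp (3 * d ^ 3) * (n * K ^ (d - 1)) := by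
  have hI := (timedInvariant (n := n) hd hst ht).mono hk
  have hdt : 1 ≤ d * d := Nat.one_le_iff_ne_zero.2 (by positivity)
  set N : ℝ := ((d * n / 2 : ℕ) : ℝ) with hN
  have hNst : N = s + t := by rw [hN, ← hst]; push_cast; ring
  set c : ℝ := 3 * d ^ 3 with hc
  have hc0 : 0 ≤ c := by positivity
  have ht1 : (1 : ℝ) ≤ t := by exact_mod_cast hdt.trans ht
  have hsup := iterate_le_of_super hI timedValid_init
    (fun k x => Real.exp (-(c / (N - k))) * timedPot d K x) (by
      intro l hl y hy
      have hU := hy.valid.two_mul_le_card_unsat (r := t + (s - l)) hd (by omega) (by omega)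
      have hr := hy.valid.rate_le (r := t + (s - l)) (by omega) (by omega)
      have hrr : ((t + (s - l) : ℕ) : ℝ) = N - l := by
        push_cast [Nat.cast_sub (by omega : l ≤ s)]; linarith
      have hr1 : (1 : ℝ) < N - l := by
        rw [← hrr]; exact_mod_cast (by omega : 1 < t + (s - l))
      rw [hrr] at hr
      have h1 := timedStep_timedPot_le hd hK hU
      rw [avgStep_const_mul]
      have h2 : N - ((l + 1 : ℕ) : ℝ) = N - l - 1 := by push_cast; ring
      rw [h2]
      set r := N - l
      have h3 : 1 + 3 * d * rate d y.graph ^ 2 ≤ Real.exp (c / (r - 1) - c / r) := by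
        have h4 : rate d y.graph ^ 2 ≤ (d / r) ^ 2 := by
          have := rate_nonneg (d := d) (G := y.graph)
          gcongr
        have h5 : 3 * d * rate d y.graph ^ 2 ≤ c * (1 / r ^ 2) := by
          have : c * (1 / r ^ 2) = 3 * d * (d / r) ^ 2 := by rw [hc]; field_simp
          rw [this]; gcongr
        have h6 := inv_sq_le_sub hr1
        have h7 : c * (1 / r ^ 2) ≤ c / (r - 1) - c / r := by
          have := mul_le_mul_of_nonneg_left h6 hc0
          rw [mul_sub, mul_one_div, mul_one_div, mul_one_div] at this
          rwa [mul_one_div]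
        have := Real.add_one_le_exp (c / (r - 1) - c / r)
        linarith
      have hp := timedPot_nonneg (d := d) hK y
      calc Real.exp (-(c / (r - 1))) * timedStep d (timedPot d K) y
          ≤ Real.exp (-(c / (r - 1))) * (timedPot d K y * Real.exp (c / (r - 1) - c / r)) := by
            gcongr
            exact h1.trans (by gcongr)
        _ = Real.exp (-(c / r)) * timedPot d K y := by
            rw [mul_left_comm, ← Real.exp_add, mul_comm]; congr 2; ring)
  rw [iterate_const_mul] at hsup
  have hinit : timedPot d K (TimedGraph.init n) = n * K ^ (d - 1) := by
    have : ∀ v : Fin n, deg (⊥ : SimpleGraph (Fin n)) v = 0 := by intro v; simp [deg]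
    simp [timedPot, TimedGraph.init, this, geoWeight]
  have hNk : 1 ≤ N - k := by
    have : (k : ℝ) ≤ s := by exact_mod_cast hk
    linarith
  have h8 : Real.exp (-(c / (N - (0 : ℕ)))) ≤ 1 := by
    rw [Real.exp_le_one_iff]
    have : 0 < N - (0 : ℕ) := by
      have : (0 : ℝ) ≤ s := by positivity
      push_cast; linarith
    have : 0 ≤ c / (N - (0 : ℕ)) := by positivity
    linarith
  have h9 : Real.exp (-c) ≤ Real.exp (-(c / (N - k))) := by
    rw [Real.exp_le_exp]
    have := div_le_self hc0 hNk
    linarith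
  have hp0 : 0 ≤ (n : ℝ) * K ^ (d - 1) := by positivity
  have hit0 : 0 ≤ (timedStep d)^[k] (timedPot d K) (TimedGraph.init n) := by
    have := iterate_mono (F := fun _ => 0) (H := timedPot d K) hI timedValid_init
      (fun y _ => timedPot_nonneg hK y)
    rw [iterate_const] at this
    exact this
  rw [hinit] at hsup
  have h10 : Real.exp (-c) * (timedStep d)^[k] (timedPot d K) (TimedGraph.init n)
      ≤ n * K ^ (d - 1) := by
    calc _ ≤ Real.exp (-(c / (N - k))) * (timedStep d)^[k] (timedPot d K) (TimedGraph.init n) := by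
          gcongr
      _ ≤ _ := hsup
      _ ≤ 1 * (n * K ^ (d - 1)) := by gcongr
      _ = _ := one_mul _
  rw [Real.exp_neg, inv_mul_le_iff₀ (Real.exp_pos c)] at h10
  exact h10

end

/-! ### Early phase: moments of the drift and of the martingale part. -/

section

open Classical

variable {n d : ℕ} {G : SimpleGraph (Fin n)}

theorem exp_one_le_three : Real.exp 1 ≤ 3 := by
  have := Real.exp_one_lt_d9
  linarith

/-- Up to time `K` the exponent `1 - 1/K` in the potential loses at most a factor `e`. -/
theorem exp_mul_card_unsat_le (hd : 1 ≤ d) {K : ℝ} (hK : 1 ≤ K) {x : TimedGraph n}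
    (hx : x.time ≤ K) :
    Real.exp x.time * (unsat d x.graph).card ≤ 3 * timedPot d K x := by
  have hKpos : 0 < K := by linarith
  have h1 : ((unsat d x.graph).card : ℝ) ≤ ∑ v, geoWeight (d - 1) K (deg x.graph v) := by
    rw [unsat, Finset.card_filter]
    push_cast
    apply Finset.sum_le_sum
    intro v _
    by_cases hv : deg x.graph v < d
    · rw [if_pos hv, geoWeight, if_pos (by omega)]
      exact one_le_pow₀ hK
    · rw [if_neg hv]
      exact geoWeight_nonneg hK
  have h2 : Real.exp x.time ≤ 3 * Real.exp (x.time * (1 - 1 / K)) := by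
    have h3 : x.time / K ≤ 1 := by rw [div_le_one hKpos]; exact hx
    calc Real.exp x.time ≤ Real.exp (1 + x.time * (1 - 1 / K)) := by
          apply Real.exp_le_exp.2
          have : x.time * (1 - 1 / K) = x.time - x.time / K := by ring
          linarith
      _ = Real.exp 1 * Real.exp (x.time * (1 - 1 / K)) := Real.exp_add _ _
      _ ≤ _ := by gcongr; exact exp_one_le_three
  unfold timedPot
  calc _ ≤ 3 * Real.exp (x.time * (1 - 1 / K)) * ∑ v, geoWeight (d - 1) K (deg x.graph v) := by
        gcongr
    _ = _ := by ring

/-- Advancing the time by the rate cancels the first-order effect of a hit. What is left is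
quadratic in the rate: the error of the hit chance and the Taylor remainder. Saturated vertices
contribute nothing because `i < d`. -/
theorem abs_poiDrift_le (hd : 1 ≤ d) (hU : 2 * d ≤ (unsat d G).card) {i : ℕ} (hi : i < d)
    {τ : ℝ} (hτ : 0 ≤ τ) :
    |poiDrift d i G τ| ≤ (unsat d G).card * ((2 * d + 4) * rate d G ^ 2 *
      (Real.exp (τ + rate d G) * (1 + (τ + rate d G)) ^ d)) := by
  have hE := addable_pos hd hU
  have hh0 : 0 ≤ rate d G := rate_nonneg
  unfold poiDrift poiSum
  rw [favg_sum_deg hE (fun _ a => poiShift i a (-(τ + rate d G))), ← Finset.sum_sub_distrib]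
  set h := rate d G with hh
  set M := Real.exp (τ + h) * (1 + (τ + h)) ^ d with hM
  have hM0 : 0 ≤ M := by positivity
  have hMb : ∀ y, ∀ z ∈ Set.uIcc (-(τ + h)) (-τ), |poiShift i y z| ≤ M := by
    intro y z hz
    rw [Set.uIcc_of_le (by linarith)] at hz
    have := abs_poiShift_neg_le (i := i) (d := d) (y := y) hi.le (x := -z) (T := τ + h)
      (by linarith [hz.2]) (by linarith [hz.1])
    rwa [neg_neg] at this
  have hterm : ∀ v, |poiShift i (deg G v) (-(τ + h)) + hit d G v *
        (poiShift i (deg G v + 1) (-(τ + h)) - poiShift i (deg G v) (-(τ + h)))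
        - poiShift i (deg G v) (-τ)|
      ≤ if deg G v < d then (2 * d + 4) * h ^ 2 * M else 0 := by
    intro v
    split_ifs with hv
    · have hp := abs_hit_sub_rate_le hd hU hv
      rw [← hh] at hp
      have ht := abs_poiShift_taylor_le (y := deg G v) hMb
      have h1 : -τ - -(τ + h) = h := by ring
      rw [h1] at ht
      set p := hit d G v
      have hb0 := abs_le.1 (hMb (deg G v) _ Set.left_mem_uIcc)
      have hb1 := abs_le.1 (hMb (deg G v + 1) _ Set.left_mem_uIcc)
      set A := poiShift i (deg G v) (-(τ + h))
      set B := poiShift i (deg G v + 1) (-(τ + h))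
      set D := poiShift i (deg G v) (-τ)
      have h2 : A + p * (B - A) - D = (p - h) * (B - A) - (D - A - h * (B - A)) := by ring
      have h3 : |B - A| ≤ 2 * M := by rw [abs_le]; constructor <;> linarith
      rw [h2]
      refine (abs_sub _ _).trans ?_
      rw [abs_mul]
      have h4 : |p - h| * |B - A| ≤ d * h ^ 2 * (2 * M) := by gcongr
      linarith
    · rw [poiShift_of_lt (by omega), poiShift_of_lt (by omega), poiShift_of_lt (by omega)]
      simp
  refine (Finset.abs_sum_le_sum_abs _ _).trans ((Finset.sum_le_sum fun v _ => hterm v).trans ?_)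
  rw [← Finset.sum_filter, Finset.sum_const, nsmul_eq_mul]
  rfl

theorem favg_poiSum_sq_le (hd : 1 ≤ d) (hU : 2 * d ≤ (unsat d G).card) {i : ℕ} (hi : i < d)
    {τ : ℝ} (hτ : 0 ≤ τ) :
    favg (addable d G) (fun e => (poiSum i (addEdge G e) (τ + rate d G)
        - favg (addable d G) (fun e => poiSum i (addEdge G e) (τ + rate d G))) ^ 2)
      ≤ 16 * (Real.exp (τ + rate d G) * (1 + (τ + rate d G)) ^ d) ^ 2 := by
  have hE := addable_pos hd hU
  have hh0 : 0 ≤ rate d G := rate_nonneg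
  -- The comparison constant uses the degrees before the step; a new edge changes only two summands.
  refine (favg_sq_sub_favg_le hE _ (∑ v, poiShift i (deg G v) (-(τ + rate d G)))).trans ?_
  set M := Real.exp (τ + rate d G) * (1 + (τ + rate d G)) ^ d with hM
  rw [← favg_const hE (16 * M ^ 2)]
  apply favg_mono
  intro e he
  have h1 := abs_sum_deg_sub_le he (fun a => poiShift i a (-(τ + rate d G))) (M := M) (fun a =>
    abs_poiShift_neg_le hi.le (by linarith) le_rfl)
  have h2 : 16 * M ^ 2 = (4 * M) ^ 2 := by ring
  rw [h2]
  exact sq_le_sq' (abs_le.1 h1).1 (abs_le.1 h1).2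

/-- The squared deviation of the martingale part of `poiSum`, cut off at internal time `m`. -/
noncomputable def cutSq (i : ℕ) (c m : ℝ) (x : TimedGraph n) : ℝ :=
  if x.time ≤ m then (poiSum i x.graph x.time - x.drift i - c) ^ 2 else 0

/-- The accumulated drift of `poiSum`, cut off at internal time `m`. -/
noncomputable def cutDrift (i : ℕ) (m : ℝ) (x : TimedGraph n) : ℝ :=
  if x.time ≤ m then |x.drift i| else 0

/-- Before the cutoff the cross term vanishes, because subtracting `poiDrift` centres the increment.
After the cutoff the functional stays zero, as time never decreases. -/
theorem timedStep_cutSq_le (hd : 1 ≤ d) {x : TimedGraph n} (hx : 0 ≤ x.time)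
    (hU : 2 * d ≤ (unsat d x.graph).card) {i : ℕ} (hi : i < d) (c m : ℝ) :
    timedStep d (cutSq i c m) x ≤ cutSq i c m x + if x.time ≤ m then
      16 * (Real.exp (x.time + rate d x.graph) * (1 + (x.time + rate d x.graph)) ^ d) ^ 2
      else 0 := by
  have hE := addable_pos hd hU
  have hh0 : 0 ≤ rate d x.graph := rate_nonneg
  rw [timedStep, avgStep_eq hE]
  by_cases hm : x.time ≤ m
  · rw [cutSq, if_pos hm, if_pos hm]
    set μ := favg (addable d x.graph)
      (fun e => poiSum i (addEdge x.graph e) (x.time + rate d x.graph)) with hμ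
    set D := poiSum i x.graph x.time - x.drift i - c with hD
    have h1 : favg (addable d x.graph) (fun e => cutSq i c m (TimedGraph.next d x e))
        ≤ favg (addable d x.graph) (fun e =>
          (poiSum i (addEdge x.graph e) (x.time + rate d x.graph) - μ) ^ 2
          + (2 * D * poiSum i (addEdge x.graph e) (x.time + rate d x.graph)
            + (D ^ 2 - 2 * D * μ))) := by
      apply favg_mono
      intro e _
      have h2 : (poiSum i (addEdge x.graph e) (x.time + rate d x.graph) - μ) ^ 2
          + (2 * D * poiSum i (addEdge x.graph e) (x.time + rate d x.graph)
            + (D ^ 2 - 2 * D * μ))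
          = (poiSum i (addEdge x.graph e) (x.time + rate d x.graph)
            - (x.drift i + poiDrift d i x.graph x.time) - c) ^ 2 := by
        rw [poiDrift, ← hμ, hD]; ring
      rw [h2]
      unfold cutSq
      split_ifs
      · rfl
      · positivity
    refine h1.trans ?_
    rw [favg_add, favg_add, favg_const_mul, favg_const hE, ← hμ]
    have := favg_poiSum_sq_le hd hU hi hx
    rw [← hμ] at this
    linarith
  · rw [cutSq, if_neg hm, if_neg hm]
    have h1 : favg (addable d x.graph) (fun e => cutSq i c m (TimedGraph.next d x e))
        = favg (addable d x.graph) (fun _ => 0) := by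
      apply favg_congr
      intro e _
      rw [cutSq, if_neg]
      simp only [TimedGraph.next]
      linarith
    rw [h1, favg_const hE]
    simp

theorem timedStep_cutDrift_le (hd : 1 ≤ d) {x : TimedGraph n} 
    (hU : 2 * d ≤ (unsat d x.graph).card) (i : ℕ) (m : ℝ) :
    timedStep d (cutDrift i m) x ≤ cutDrift i m x + if x.time ≤ m then
      |poiDrift d i x.graph x.time| else 0 := by
  have hE := addable_pos hd hU
  have hh0 : 0 ≤ rate d x.graph := rate_nonneg
  rw [timedStep, avgStep_eq hE]
  rw [← favg_const hE (cutDrift i m x + if x.time ≤ m then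
      |poiDrift d i x.graph x.time| else 0)]
  apply favg_mono
  intro e _
  unfold cutDrift
  change (if x.time + rate d x.graph ≤ m then |x.drift i + poiDrift d i x.graph x.time| else 0) ≤ _
  by_cases hm : x.time ≤ m
  · rw [if_pos hm, if_pos hm]
    split_ifs
    · exact abs_add_le _ _
    · positivity
  · rw [if_neg hm, if_neg hm, if_neg (by linarith)]
    simp

theorem exp_mul_pow_le {K τ h : ℝ} (hK : 1 ≤ K) (hτ0 : 0 ≤ τ) (hτ : τ ≤ K) (hh : h ≤ 1)
    (hh0 : 0 ≤ h) :
    Real.exp (τ + h) * (1 + (τ + h)) ^ d ≤ 3 * Real.exp τ * (3 * K) ^ d := by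
  rw [Real.exp_add]
  have h1 : Real.exp h ≤ 3 := (Real.exp_le_exp.2 hh).trans exp_one_le_three
  have h2 : (1 + (τ + h)) ^ d ≤ (3 * K) ^ d := by gcongr; linarith
  have h3 := Real.exp_pos τ
  calc _ ≤ Real.exp τ * 3 * (3 * K) ^ d := by gcongr
    _ = _ := by ring

theorem sum_inv_sq_le {N s t : ℕ} (hst : s + t = N) (ht : 1 ≤ t) :
    ∑ k ∈ Finset.range s, 1 / ((N : ℝ) - k) ^ 2 ≤ 1 / (t : ℝ) := by
  have h1 : ∀ k ≤ s, ∑ l ∈ Finset.range k, 1 / ((N : ℝ) - l) ^ 2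
      ≤ 1 / ((N : ℝ) - k) - 1 / (N : ℝ) := by
    intro k hk
    induction k with
    | zero => simp
    | succ k ih =>
      rw [Finset.sum_range_succ]
      have hr : (1 : ℝ) < N - k := by
        have : (k : ℝ) + 1 ≤ s := by exact_mod_cast hk
        have h2 : (1 : ℝ) ≤ t := by exact_mod_cast ht
        have h3 : (s : ℝ) + t = N := by exact_mod_cast hst
        linarith
      have h4 := inv_sq_le_sub hr
      have h5 : (N : ℝ) - (k + 1 : ℕ) = N - k - 1 := by push_cast; ring
      rw [h5]
      linarith [ih (by omega)]
  have h2 := h1 s le_rfl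
  have h3 : (N : ℝ) - s = t := by rw [← hst]; push_cast; ring
  rw [h3] at h2
  have : (0 : ℝ) ≤ 1 / (N : ℝ) := by positivity
  linarith

theorem sum_inv_le {N s t : ℕ} (hst : s + t = N) (ht : 1 ≤ t) :
    ∑ k ∈ Finset.range s, 1 / ((N : ℝ) - k) ≤ Real.log N - Real.log t := by
  have h1 : ∀ k ≤ s, ∑ l ∈ Finset.range k, 1 / ((N : ℝ) - l)
      ≤ Real.log N - Real.log ((N : ℝ) - k) := by
    intro k hk
    induction k with
    | zero => simp
    | succ k ih =>
      rw [Finset.sum_range_succ]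
      have hr : (1 : ℝ) < N - k := by
        have : (k : ℝ) + 1 ≤ s := by exact_mod_cast hk
        have h2 : (1 : ℝ) ≤ t := by exact_mod_cast ht
        have h3 : (s : ℝ) + t = N := by exact_mod_cast hst
        linarith
      have h5 : (N : ℝ) - (k + 1 : ℕ) = N - k - 1 := by push_cast; ring
      rw [h5]
      set r := (N : ℝ) - k
      have h4 : Real.log (r - 1) - Real.log r ≤ -(1 / r) := by
        rw [← Real.log_div (by linarith) (by linarith)]
        refine (Real.log_le_sub_one_of_pos (div_pos (by linarith) (by linarith))).trans ?_
        apply le_of_eq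
        field_simp
        ring
      linarith [ih (by omega)]
  have h2 := h1 s le_rfl
  have h3 : (N : ℝ) - s = t := by rw [← hst]; push_cast; ring
  rwa [h3] at h2

section Moments

variable {K m : ℝ} {s t : ℕ}

/-- In the drift bound `e^τ` times the number of unsaturated vertices is at most three potentials,
and the squared rate gives `d²/r²`, whose sum is `O(1 / t)`. -/
theorem iterate_cutDrift_le (hd : 1 ≤ d) (hK : 1 ≤ K) (hmK : m ≤ K)
    (hst : s + t = d * n / 2) (ht : d * d ≤ t) {i : ℕ} (hi : i < d) :
    (timedStep d)^[s] (cutDrift i m) (TimedGraph.init n)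
      ≤ 9 * (2 * d + 4) * d ^ 2 * 3 ^ d * Real.exp (3 * d ^ 3) * (n * K ^ (2 * d - 1)) / t := by
  have hI := timedInvariant (n := n) hd hst ht
  have hdt : 1 ≤ d * d := Nat.one_le_iff_ne_zero.2 (by positivity)
  have hK0 : 0 < K := by linarith
  set C : ℝ := 9 * (2 * d + 4) * d ^ 2 * (3 * K) ^ d with hC
  have hC0 : 0 ≤ C := by positivity
  set N : ℝ := ((d * n / 2 : ℕ) : ℝ) with hN
  have hNst : N = s + t := by rw [hN, ← hst]; push_cast; ring
  have h := iterate_le_add_sum hI timedValid_init (fun _ => cutDrift i m)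
    (fun k x => C * (1 / (N - k) ^ 2) * timedPot d K x) (by
      intro k hk x hx
      have hU := hx.valid.two_mul_le_card_unsat (r := t + (s - k)) hd (by omega) (by omega)
      have hr := hx.valid.rate_le (r := t + (s - k)) (by omega) (by omega)
      have hrr : ((t + (s - k) : ℕ) : ℝ) = N - k := by
        push_cast [Nat.cast_sub hk.le]; linarith
      have hr1 : (1 : ℝ) < N - k := by
        rw [← hrr]; exact_mod_cast (by omega : 1 < t + (s - k))
      rw [hrr] at hr
      refine (timedStep_cutDrift_le hd hU i m).trans ?_
      gcongr
      have hp := timedPot_nonneg (d := d) hK x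
      split_ifs with hm
      · refine (abs_poiDrift_le hd hU hi hx.time_nonneg).trans ?_
        have hτK := hm.trans hmK
        have h1 := exp_mul_pow_le (d := d) hK hx.time_nonneg hτK (rate_le_one hd hU) rate_nonneg
        have h2 := exp_mul_card_unsat_le hd hK hτK
        have h0 := rate_nonneg (d := d) (G := x.graph)
        have h3 := hx.time_nonneg
        set h := rate d x.graph
        set r := N - k
        calc _ ≤ (unsat d x.graph).card * ((2 * d + 4) * (d / r) ^ 2 *
              (3 * Real.exp x.time * (3 * K) ^ d)) := by gcongr
          _ = 3 * (2 * d + 4) * d ^ 2 * (3 * K) ^ d * (1 / r ^ 2)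
              * (Real.exp x.time * (unsat d x.graph).card) := by field_simp
          _ ≤ 3 * (2 * d + 4) * d ^ 2 * (3 * K) ^ d * (1 / r ^ 2) * (3 * timedPot d K x) := by
              gcongr
          _ = _ := by rw [hC]; ring
      · have : 0 < (N - k) ^ 2 := by positivity
        positivity)
  refine h.trans ?_
  have h0 : cutDrift i m (TimedGraph.init n) = 0 := by simp [cutDrift, TimedGraph.init]
  rw [h0, zero_add]
  have hsum := sum_inv_sq_le hst (hdt.trans ht)
  have hb : ∀ k ∈ Finset.range s, (timedStep d)^[k]
      (fun x => C * (1 / (N - k) ^ 2) * timedPot d K x) (TimedGraph.init n)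
      ≤ C * (Real.exp (3 * d ^ 3) * (n * K ^ (d - 1))) * (1 / (N - k) ^ 2) := by
    intro k hk
    have hk' := Finset.mem_range.1 hk
    have h1 := iterate_timedPot_le (n := n) hd hK hst ht hk'.le
    rw [timedStep, iterate_const_mul]
    calc _ ≤ C * (1 / (N - k) ^ 2) * (Real.exp (3 * d ^ 3) * (n * K ^ (d - 1))) := by
          have : 0 ≤ 1 / (N - k) ^ 2 := by positivity
          exact mul_le_mul_of_nonneg_left h1 (by positivity)
      _ = _ := by ring
  refine (Finset.sum_le_sum hb).trans ?_
  rw [← Finset.mul_sum]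
  refine (mul_le_mul_of_nonneg_left hsum (by positivity)).trans (le_of_eq ?_)
  have : 2 * d - 1 = d + (d - 1) := by omega
  rw [hC, this, pow_add, mul_pow]
  ring

/-- Squared increments are of order `e^{2τ} K^{2d}`. One factor `e^τ` is at most `e^m` by the
cutoff; the other is `O(timedPot / r)`, since at least `2r/d` vertices are unsaturated. The sum of
`1 / r` costs `log N ≤ 2K`. -/
theorem iterate_cutSq_le (hd : 1 ≤ d) (hK : 1 ≤ K) (hmK : m ≤ K) (hm0 : 0 ≤ m)
    (hst : s + t = d * n / 2) (ht : d * d ≤ t) {i : ℕ} (hi : i < d)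
    (hlog : Real.log ((d * n / 2 : ℕ) : ℝ) ≤ 2 * K) :
    (timedStep d)^[s] (cutSq i (if i = 0 then (n : ℝ) else 0) m) (TimedGraph.init n)
      ≤ 432 * d * 9 ^ d * Real.exp (3 * d ^ 3) * (Real.exp m * (n * K ^ (3 * d))) := by
  have hI := timedInvariant (n := n) hd hst ht
  have hdt : 1 ≤ d * d := Nat.one_le_iff_ne_zero.2 (by positivity)
  have hK0 : 0 < K := by linarith
  set C : ℝ := 216 * d * (3 * K) ^ (2 * d) * Real.exp m with hC
  have hC0 : 0 ≤ C := by positivity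
  set N : ℝ := ((d * n / 2 : ℕ) : ℝ) with hN
  have hNst : N = s + t := by rw [hN, ← hst]; push_cast; ring
  set c : ℝ := if i = 0 then (n : ℝ) else 0 with hc
  have h := iterate_le_add_sum hI timedValid_init (fun _ => cutSq i c m)
    (fun k x => C * (1 / (N - k)) * timedPot d K x) (by
      intro k hk x hx
      have hU := hx.valid.two_mul_le_card_unsat (r := t + (s - k)) hd (by omega) (by omega)
      have hr := hx.valid.le_mul_card_unsat (r := t + (s - k)) (by omega)
      have hr' : 2 * ((t + (s - k) : ℕ) : ℝ) ≤ d * (unsat d x.graph).card := by exact_mod_cast hr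
      have hrr : ((t + (s - k) : ℕ) : ℝ) = N - k := by
        push_cast [Nat.cast_sub hk.le]; linarith
      have hr1 : (1 : ℝ) < N - k := by
        rw [← hrr]; exact_mod_cast (by omega : 1 < t + (s - k))
      rw [hrr] at hr'
      refine (timedStep_cutSq_le hd hx.time_nonneg hU hi c m).trans ?_
      gcongr
      have hp := timedPot_nonneg (d := d) hK x
      split_ifs with hm
      · have hτK := hm.trans hmK
        have h0 := rate_nonneg (d := d) (G := x.graph)
        have h1 := exp_mul_pow_le (d := d) hK hx.time_nonneg hτK (rate_le_one hd hU) h0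
        have h2 := exp_mul_card_unsat_le hd hK hτK
        have h3 := hx.time_nonneg
        set h := rate d x.graph
        set r := N - k
        have h4 : 2 * r * Real.exp x.time ≤ d * (3 * timedPot d K x) := by
          calc _ ≤ d * (unsat d x.graph).card * Real.exp x.time := by gcongr
            _ = d * (Real.exp x.time * (unsat d x.graph).card) := by ring
            _ ≤ _ := by gcongr
        have h5 : Real.exp x.time ≤ 3 / 2 * d * (1 / r) * timedPot d K x := by
          rw [show 3 / 2 * (d : ℝ) * (1 / r) * timedPot d K x
            = (d * (3 * timedPot d K x)) / (2 * r) by field_simp, le_div_iff₀ (by linarith)]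
          linarith
        have h6 : Real.exp x.time ≤ Real.exp m := Real.exp_le_exp.2 hm
        calc _ ≤ 16 * (3 * Real.exp x.time * (3 * K) ^ d) ^ 2 := by gcongr
          _ = 144 * (3 * K) ^ (2 * d) * Real.exp x.time * Real.exp x.time := by ring
          _ ≤ 144 * (3 * K) ^ (2 * d) * Real.exp m * (3 / 2 * d * (1 / r) * timedPot d K x) := by
              gcongr
          _ = _ := by rw [hC]; ring
      · have : 0 < (N - k) := by positivity
        positivity)
  refine h.trans ?_
  have h0 : cutSq i c m (TimedGraph.init n) = 0 := by
    have hdeg : ∀ v : Fin n, deg (⊥ : SimpleGraph (Fin n)) v = 0 := by intro v; simp [deg]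
    rw [cutSq, if_pos (show (TimedGraph.init n).time ≤ m from hm0)]
    simp only [TimedGraph.init, poiSum, hdeg, poiShift_zero, neg_zero]
    rw [hc]
    split_ifs with hi0
    · simp [hi0, poi]
    · simp [poi, hi0]
  rw [h0, zero_add]
  have ht1 : 1 ≤ t := hdt.trans ht
  have hsum := sum_inv_le hst ht1
  have hlogt : 0 ≤ Real.log t := Real.log_natCast_nonneg t
  have hsum' : ∑ k ∈ Finset.range s, 1 / (N - k) ≤ 2 * K := by linarith
  have hb : ∀ k ∈ Finset.range s, (timedStep d)^[k]
      (fun x => C * (1 / (N - k)) * timedPot d K x) (TimedGraph.init n)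
      ≤ C * (Real.exp (3 * d ^ 3) * (n * K ^ (d - 1))) * (1 / (N - k)) := by
    intro k hk
    have hk' := Finset.mem_range.1 hk
    have h1 := iterate_timedPot_le (n := n) hd hK hst ht hk'.le
    rw [timedStep, iterate_const_mul]
    have hpos : 0 < N - k := by
      have h2 : (k : ℝ) ≤ s := by exact_mod_cast hk'.le
      have h3 : (1 : ℝ) ≤ t := by exact_mod_cast ht1
      linarith
    calc _ ≤ C * (1 / (N - k)) * (Real.exp (3 * d ^ 3) * (n * K ^ (d - 1))) :=
          mul_le_mul_of_nonneg_left h1 (by positivity)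
      _ = _ := by ring
  refine (Finset.sum_le_sum hb).trans ?_
  rw [← Finset.mul_sum]
  refine (mul_le_mul_of_nonneg_left hsum' (by positivity)).trans (le_of_eq ?_)
  have h3d : 3 * d = 2 * d + (d - 1) + 1 := by omega
  have h9 : (9 : ℝ) ^ d = 3 ^ (2 * d) := by rw [pow_mul]; norm_num
  rw [hC, h3d, h9, pow_succ, pow_add, mul_pow]
  ring

end Moments

end

/-! ### Early phase: most graphs at the split are typical. -/

section

open Classical

variable {n d : ℕ}

/-- The internal time is at most `m`, and each `poiSum` is close to its initial value. -/
def Typical (d : ℕ) (K m : ℝ) (x : TimedGraph n) : Prop :=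
  x.time ≤ m ∧ ∀ i < d, |poiSum i x.graph x.time - if i = 0 then (n : ℝ) else 0| ≤ n / K

/-- Markov and Chebyshev in pointwise form. Either the time exceeds `m`, and the potential is large
since at least `2t/d` vertices are unsaturated; or some `poiSum` deviates by more than `n/K`, and
then its drift or its martingale part deviates by `n/(2K)`. -/
theorem indicator_not_typical_le (hd : 1 ≤ d) {K m : ℝ} {s t : ℕ} (hK : 1 ≤ K)
    (hmK : m ≤ K) (hn : 1 ≤ n) (hst : s + t = d * n / 2) (ht : 1 ≤ t) {x : TimedGraph n}
    (hx : TimedValid d s x) :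
    (if Typical d K m x then 0 else 1) ≤ 3 * d / (2 * t * Real.exp m) * timedPot d K x
      + ∑ i ∈ Finset.range d, (4 * K ^ 2 / n ^ 2 * cutSq i (if i = 0 then (n : ℝ) else 0) m x
        + 2 * K / n * cutDrift i m x) := by
  have hK0 : 0 < K := by linarith
  have hn0 : (0 : ℝ) < n := by exact_mod_cast hn
  have ht0 : (0 : ℝ) < t := by exact_mod_cast ht
  have hd0 : (0 : ℝ) < d := by exact_mod_cast hd
  have hp := timedPot_nonneg (d := d) hK x
  have hsq : ∀ i, 0 ≤ cutSq i (if i = 0 then (n : ℝ) else 0) m x := by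
    intro i; unfold cutSq; split_ifs <;> positivity
  have hdr : ∀ i, 0 ≤ cutDrift i m x := by
    intro i; unfold cutDrift; split_ifs <;> positivity
  have hterm : ∀ i, 0 ≤ 4 * K ^ 2 / n ^ 2 * cutSq i (if i = 0 then (n : ℝ) else 0) m x
        + 2 * K / n * cutDrift i m x := by
    intro i
    have := hsq i
    have := hdr i
    positivity
  have hpt : 0 ≤ 3 * d / (2 * t * Real.exp m) * timedPot d K x := by positivity
  split_ifs with hT
  · exact add_nonneg hpt (Finset.sum_nonneg fun i _ => hterm i)
  · by_cases hm : x.time ≤ m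
    · have : ∃ i < d, n / K < |poiSum i x.graph x.time - if i = 0 then (n : ℝ) else 0| := by
        by_contra hcon
        push Not at hcon
        exact hT ⟨hm, hcon⟩
      obtain ⟨i, hi, hlt⟩ := this
      have h1 := Finset.single_le_sum (fun i _ => hterm i) (Finset.mem_range.2 hi)
      refine le_trans ?_ (add_le_add hpt h1)
      rw [zero_add]
      by_cases hR : n / (2 * K) ≤ |x.drift i|
      · have h2 : 1 ≤ 2 * K / n * cutDrift i m x := by
          rw [cutDrift, if_pos hm]
          calc (1 : ℝ) = 2 * K / n * (n / (2 * K)) := by field_simp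
            _ ≤ _ := by gcongr
        have h3 : 0 ≤ 4 * K ^ 2 / n ^ 2 * cutSq i (if i = 0 then (n : ℝ) else 0) m x := by
          have := hsq i
          positivity
        linarith
      · push Not at hR
        have h2 : 1 ≤ 4 * K ^ 2 / n ^ 2 * cutSq i (if i = 0 then (n : ℝ) else 0) m x := by
          rw [cutSq, if_pos hm]
          set c : ℝ := if i = 0 then (n : ℝ) else 0
          have h4 : n / (2 * K) ≤ |poiSum i x.graph x.time - x.drift i - c| := by
            have h5 : poiSum i x.graph x.time - c
              = (poiSum i x.graph x.time - x.drift i - c) + x.drift i := by ring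
            have h6 := abs_add_le (poiSum i x.graph x.time - x.drift i - c) (x.drift i)
            rw [← h5] at h6
            have h7 : (n : ℝ) / K = n / (2 * K) + n / (2 * K) := by field_simp; ring
            linarith
          rw [← sq_abs (poiSum i x.graph x.time - x.drift i - c)]
          calc (1 : ℝ) = 4 * K ^ 2 / n ^ 2 * (n / (2 * K)) ^ 2 := by field_simp; norm_num
            _ ≤ _ := by gcongr
        have h3 : 0 ≤ 2 * K / n * cutDrift i m x := by
          have := hdr i
          positivity
        linarith
    · push Not at hm
      have hU := hx.valid.le_mul_card_unsat hst
      have hU' : (2 * t : ℝ) ≤ d * (unsat d x.graph).card := by exact_mod_cast hU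
      have h1 : ((unsat d x.graph).card : ℝ) ≤ ∑ v, geoWeight (d - 1) K (deg x.graph v) := by
        rw [unsat, Finset.card_filter]
        push_cast
        apply Finset.sum_le_sum
        intro v _
        by_cases hv : deg x.graph v < d
        · rw [if_pos hv, geoWeight, if_pos (by omega)]
          exact one_le_pow₀ hK
        · rw [if_neg hv]
          exact geoWeight_nonneg hK
      have h2 : Real.exp m ≤ 3 * Real.exp (x.time * (1 - 1 / K)) := by
        have h3 : m / K ≤ 1 := by rw [div_le_one hK0]; exact hmK
        have h4 : 0 ≤ 1 - 1 / K := by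
          rw [sub_nonneg, div_le_one hK0]; exact hK
        calc Real.exp m ≤ Real.exp (1 + x.time * (1 - 1 / K)) := by
              apply Real.exp_le_exp.2
              have : m * (1 - 1 / K) = m - m / K := by ring
              nlinarith
          _ = Real.exp 1 * Real.exp (x.time * (1 - 1 / K)) := Real.exp_add _ _
          _ ≤ _ := by gcongr; exact exp_one_le_three
      have h5 : 2 * t * Real.exp m ≤ 3 * d * timedPot d K x := by
        unfold timedPot
        have h6 : 2 * (t : ℝ) ≤ d * ∑ v, geoWeight (d - 1) K (deg x.graph v) :=
          hU'.trans (by gcongr)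
        have h8 : 0 ≤ d * ∑ v, geoWeight (d - 1) K (deg x.graph v) := by linarith
        calc 2 * t * Real.exp m
            ≤ (d * ∑ v, geoWeight (d - 1) K (deg x.graph v))
              * (3 * Real.exp (x.time * (1 - 1 / K))) := by gcongr
          _ = _ := by ring
      have h7 : 1 ≤ 3 * d / (2 * t * Real.exp m) * timedPot d K x := by
        rw [div_mul_eq_mul_div, le_div_iff₀ (by positivity)]
        linarith
      have := Finset.sum_nonneg fun i (_ : i ∈ Finset.range d) => hterm i
      linarith

/-- The choice `e^m = n / K^{3d+3}` makes the Chebyshev term `(K²/n²) e^m n K^{3d}` equal to `1/K`.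
The Markov term `n K^{d-1} / (t e^m)` is then `K^{4d+2} / t`, which explains the hypothesis `K ^ (4
* d + 3) ≤ t`. -/
theorem iterate_not_typical_le (hd : 1 ≤ d) {K m : ℝ} {s t : ℕ} (hK : 1 ≤ K) (hm0 : 0 ≤ m)
    (hmK : m ≤ K) (hn : 1 ≤ n) (hst : s + t = d * n / 2) (ht : d * d ≤ t)
    (hlog : Real.log ((d * n / 2 : ℕ) : ℝ) ≤ 2 * K)
    (hm : Real.exp m * K ^ (3 * d + 3) = n) (htK : K ^ (4 * d + 3) ≤ t) :
    (timedStep d)^[s] (fun x => if Typical d K m x then 0 else 1) (TimedGraph.init n)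
      ≤ (2 * d + d * (4 * (432 * d * 9 ^ d) + 2 * (9 * (2 * d + 4) * d ^ 2 * 3 ^ d)))
        * Real.exp (3 * d ^ 3) / K := by
  have hdt : 1 ≤ d * d := Nat.one_le_iff_ne_zero.2 (by positivity)
  have ht1 := hdt.trans ht
  have hK0 : 0 < K := by linarith
  have hn0 : (0 : ℝ) < n := by exact_mod_cast hn
  have ht0 : (0 : ℝ) < t := by exact_mod_cast ht1
  have hI := timedInvariant (n := n) hd hst ht
  have h1 := iterate_mono hI timedValid_init (fun y hy =>
    indicator_not_typical_le hd hK hmK hn hst ht1 hy)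
  refine h1.trans ?_
  have h2 : (timedStep d)^[s] (fun x => 3 * d / (2 * t * Real.exp m) * timedPot d K x
      + ∑ i ∈ Finset.range d, (4 * K ^ 2 / n ^ 2 * cutSq i (if i = 0 then (n : ℝ) else 0) m x
        + 2 * K / n * cutDrift i m x)) (TimedGraph.init n)
      = 3 * d / (2 * t * Real.exp m) * (timedStep d)^[s] (timedPot d K) (TimedGraph.init n)
      + ∑ i ∈ Finset.range d, (4 * K ^ 2 / n ^ 2 *
        (timedStep d)^[s] (cutSq i (if i = 0 then (n : ℝ) else 0) m) (TimedGraph.init n)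
        + 2 * K / n * (timedStep d)^[s] (cutDrift i m) (TimedGraph.init n)) := by
    have e1 := congrFun (iterate_add (d := d) (gr := TimedGraph.graph) (upd := TimedGraph.next d)
      (F := fun x : TimedGraph n => 3 * d / (2 * t * Real.exp m) * timedPot d K x)
      (H := fun x => ∑ i ∈ Finset.range d,
        (4 * K ^ 2 / n ^ 2 * cutSq i (if i = 0 then (n : ℝ) else 0) m x
        + 2 * K / n * cutDrift i m x)) s) (TimedGraph.init n)
    refine e1.trans ?_
    rw [Pi.add_apply, iterate_const_mul, iterate_sum]
    congr 1
    apply Finset.sum_congr rfl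
    intro i _
    have e2 := congrFun (iterate_add (d := d) (gr := TimedGraph.graph) (upd := TimedGraph.next d)
      (F := fun x : TimedGraph n => 4 * K ^ 2 / n ^ 2 *
        cutSq i (if i = 0 then (n : ℝ) else 0) m x)
      (H := fun x => 2 * K / n * cutDrift i m x) s) (TimedGraph.init n)
    refine e2.trans ?_
    rw [Pi.add_apply, iterate_const_mul, iterate_const_mul]
    rfl
  refine h2.le.trans ?_
  set E := Real.exp (3 * (d : ℝ) ^ 3) with hE
  have hE0 : 0 < E := Real.exp_pos _
  have hexp : 0 < Real.exp m := Real.exp_pos m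
  have b1 : 3 * d / (2 * t * Real.exp m) *
      (timedStep d)^[s] (timedPot d K) (TimedGraph.init n) ≤ 2 * d * E / K := by
    have h3 := iterate_timedPot_le (n := n) hd hK hst ht le_rfl
    calc _ ≤ 3 * d / (2 * t * Real.exp m) * (E * (n * K ^ (d - 1))) := by gcongr
      _ = 3 / 2 * d * E * (K ^ (3 * d + 3) * K ^ (d - 1)) / t := by rw [← hm]; field_simp
      _ ≤ 3 / 2 * d * E * (K ^ (3 * d + 3) * K ^ (d - 1)) / K ^ (4 * d + 3) := by gcongr
      _ = 3 / 2 * d * E / K := by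
          rw [show 4 * d + 3 = (3 * d + 3) + (d - 1) + 1 by omega]
          field_simp
          ring
      _ ≤ 2 * d * E / K := by gcongr; norm_num
  have b2 : ∀ i ∈ Finset.range d, 4 * K ^ 2 / n ^ 2 *
        (timedStep d)^[s] (cutSq i (if i = 0 then (n : ℝ) else 0) m) (TimedGraph.init n)
        + 2 * K / n * (timedStep d)^[s] (cutDrift i m) (TimedGraph.init n)
      ≤ (4 * (432 * d * 9 ^ d) + 2 * (9 * (2 * d + 4) * d ^ 2 * 3 ^ d)) * E / K := by
    intro i hi
    have hi' := Finset.mem_range.1 hi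
    have h3 := iterate_cutSq_le hd hK hmK hm0 hst ht hi' hlog
    have h4 := iterate_cutDrift_le hd hK hmK hst ht hi'
    have c1 : 4 * K ^ 2 / n ^ 2 *
        (timedStep d)^[s] (cutSq i (if i = 0 then (n : ℝ) else 0) m) (TimedGraph.init n)
        ≤ 4 * (432 * d * 9 ^ d) * E / K := by
      calc _ ≤ 4 * K ^ 2 / n ^ 2 * (432 * d * 9 ^ d * E * (Real.exp m * (n * K ^ (3 * d)))) := by
            gcongr
        _ = 4 * (432 * d * 9 ^ d) * E / K * ((Real.exp m * K ^ (3 * d + 3)) / n) := by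
            field_simp; ring
        _ = _ := by rw [hm, div_self hn0.ne', mul_one]
    have c2 : 2 * K / n * (timedStep d)^[s] (cutDrift i m) (TimedGraph.init n)
        ≤ 2 * (9 * (2 * d + 4) * d ^ 2 * 3 ^ d) * E / K := by
      calc _ ≤ 2 * K / n *
            (9 * (2 * d + 4) * d ^ 2 * 3 ^ d * E * (n * K ^ (2 * d - 1)) / t) := by gcongr
        _ = 2 * (9 * (2 * d + 4) * d ^ 2 * 3 ^ d) * E * (K * K ^ (2 * d - 1)) / t := by
            field_simp
        _ ≤ 2 * (9 * (2 * d + 4) * d ^ 2 * 3 ^ d) * E * (K * K ^ (2 * d - 1)) / K ^ (2 * d + 1) := by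
            have : K ^ (2 * d + 1) ≤ t := le_trans (pow_le_pow_right₀ hK (by omega)) htK
            gcongr
        _ = _ := by
            rw [show 2 * d + 1 = (2 * d - 1) + 1 + 1 by omega]
            field_simp
            ring
    calc _ ≤ _ := add_le_add c1 c2
      _ = _ := by ring
  refine (add_le_add b1 (Finset.sum_le_sum b2)).trans (le_of_eq ?_)
  rw [Finset.sum_const, Finset.card_range, nsmul_eq_mul]
  ring

end

/-! ### From the almost-martingales back to degree counts. -/

section

open Classical

variable {n d : ℕ}

/-- The Poisson weights of opposite parameters are convolution inverses. -/
theorem sum_poi_mul_poi_neg (m : ℕ) (τ : ℝ) :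
    ∑ l ∈ Finset.range (m + 1), poi l τ * poi (m - l) (-τ) = if m = 0 then 1 else 0 := by
  have h1 : ∀ l ∈ Finset.range (m + 1), poi l τ * poi (m - l) (-τ)
      = (τ ^ l * (-τ) ^ (m - l) * (m.choose l : ℝ)) / m.factorial := by
    intro l hl
    have hl' : l ≤ m := by simpa [Nat.lt_succ_iff] using hl
    have h2 : (m.choose l : ℝ) * l.factorial * (m - l).factorial = m.factorial := by
      exact_mod_cast Nat.choose_mul_factorial_mul_factorial hl'
    have h3 : (l.factorial : ℝ) ≠ 0 := by positivity
    have h4 : ((m - l).factorial : ℝ) ≠ 0 := by positivity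
    have h5 : (m.choose l : ℝ) ≠ 0 := by
      exact_mod_cast (Nat.choose_pos hl').ne'
    rw [← h2]
    unfold poi
    have h6 : Real.exp (-τ) * Real.exp τ = 1 := by rw [← Real.exp_add]; simp
    field_simp
    linear_combination τ ^ l * (-τ) ^ (m - l) * h6
  rw [Finset.sum_congr rfl h1, ← Finset.sum_div, ← add_pow]
  split_ifs with h
  · simp [h]
  · simp [h]

theorem sum_poi_mul_poiShift_neg (i a : ℕ) (τ : ℝ) :
    ∑ l ∈ Finset.range (i + 1), poi l τ * poiShift (i - l) a (-τ) = if a = i then 1 else 0 := by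
  by_cases ha : a ≤ i
  · have h1 : ∑ l ∈ Finset.range (i + 1), poi l τ * poiShift (i - l) a (-τ)
        = ∑ l ∈ Finset.range (i - a + 1), poi l τ * poi (i - a - l) (-τ) := by
      symm
      refine (Finset.sum_congr rfl fun l hl => ?_).trans
        (Finset.sum_subset (Finset.range_subset_range.2 (by omega)) fun l hl hl' => ?_)
      · have := Finset.mem_range.1 hl
        rw [poiShift, if_pos (by omega)]
        congr 2; omega
      · have h1 := Finset.mem_range.1 hl
        have h2 : ¬ l < i - a + 1 := fun h => hl' (Finset.mem_range.2 h)
        rw [poiShift_of_lt (by omega), mul_zero]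
    rw [h1, sum_poi_mul_poi_neg]
    by_cases h : a = i
    · simp [h]
    · rw [if_neg h, if_neg (by omega)]
  · rw [if_neg (by omega)]
    apply Finset.sum_eq_zero
    intro l _
    rw [poiShift_of_lt (by omega), mul_zero]

/-- Convolving with Poisson weights of mean `τ` undoes the weights of mean `-τ` inside `poiSum`. -/
theorem degreeCount_eq_sum_poiSum (i : ℕ) (G : SimpleGraph (Fin n)) (τ : ℝ) :
    (degreeCount i G : ℝ) = ∑ l ∈ Finset.range (i + 1), poi l τ * poiSum (i - l) G τ := by
  unfold poiSum
  simp_rw [Finset.mul_sum]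
  rw [Finset.sum_comm]
  simp_rw [sum_poi_mul_poiShift_neg]
  rw [degreeCount_eq, Finset.sum_boole]

theorem Valid.sum_degreeCount {s : ℕ} {G : SimpleGraph (Fin n)} (h : Valid d s G) :
    ∑ i ∈ Finset.range d, (d - i) * degreeCount i G + 2 * s = d * n := by
  rw [← h.sum_deficit]
  congr 1
  have h1 : ∀ v : Fin n, d - deg G v
      = ∑ i ∈ Finset.range d, (d - i) * (if deg G v = i then 1 else 0) := by
    intro v
    by_cases hv : deg G v < d
    · rw [Finset.sum_eq_single (deg G v)]
      · simp
      · intro b _ hb; simp [Ne.symm hb]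
      · intro hc; exact absurd (Finset.mem_range.2 hv) hc
    · rw [Finset.sum_eq_zero]
      · omega
      · intro i hi
        have := Finset.mem_range.1 hi
        rw [if_neg (by omega), mul_zero]
  rw [Finset.sum_congr rfl fun v _ => h1 v, Finset.sum_comm]
  apply Finset.sum_congr rfl
  intro i _
  rw [← Finset.mul_sum, degreeCount_eq, Finset.card_filter]

theorem mul_pow_sub_pow_le {K τ : ℝ} (hτ : 0 ≤ τ) (hτK : τ ≤ K) (i : ℕ) :
    K * (K ^ i - τ ^ i) ≤ i * K ^ i * (K - τ) := by
  have hK : 0 ≤ K := hτ.trans hτK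
  induction i with
  | zero => simp
  | succ i ih =>
    have h1 : K * (K ^ (i + 1) - τ ^ (i + 1))
      = K * (K * (K ^ i - τ ^ i)) + K * τ ^ i * (K - τ) := by ring
    have h2 : τ ^ i ≤ K ^ i := by gcongr
    have h3 : K * τ ^ i * (K - τ) ≤ K * K ^ i * (K - τ) := by
      have : 0 ≤ K - τ := by linarith
      gcongr
    have h4 := mul_le_mul_of_nonneg_left ih hK
    rw [h1]
    push_cast
    calc _ ≤ K * (i * K ^ i * (K - τ)) + K * K ^ i * (K - τ) := add_le_add h4 h3
      _ = _ := by ring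

/-- Only the summand `l = i` of the inversion formula has the main term `n`. The at most `d`
deviations are `n/K` each, and replacing `τ^i` by `K^i` costs a relative error of order `(K - τ)/K`.
-/
theorem Typical.abs_degreeCount_sub_le {K m : ℝ} {x : TimedGraph n} (h : Typical d K m x)
    (hK : 1 ≤ K) (hmK : m ≤ K) (hx : 0 ≤ x.time) {i : ℕ} (hi : i < d) :
    |(degreeCount i x.graph : ℝ) - n * Real.exp (-x.time) * K ^ i / i.factorial|
      ≤ n * Real.exp (-x.time) * K ^ i * (d * ((1 + (K - x.time)) / K)) := by
  have hK0 : 0 < K := by linarith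
  set τ := x.time with hτ
  have hτK : τ ≤ K := h.1.trans hmK
  set E := Real.exp (-τ) with hE
  have hE0 : 0 < E := Real.exp_pos _
  have h1 : (degreeCount i x.graph : ℝ) - n * poi i τ
      = ∑ l ∈ Finset.range (i + 1), poi l τ *
        (poiSum (i - l) x.graph τ - if i - l = 0 then (n : ℝ) else 0) := by
    rw [degreeCount_eq_sum_poiSum i x.graph τ]
    simp_rw [mul_sub]
    rw [Finset.sum_sub_distrib]
    congr 1
    rw [Finset.sum_eq_single i]
    · simp [mul_comm]
    · intro l hl hne
      have := Finset.mem_range.1 hl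
      rw [if_neg (by omega), mul_zero]
    · intro hc; exact absurd (Finset.mem_range.2 (by omega)) hc
  have hpoi : ∀ l ≤ i, |poi l τ| ≤ E * K ^ i := by
    intro l hl
    rw [abs_of_nonneg (poi_nonneg l hx)]
    have h2 : (1 : ℝ) ≤ l.factorial := by exact_mod_cast Nat.one_le_of_lt (Nat.factorial_pos _)
    unfold poi
    refine (div_le_self (by positivity) h2).trans ?_
    have h3 : τ ^ l ≤ K ^ i := (by gcongr : τ ^ l ≤ K ^ l).trans (pow_le_pow_right₀ hK hl)
    gcongr
  have h4 : |(degreeCount i x.graph : ℝ) - n * poi i τ| ≤ d * (E * K ^ i * (n / K)) := by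
    rw [h1]
    refine (Finset.abs_sum_le_sum_abs _ _).trans ?_
    calc _ ≤ ∑ l ∈ Finset.range (i + 1), E * K ^ i * (n / K) := by
          apply Finset.sum_le_sum
          intro l hl
          have := Finset.mem_range.1 hl
          rw [abs_mul]
          have h5 := hpoi l (by omega)
          have h6 := h.2 (i - l) (by omega)
          gcongr
      _ = ((i + 1 : ℕ) : ℝ) * (E * K ^ i * (n / K)) := by
          rw [Finset.sum_const, Finset.card_range, nsmul_eq_mul]
      _ ≤ _ := by gcongr; omega
  have h7 : |n * poi i τ - n * E * K ^ i / i.factorial| ≤ n * E * (d * K ^ i * (K - τ) / K) := by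
    have h8 : n * poi i τ - n * E * K ^ i / i.factorial
        = - (n * E * ((K ^ i - τ ^ i) / i.factorial)) := by
      unfold poi; rw [← hE]; ring
    have h9 : 0 ≤ K ^ i - τ ^ i := by
      rw [sub_nonneg]; gcongr
    have h2 : (1 : ℝ) ≤ i.factorial := by exact_mod_cast Nat.one_le_of_lt (Nat.factorial_pos _)
    rw [h8, abs_neg, abs_of_nonneg (by positivity)]
    have h10 : (K ^ i - τ ^ i) / i.factorial ≤ d * K ^ i * (K - τ) / K := by
      refine (div_le_self h9 h2).trans ?_
      rw [le_div_iff₀ hK0]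
      have h11 := mul_pow_sub_pow_le hx hτK i
      have h12 : (i : ℝ) * K ^ i * (K - τ) ≤ d * K ^ i * (K - τ) := by
        have : 0 ≤ K - τ := by linarith
        gcongr
      linarith
    gcongr
  have h13 := abs_add_le ((degreeCount i x.graph : ℝ) - n * poi i τ)
    (n * poi i τ - n * E * K ^ i / i.factorial)
  rw [sub_add_sub_cancel] at h13
  refine h13.trans ((add_le_add h4 h7).trans (le_of_eq ?_))
  field_simp

set_option maxHeartbeats 800000 in
/-- The degree counts of a typical graph, in terms of the number of missing edges. -/
theorem Typical.abs_degreeCount_mul_sub_le {K m η : ℝ} {s t : ℕ} {x : TimedGraph n}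
    (h : Typical d K m x) (hv : TimedValid d s x) (hst : s + t = d * n / 2) (ht : K ≤ t)
    (hd : 1 ≤ d) (hK : 1 ≤ K) (hmK : m ≤ K) (hη : (1 + (K - x.time)) / K ≤ η)
    (hη1 : 8 * d ^ 3 * (d - 1).factorial * η ≤ 1) {i : ℕ} (hi : i < d) :
    |(degreeCount i x.graph : ℝ) * K ^ (d - 1 - i) - 2 * t * ((d - 1).factorial / i.factorial)|
      ≤ 31 * d ^ 3 * (d - 1).factorial ^ 2 * η * t := by
  have hK0 : 0 < K := by linarith
  set E := Real.exp (-x.time) with hE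
  have hE0 : 0 < E := Real.exp_pos _
  -- The scale `y` contains the random time. All scaled counts are close to `y / i!`; the deficit
  -- identity then determines `y` as about `2t (d-1)!`.
  set y := n * E * K ^ (d - 1) with hy
  have hy0 : 0 ≤ y := by positivity
  have hd1 : (1 : ℝ) ≤ d := by exact_mod_cast hd
  have ht1 : 1 ≤ (t : ℝ) := hK.trans ht
  set f : ℝ := ((d - 1).factorial : ℝ) with hf
  have hf1 : (1 : ℝ) ≤ f := by
    rw [hf]; exact_mod_cast Nat.one_le_of_lt (Nat.factorial_pos _)
  have hτK : x.time ≤ K := h.1.trans hmK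
  have hηK : 1 / K ≤ η := by
    refine le_trans ?_ hη
    gcongr
    linarith
  have hη0 : 0 ≤ η := le_trans (by positivity) hηK
  have hd3 : (1 : ℝ) ≤ d ^ 3 := one_le_pow₀ hd1
  have hη2 : d * η ≤ 1 := by
    have h1 : (d : ℝ) * 1 ≤ d * d ^ 2 := by gcongr; exact one_le_pow₀ hd1
    have h2 : (d : ℝ) * η ≤ 8 * d ^ 3 * f * η := by
      gcongr
      have : (d : ℝ) ^ 3 = d * d ^ 2 := by ring
      nlinarith
    linarith
  -- the estimate scaled by a power of `K`
  have hscaled : ∀ i < d, |(degreeCount i x.graph : ℝ) * K ^ (d - 1 - i) - y / i.factorial|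
      ≤ d * η * y := by
    intro i hi
    have h1 := h.abs_degreeCount_sub_le hK hmK hv.time_nonneg hi
    have hpow : K ^ (d - 1) = K ^ i * K ^ (d - 1 - i) := by
      rw [← pow_add]; congr 1; omega
    have h2 : (degreeCount i x.graph : ℝ) * K ^ (d - 1 - i) - y / i.factorial
        = ((degreeCount i x.graph : ℝ) - n * E * K ^ i / i.factorial) * K ^ (d - 1 - i) := by
      rw [hy, hpow]; ring
    rw [h2, abs_mul, abs_of_pos (by positivity : 0 < K ^ (d - 1 - i))]
    calc _ ≤ n * E * K ^ i * (d * ((1 + (K - x.time)) / K)) * K ^ (d - 1 - i) := by gcongr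
      _ ≤ n * E * K ^ i * (d * η) * K ^ (d - 1 - i) := by gcongr
      _ = _ := by rw [hy, hpow]; ring
  have hlow : ∀ i < d - 1, (degreeCount i x.graph : ℝ) ≤ 2 * y * η := by
    intro i hi
    have h1 := (abs_le.1 (hscaled i (by omega))).2
    have h2 : (1 : ℝ) ≤ i.factorial := by exact_mod_cast Nat.one_le_of_lt (Nat.factorial_pos _)
    have h3 : y / i.factorial ≤ y := div_le_self hy0 h2
    have h4 : (degreeCount i x.graph : ℝ) * K ^ (d - 1 - i) ≤ 2 * y := by
      have : d * η * y ≤ 1 * y := by gcongr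
      linarith
    have h5 : (degreeCount i x.graph : ℝ) * K ≤ 2 * y := by
      refine le_trans ?_ h4
      gcongr
      exact le_self_pow₀ hK (by omega)
    calc (degreeCount i x.graph : ℝ) ≤ 2 * y * (1 / K) := by
          rw [mul_one_div, le_div_iff₀ hK0]; exact h5
      _ ≤ _ := by gcongr
  -- The error 1 is the parity of `d * n`.
  have hdef : |∑ i ∈ Finset.range d, ((d - i : ℕ) : ℝ) * degreeCount i x.graph - 2 * t| ≤ 1 := by
    have h1 := hv.valid.sum_degreeCount
    have h2 : ∑ i ∈ Finset.range d, (d - i) * degreeCount i x.graph ≤ 2 * t + 1 := by omega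
    have h3 : 2 * t ≤ ∑ i ∈ Finset.range d, (d - i) * degreeCount i x.graph := by omega
    have h2' : ∑ i ∈ Finset.range d, ((d - i : ℕ) : ℝ) * degreeCount i x.graph ≤ 2 * t + 1 := by
      exact_mod_cast h2
    have h3' : (2 * t : ℝ) ≤ ∑ i ∈ Finset.range d, ((d - i : ℕ) : ℝ) * degreeCount i x.graph := by
      exact_mod_cast h3
    rw [abs_le]; constructor <;> linarith
  have hsplit : ∑ i ∈ Finset.range d, ((d - i : ℕ) : ℝ) * degreeCount i x.graph
      = ∑ i ∈ Finset.range (d - 1), ((d - i : ℕ) : ℝ) * degreeCount i x.graph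
        + degreeCount (d - 1) x.graph := by
    have h1 : d = d - 1 + 1 := by omega
    conv_lhs => rw [h1, Finset.sum_range_succ]
    rw [← h1]
    have h2 : d - (d - 1) = 1 := by omega
    rw [h2]; simp
  have hrest0 : 0 ≤ ∑ i ∈ Finset.range (d - 1), ((d - i : ℕ) : ℝ) * degreeCount i x.graph := by
    positivity
  have hrest : ∑ i ∈ Finset.range (d - 1), ((d - i : ℕ) : ℝ) * degreeCount i x.graph
      ≤ d * (d * (2 * y * η)) := by
    calc _ ≤ ∑ i ∈ Finset.range (d - 1), (d : ℝ) * (2 * y * η) := by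
          apply Finset.sum_le_sum
          intro i hi
          have h1 := hlow i (Finset.mem_range.1 hi)
          have h2 : ((d - i : ℕ) : ℝ) ≤ d := by exact_mod_cast Nat.sub_le d i
          gcongr
      _ = ((d - 1 : ℕ) : ℝ) * ((d : ℝ) * (2 * y * η)) := by
          rw [Finset.sum_const, Finset.card_range, nsmul_eq_mul]
      _ ≤ _ := by
          have : ((d - 1 : ℕ) : ℝ) ≤ d := by exact_mod_cast Nat.sub_le d 1
          gcongr
  have htop := hscaled (d - 1) (by omega)
  rw [Nat.sub_self, pow_zero, mul_one, ← hf] at htop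
  have hmain : |2 * t - y / f| ≤ 1 + 3 * d ^ 3 * η * y := by
    have h1 := abs_le.1 hdef
    have h2 := abs_le.1 htop
    rw [hsplit] at h1
    have h3 : d * η * y + d * (d * (2 * y * η)) ≤ 3 * d ^ 3 * η * y := by
      have h6 : (d : ℝ) ≤ d ^ 3 := le_self_pow₀ hd1 (by norm_num)
      have h7 : (d : ℝ) ^ 2 ≤ d ^ 3 := pow_le_pow_right₀ hd1 (by norm_num)
      have h5 : (d : ℝ) + 2 * d ^ 2 ≤ 3 * d ^ 3 := by linarith
      have h4 := mul_le_mul_of_nonneg_right h5 (by positivity : 0 ≤ η * y)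
      linarith
    rw [abs_le]; constructor <;> linarith
  -- By `hη1` the error `3d³ηy` is at most half of `y / f`, so it can be absorbed.
  have hyt : y ≤ 6 * t * f := by
    have h1 := (abs_le.1 hmain).1
    have h2 : 3 * d ^ 3 * η * y ≤ y / (2 * f) := by
      rw [le_div_iff₀ (by positivity)]
      calc 3 * d ^ 3 * η * y * (2 * f) = 6 / 8 * (8 * d ^ 3 * f * η) * y := by ring
        _ ≤ 6 / 8 * 1 * y := by gcongr
        _ ≤ y := by linarith
    have h3 : y / f = y / (2 * f) + y / (2 * f) := by field_simp; ring
    have h4 : y / (2 * f) ≤ 3 * t := by linarith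
    rw [div_le_iff₀ (by positivity)] at h4
    linarith
  -- Lets the parity error be counted as a relative error.
  have hone : 1 ≤ η * t := by
    calc (1 : ℝ) = 1 / K * K := by field_simp
      _ ≤ η * t := by gcongr
  have hmain2 : |2 * t - y / f| ≤ 19 * d ^ 3 * f * η * t := by
    refine hmain.trans ?_
    have h1 : 3 * d ^ 3 * η * y ≤ 3 * d ^ 3 * η * (6 * t * f) := by gcongr
    have h2 : η * t ≤ d ^ 3 * f * (η * t) := by
      have h3 : (1 : ℝ) ≤ d ^ 3 * f := by nlinarith
      exact le_mul_of_one_le_left (by positivity) h3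
    have h5 : 3 * d ^ 3 * η * (6 * t * f) = 18 * (d ^ 3 * f * (η * t)) := by ring
    have h6 : 19 * d ^ 3 * f * η * t = 19 * (d ^ 3 * f * (η * t)) := by ring
    linarith
  have hfi : (0 : ℝ) < i.factorial := by positivity
  have hfi1 : (1 : ℝ) ≤ i.factorial := by exact_mod_cast Nat.one_le_of_lt (Nat.factorial_pos _)
  have hfin : (degreeCount i x.graph : ℝ) * K ^ (d - 1 - i) - 2 * t * (f / i.factorial)
      = ((degreeCount i x.graph : ℝ) * K ^ (d - 1 - i) - y / i.factorial)
        - f / i.factorial * (2 * t - y / f) := by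
    field_simp
    ring
  rw [hfin]
  refine (abs_sub _ _).trans ?_
  rw [abs_mul, abs_of_nonneg (by positivity : 0 ≤ f / i.factorial)]
  have h1 := hscaled i hi
  have h2 : d * η * y ≤ d * η * (6 * t * f) := by gcongr
  have h3 : f / i.factorial * |2 * t - y / f| ≤ f * (19 * d ^ 3 * f * η * t) := by
    have := div_le_self (by linarith : 0 ≤ f) hfi1
    gcongr
  have h4 : d * η * (6 * t * f) ≤ 6 * d ^ 3 * f ^ 2 * η * t := by
    have h5 : (d : ℝ) * f ≤ d ^ 3 * f ^ 2 := by
      have h6 : (d : ℝ) ≤ d ^ 3 := le_self_pow₀ hd1 (by norm_num)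
      have h7 : f ≤ f ^ 2 := le_self_pow₀ hf1 (by norm_num)
      gcongr
    have h8 := mul_le_mul_of_nonneg_right h5 (by positivity : 0 ≤ 6 * (η * t))
    have h10 : d * η * (6 * t * f) = d * f * (6 * (η * t)) := by ring
    have h11 : 6 * d ^ 3 * f ^ 2 * η * t = d ^ 3 * f ^ 2 * (6 * (η * t)) := by ring
    linarith
  have h9 : 0 ≤ d ^ 3 * f ^ 2 * η * t := by positivity
  calc _ ≤ d * η * y + f / i.factorial * |2 * t - y / f| := by gcongr
    _ ≤ 6 * d ^ 3 * f ^ 2 * η * t + f * (19 * d ^ 3 * f * η * t) := by linarith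
    _ = 25 * (d ^ 3 * f ^ 2 * η * t) := by ring
    _ ≤ 31 * (d ^ 3 * f ^ 2 * η * t) := by linarith
    _ = _ := by ring

end

/-! ### Late phase: hit chances and decay of potentials. -/

section

open Classical

variable {n d : ℕ}

/-- The facts which hold surely `k` steps after the graph `G₀`, itself reached at step `s`. -/
structure LateValid (d s : ℕ) (G₀ : SimpleGraph (Fin n)) (k : ℕ) (G : SimpleGraph (Fin n)) :
    Prop where
  valid : Valid d (s + k) G
  mono : ∀ v, deg G₀ v ≤ deg G v

section

variable {s T t₀ t : ℕ} {G₀ G : SimpleGraph (Fin n)}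

theorem lateInvariant (hd : 1 ≤ d) (hst : s + t₀ = d * n / 2) (hT : T + t = t₀) (ht : d * d ≤ t) :
    Invariant d id addEdge (LateValid d s G₀) T := by
  have hU : ∀ k < T, ∀ G, LateValid d s G₀ k G → 2 * d ≤ (unsat d G).card := by
    intro k hk G hG
    exact hG.valid.two_mul_le_card_unsat (r := t₀ - k) hd (by omega) (by omega)
  refine ⟨fun k hk G hG => addable_pos hd (hU k hk G hG), fun k hk G hG e he => ?_⟩
  refine ⟨hG.valid.addEdge he, fun v => ?_⟩
  have he' : e ∈ addable d G := he
  rw [deg_addEdge he']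
  have := hG.mono v
  omega

theorem lateValid_zero (h : Valid d s G₀) : LateValid d s G₀ 0 G₀ := ⟨h, fun _ => le_rfl⟩

/-- The lower bound uses only that at most `2r + 1` vertices are unsaturated, so it holds whatever
the number of low-degree vertices. -/
theorem Valid.le_hit {s r : ℕ} (h : Valid d s G) (hd : 1 ≤ d) (hr : s + r = d * n / 2)
    (hrd : d * d ≤ r) {v : Fin n} (hv : deg G v < d) :
    1 / (r : ℝ) - (d ^ 3 + 1) / r ^ 2 ≤ hit d G v := by
  have hdd : 1 ≤ d * d := Nat.one_le_iff_ne_zero.2 (by positivity)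
  have hU := h.two_mul_le_card_unsat hd hr hrd
  have h1 := (abs_le.1 (abs_hit_sub_rate_le hd hU hv)).1
  have h2 := h.rate_le hr (by omega)
  have h3 := h.le_rate hr (by omega)
  have h0 := rate_nonneg (d := d) (G := G)
  have hr0 : (1 : ℝ) ≤ r := by exact_mod_cast hdd.trans hrd
  have h4 : d * rate d G ^ 2 ≤ d * (d / r) ^ 2 := by gcongr
  have h5 : (d : ℝ) * (d / r) ^ 2 = d ^ 3 / r ^ 2 := by field_simp
  have h6 : 1 / (r : ℝ) - 1 / r ^ 2 ≤ 2 / (2 * r + 1) := by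
    rw [div_sub_div _ _ (by positivity) (by positivity), div_le_div_iff₀ (by positivity)
      (by positivity)]
    nlinarith
  have h7 : ((d : ℝ) ^ 3 + 1) / r ^ 2 = d ^ 3 / r ^ 2 + 1 / r ^ 2 := by ring
  linarith

/-- The two-sided bound needs about `2r` unsaturated vertices, and this can fail by up to `d *
lowCount`. -/
theorem Valid.abs_hit_sub_le {s r : ℕ} (h : Valid d s G) (hd : 1 ≤ d) (hr : s + r = d * n / 2)
    (hrd : d * d ≤ r) {v : Fin n} (hv : deg G v < d) :
    |hit d G v - 1 / r| ≤ 2 * d ^ 3 * (1 + lowCount d G) / r ^ 2 := by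
  have hdd : 1 ≤ d * d := Nat.one_le_iff_ne_zero.2 (by positivity)
  have hU := h.two_mul_le_card_unsat hd hr hrd
  have h1 := abs_hit_sub_rate_le hd hU hv
  have h2 := h.rate_le hr (by omega)
  have h0 := rate_nonneg (d := d) (G := G)
  have hr0 : (1 : ℝ) ≤ r := by exact_mod_cast hdd.trans hrd
  have hd1 : (1 : ℝ) ≤ d := by exact_mod_cast hd
  have h4 : d * rate d G ^ 2 ≤ d * (d / r) ^ 2 := by gcongr
  have h5 : (d : ℝ) * (d / r) ^ 2 = d ^ 3 / r ^ 2 := by field_simp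
  have h6 : (2 * r : ℝ) ≤ (unsat d G).card + d * lowCount d G := by
    exact_mod_cast h.le_card_unsat_add hr
  have h7 : ((unsat d G).card : ℝ) ≤ 2 * r + 1 := by exact_mod_cast h.card_unsat_le hr
  have hU0 : (0 : ℝ) < (unsat d G).card := by exact_mod_cast (by omega : 0 < (unsat d G).card)
  have hZ : (0 : ℝ) ≤ lowCount d G := by positivity
  have h8 : |rate d G - 1 / r| ≤ d ^ 3 * (1 + lowCount d G) / r ^ 2 := by
    have h9 : rate d G - 1 / r = rate d G * ((2 * r - (unsat d G).card) / (2 * r)) := by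
      unfold rate; field_simp
    rw [h9, abs_mul, abs_of_nonneg h0, abs_div, abs_of_pos (by positivity : (0 : ℝ) < 2 * r)]
    have h10 : |2 * (r : ℝ) - (unsat d G).card| ≤ d * (1 + lowCount d G) := by
      rw [abs_le]; constructor <;> nlinarith
    have hrpos : (0 : ℝ) < r := by linarith
    calc rate d G * (|2 * (r : ℝ) - (unsat d G).card| / (2 * r))
        ≤ (d / r : ℝ) * (d * (1 + lowCount d G) / (2 * r)) := by gcongr
      _ = (d : ℝ) ^ 2 * (1 + lowCount d G) / (2 * r ^ 2) := by field_simp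
      _ ≤ (d : ℝ) ^ 3 * (1 + lowCount d G) / (1 * r ^ 2) := by
          have e1 : (d : ℝ) ^ 2 ≤ d ^ 3 := pow_le_pow_right₀ hd1 (by norm_num)
          have e2 : 1 * (r : ℝ) ^ 2 ≤ 2 * r ^ 2 := by nlinarith [sq_nonneg (r : ℝ)]
          gcongr
      _ = _ := by rw [one_mul]
  have h11 := abs_add_le (hit d G v - rate d G) (rate d G - 1 / r)
  rw [sub_add_sub_cancel] at h11
  have h12 : (d : ℝ) ^ 3 / r ^ 2 ≤ d ^ 3 * (1 + lowCount d G) / r ^ 2 := by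
    gcongr
    have : (0 : ℝ) ≤ d ^ 3 := by positivity
    nlinarith
  have h13 : 2 * (d : ℝ) ^ 3 * (1 + lowCount d G) / r ^ 2
    = d ^ 3 * (1 + lowCount d G) / r ^ 2 + d ^ 3 * (1 + lowCount d G) / r ^ 2 := by ring
  linarith

/-- Iterating a multiplicative one-step decay. -/
theorem iterate_le_of_decay {Inv : ℕ → SimpleGraph (Fin n) → Prop}
    (hI : Invariant d id addEdge Inv T) (h0 : Inv 0 G₀) (hT : T + t = t₀) (ht : 1 ≤ t)
    {F : SimpleGraph (Fin n) → ℝ} (hF : ∀ G, 0 ≤ F G) {a : ℕ} {η C : ℝ} (hη : 0 ≤ η) (hC : 0 ≤ C)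
    (hη1 : η * Real.log t₀ ≤ 1)
    (hstep : ∀ k < T, ∀ G, Inv k G → graphStep d F G
      ≤ F G * (1 - a / ((t₀ : ℝ) - k) + η / ((t₀ : ℝ) - k) + C / ((t₀ : ℝ) - k) ^ 2))
    {k : ℕ} (hk : k ≤ T) :
    (graphStep d)^[k] F G₀ ≤ F G₀ * (Real.exp (C + 1) * (2 * ((t₀ : ℝ) - k) / t₀) ^ a) := by
  -- Chosen so that `exp (-φ r) * F` is a supermartingale: the decrements of `log (r + 1)` are at
  -- most `1/r`, those of `log r` at least `1/r`, and `C/r` telescopes over `C/r²`.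
  set φ : ℝ → ℝ := fun r => a * Real.log (r + 1) - η * Real.log r + C / r with hφ
  have ht' : (1 : ℝ) ≤ t := by exact_mod_cast ht
  have hT' : (T : ℝ) + t = t₀ := by exact_mod_cast hT
  have hrk : ∀ l ≤ T, (1 : ℝ) ≤ (t₀ : ℝ) - l := by
    intro l hl
    have : (l : ℝ) ≤ T := by exact_mod_cast hl
    linarith
  have hsup := iterate_le_of_super (hI.mono hk) h0
    (fun l G => Real.exp (-φ ((t₀ : ℝ) - l)) * F G) (by
      intro l hl G hG
      have h1 := hstep l (by omega) G hG
      have hr1 : (1 : ℝ) ≤ (t₀ : ℝ) - (l + 1 : ℕ) := hrk (l + 1) (by omega)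
      rw [avgStep_const_mul]
      have h2 : (t₀ : ℝ) - ((l + 1 : ℕ) : ℝ) = t₀ - l - 1 := by push_cast; ring
      rw [h2] at hr1 ⊢
      set r := (t₀ : ℝ) - l
      have hrpos : 0 < r := by linarith
      have h3 : 1 - a / r + η / r + C / r ^ 2 ≤ Real.exp (φ (r - 1) - φ r) := by
        refine le_trans ?_ (Real.add_one_le_exp _)
        have h4 : Real.log (r + 1) - Real.log r ≤ 1 / r := by
          rw [← Real.log_div (by linarith) (by linarith)]
          refine (Real.log_le_sub_one_of_pos (by positivity)).trans (le_of_eq ?_)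
          field_simp
          ring
        have h5 : 1 / r ≤ Real.log r - Real.log (r - 1) := by
          have h6 : Real.log (r - 1) - Real.log r ≤ -(1 / r) := by
            rw [← Real.log_div (by linarith) (by linarith)]
            refine (Real.log_le_sub_one_of_pos (div_pos (by linarith) (by linarith))).trans ?_
            apply le_of_eq
            field_simp
            ring
          linarith
        have h7 := inv_sq_le_sub (by linarith : 1 < r)
        have e1 := mul_le_mul_of_nonneg_left h4 (Nat.cast_nonneg (α := ℝ) a)
        have e2 := mul_le_mul_of_nonneg_left h5 hη
        have e3 := mul_le_mul_of_nonneg_left h7 hC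
        simp only [hφ]
        rw [sub_add_cancel]
        have f1 : (a : ℝ) / r = a * (1 / r) := by ring
        have f2 : η / r = η * (1 / r) := by ring
        have f3 : C / r ^ 2 = C * (1 / r ^ 2) := by ring
        have f4 : C / (r - 1) = C * (1 / (r - 1)) := by ring
        have f5 : C / r = C * (1 / r) := by ring
        rw [f1, f2, f3, f4, f5]
        linarith
      have h8 := hF G
      calc _ ≤ Real.exp (-φ (r - 1)) * (F G * Real.exp (φ (r - 1) - φ r)) := by
            have := h1.trans (mul_le_mul_of_nonneg_left h3 h8)
            exact mul_le_mul_of_nonneg_left this (Real.exp_pos _).le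
        _ = Real.exp (-φ r) * F G := by
            rw [mul_left_comm, ← Real.exp_add, mul_comm]; congr 2; ring)
  rw [iterate_const_mul] at hsup
  have hr := hrk k hk
  have ht0 : (1 : ℝ) ≤ t₀ := by simpa using hrk 0 (by omega)
  have h9 : (graphStep d)^[k] F G₀ ≤ F G₀ * Real.exp (φ (t₀ - k) - φ t₀) := by
    have h10 : Real.exp (φ (t₀ - k)) * (Real.exp (-φ (t₀ - k)) * (graphStep d)^[k] F G₀)
        ≤ Real.exp (φ (t₀ - k)) * (Real.exp (-φ (t₀ - (0 : ℕ))) * F G₀) :=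
      mul_le_mul_of_nonneg_left hsup (Real.exp_pos _).le
    rw [← mul_assoc, ← Real.exp_add, add_neg_cancel, Real.exp_zero, one_mul, ← mul_assoc,
      ← Real.exp_add, Nat.cast_zero, sub_zero, mul_comm, ← sub_eq_add_neg] at h10
    exact h10
  refine h9.trans (mul_le_mul_of_nonneg_left ?_ (hF G₀))
  set r := (t₀ : ℝ) - k with hrdef
  have hrt : r ≤ t₀ := by
    have : (0 : ℝ) ≤ k := by positivity
    linarith
  -- The `+ 1` pays for `η * log t₀`.
  have h11 : φ r - φ t₀ ≤ (C + 1) + a * Real.log (2 * r / t₀) := by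
    simp only [hφ]
    have h12 : 0 ≤ η * Real.log r := mul_nonneg hη (Real.log_nonneg hr)
    have h13 : C / r ≤ C := div_le_self hC hr
    have h14 : 0 ≤ C / t₀ := by positivity
    have h15 : Real.log (r + 1) - Real.log (t₀ + 1) ≤ Real.log (2 * r / t₀) := by
      rw [← Real.log_div (by linarith) (by linarith)]
      apply Real.log_le_log (by positivity)
      rw [div_le_div_iff₀ (by positivity) (by positivity)]
      nlinarith
    have h16 := mul_le_mul_of_nonneg_left h15 (Nat.cast_nonneg (α := ℝ) a)
    linarith
  refine (Real.exp_le_exp.2 h11).trans (le_of_eq ?_)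
  rw [Real.exp_add, Real.exp_nat_mul, Real.exp_log (by positivity)]

end

/-- The number of vertices of `A` that have degree `j`. -/
noncomputable def aliveCount (A : Finset (Fin n)) (j : ℕ) (G : SimpleGraph (Fin n)) : ℕ :=
  (A.filter fun v => deg G v = j).card

/-- The indicator that `v` has degree `j`. -/
noncomputable def alive (j : ℕ) (G : SimpleGraph (Fin n)) (v : Fin n) : ℝ :=
  if deg G v = j then 1 else 0

theorem aliveCount_eq (A : Finset (Fin n)) (j : ℕ) (G : SimpleGraph (Fin n)) :
    (aliveCount A j G : ℝ) = ∑ v ∈ A, alive j G v := by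
  simp [aliveCount, alive]

theorem alive_nonneg (j : ℕ) (G : SimpleGraph (Fin n)) (v : Fin n) : 0 ≤ alive j G v := by
  unfold alive; split_ifs <;> norm_num

theorem alive_addEdge {j : ℕ} {G : SimpleGraph (Fin n)} {e : Sym2 (Fin n)} (he : e ∈ addable d G)
    {v : Fin n} (hv : j ≤ deg G v) :
    alive j (addEdge G e) v = alive j G v * (1 - if v ∈ e then 1 else 0) := by
  unfold alive
  rw [deg_addEdge he]
  by_cases h1 : v ∈ e
  · simp only [h1, if_true]
    rw [if_neg (by omega)]
    simp
  · simp [h1]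

/-- Weighted number of pairs of a vertex of degree `j` in `A` and another vertex of low degree. -/
noncomputable def pairPot (d j : ℕ) (β : ℝ) (A : Finset (Fin n)) (G : SimpleGraph (Fin n)) : ℝ :=
  ∑ v ∈ A, ∑ w ∈ Finset.univ.erase v, alive j G v * geoWeight (d - 2) β (deg G w)

section

variable {s r j : ℕ} {G : SimpleGraph (Fin n)} {A : Finset (Fin n)}

/-- The bound is written with `(1 : ℕ)` and `0` to fit `iterate_le_of_decay`. -/
theorem graphStep_aliveCount_le (hd : 1 ≤ d) (hj : j < d) (h : Valid d s G)
    (hr : s + r = d * n / 2) (hrd : d * d ≤ r) (hA : ∀ v ∈ A, j ≤ deg G v) :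
    graphStep d (fun G => (aliveCount A j G : ℝ)) G
      ≤ aliveCount A j G * (1 - (1 : ℕ) / (r : ℝ) + 0 / (r : ℝ) + (d ^ 3 + 1) / (r : ℝ) ^ 2) := by
  have hE := addable_pos hd (h.two_mul_le_card_unsat hd hr hrd)
  rw [graphStep, avgStep_eq hE]
  simp only [aliveCount_eq, id]
  rw [favg_sum, Finset.sum_mul]
  apply Finset.sum_le_sum
  intro v hv
  rw [favg_congr fun e he => alive_addEdge he (hA v hv), favg_const_mul, favg_sub, favg_const hE,
    favg_mem]
  by_cases hvj : deg G v = j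
  · have := h.le_hit hd hr hrd (v := v) (by omega)
    apply mul_le_mul_of_nonneg_left _ (alive_nonneg j G v)
    simp only [Nat.cast_one, zero_div]
    linarith
  · simp [alive, hvj]

theorem one_sub_mul_drop_le {p κ x c : ℝ} (hc : 0 ≤ c) (hp : x - c ≤ p) (hκ0 : 0 ≤ κ)
    (hκ1 : κ ≤ 1) : 1 - p * κ ≤ 1 - x + x * (1 - κ) + c := by
  nlinarith

theorem graphStep_geoWeight_le (hd : 1 ≤ d) (hj : j < d) (h : Valid d s G)
    (hr : s + r = d * n / 2) (hrd : d * d ≤ r) {β : ℝ} (hβ : 1 ≤ β) (B : Finset (Fin n)) :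
    graphStep d (fun G => ∑ v ∈ B, geoWeight j β (deg G v)) G
      ≤ (∑ v ∈ B, geoWeight j β (deg G v))
        * (1 - (1 : ℕ) / (r : ℝ) + (1 / β) / (r : ℝ) + (d ^ 3 + 1) / (r : ℝ) ^ 2) := by
  have hE := addable_pos hd (h.two_mul_le_card_unsat hd hr hrd)
  rw [graphStep, avgStep_eq hE]
  simp only [id]
  rw [favg_sum_deg hE (fun _ => geoWeight j β), Finset.sum_mul]
  apply Finset.sum_le_sum
  intro v _
  refine (geoWeight_drop_le hβ (hit_nonneg v)).trans ?_
  rw [mul_comm]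
  by_cases hvj : deg G v ≤ j
  · have h1 := h.le_hit hd hr hrd (v := v) (by omega)
    apply mul_le_mul_of_nonneg_left _ (geoWeight_nonneg hβ)
    have hβ0 : 0 < β := by linarith
    have h2 : (1 : ℝ) / β ≤ 1 := by rw [div_le_one hβ0]; exact hβ
    have h3 : 0 < 1 / β := by positivity
    refine (one_sub_mul_drop_le (by positivity) h1 (by linarith) (by linarith)).trans
      (le_of_eq ?_)
    push_cast
    ring
  · rw [geoWeight, if_neg hvj]; simp

/-- At most one pair covers both `v` and `w`, so up to `d²/r²` their hits are disjoint events and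
the two decay rates `1/r` add up. A hit on `w` may leave it low, which costs the term `1/β`. -/
theorem graphStep_pairPot_le (hd : 2 ≤ d) (hj : j < d) (h : Valid d s G)
    (hr : s + r = d * n / 2) (hrd : d * d ≤ r) {β : ℝ} (hβ : 1 ≤ β)
    (hA : ∀ v ∈ A, j ≤ deg G v) :
    graphStep d (pairPot d j β A) G ≤ pairPot d j β A G *
      (1 - (2 : ℕ) / (r : ℝ) + (1 / β) / (r : ℝ) + (2 * (d ^ 3 + 1) + d ^ 2) / (r : ℝ) ^ 2) := by
  have hU := h.two_mul_le_card_unsat (by omega) hr hrd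
  have hE := addable_pos (by omega) hU
  rw [graphStep, avgStep_eq hE]
  simp only [id, pairPot]
  rw [favg_sum, Finset.sum_mul]
  apply Finset.sum_le_sum
  intro v hv
  rw [favg_sum, Finset.sum_mul]
  apply Finset.sum_le_sum
  intro w hw
  have hwv : v ≠ w := (Finset.ne_of_mem_erase hw).symm
  set ω := geoWeight (d - 2) β (deg G w) with hω
  set Δ := geoWeight (d - 2) β (deg G w + 1) - ω with hΔ
  have hω0 : 0 ≤ ω := geoWeight_nonneg hβ
  have ha0 := alive_nonneg j G v
  have h1 : favg (addable d G) (fun e => alive j (addEdge G e) v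
        * geoWeight (d - 2) β (deg (addEdge G e) w))
      = favg (addable d G) (fun e => alive j G v * ((ω - ω * (if v ∈ e then 1 else 0))
        + (Δ * (if w ∈ e then 1 else 0)
        - Δ * ((if v ∈ e then 1 else 0) * (if w ∈ e then 1 else 0))))) := by
    apply favg_congr
    intro e he
    rw [alive_addEdge he (hA v hv), deg_addEdge he]
    by_cases hv' : v ∈ e <;> by_cases hw' : w ∈ e <;> simp [hv', hw', hΔ, hω]
  rw [h1, favg_const_mul, favg_add, favg_sub, favg_sub, favg_const hE, favg_const_mul,
    favg_const_mul, favg_const_mul, favg_mem, favg_mem, mul_assoc (alive j G v)]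
  have hq := favg_mem_mem_le (G := G) (d := d) (by omega) hU hwv
  set q := favg (addable d G) (fun e => (if v ∈ e then (1 : ℝ) else 0) * (if w ∈ e then 1 else 0))
  have hq0 : 0 ≤ q := by
    have : favg (addable d G) (fun _ => (0 : ℝ)) ≤ q := favg_mono fun e _ => by
      split_ifs <;> norm_num
    rwa [favg_const hE] at this
  have hr1 : (1 : ℝ) ≤ r := by
    have : 1 ≤ d * d := Nat.one_le_iff_ne_zero.2 (by positivity)
    exact_mod_cast this.trans hrd
  have hrate := h.rate_le hr (by
    have : 1 ≤ d * d := Nat.one_le_iff_ne_zero.2 (by positivity)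
    omega)
  have hq2 : q ≤ d ^ 2 / r ^ 2 := by
    refine hq.trans ?_
    have h0 := rate_nonneg (d := d) (G := G)
    calc rate d G ^ 2 ≤ (d / r) ^ 2 := by gcongr
      _ = _ := by rw [div_pow]
  by_cases hvj : deg G v = j
  · by_cases hwd : deg G w ≤ d - 2
    · apply mul_le_mul_of_nonneg_left _ ha0
      have hpv := h.le_hit (by omega) hr hrd (v := v) (by omega)
      have hpw := h.le_hit (by omega) hr hrd (v := w) (by omega)
      have hβ0 : 0 < β := by linarith
      have hβ1 : (1 : ℝ) / β ≤ 1 := by rw [div_le_one hβ0]; exact hβ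
      have hβ2 : 0 < 1 / β := by positivity
      have hdrop := geoWeight_drop_le (m := d - 2) (a := deg G w) hβ (hit_nonneg (d := d) (G := G) w)
      rw [← hω, ← hΔ] at hdrop
      have h2 : -(Δ * q) ≤ ω * (d ^ 2 / r ^ 2) := by
        have h3 : -Δ ≤ ω := by
          rw [hΔ]
          have := geoWeight_nonneg (m := d - 2) (a := deg G w + 1) hβ
          linarith
        calc -(Δ * q) = -Δ * q := by ring
          _ ≤ ω * q := by gcongr
          _ ≤ _ := by gcongr
      have hc : (0 : ℝ) ≤ (d ^ 3 + 1) / r ^ 2 := by positivity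
      have h4 := one_sub_mul_drop_le hc hpw (by linarith : 0 ≤ 1 - 1 / β) (by linarith)
      have h5 := mul_le_mul_of_nonneg_right h4 hω0
      have h6 := mul_le_mul_of_nonneg_left hpv hω0
      have h7 : ω * (1 - (2 : ℕ) / (r : ℝ) + 1 / β / r + (2 * (d ^ 3 + 1) + d ^ 2) / r ^ 2)
          = (1 - 1 / (r : ℝ) + 1 / r * (1 - (1 - 1 / β)) + (d ^ 3 + 1) / r ^ 2) * ω
            - ω * (1 / r - (d ^ 3 + 1) / r ^ 2) + ω * (d ^ 2 / r ^ 2) := by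
        push_cast; ring
      rw [h7]
      linarith
    · have : ω = 0 := by rw [hω, geoWeight, if_neg hwd]
      have h2 : Δ = 0 := by rw [hΔ, this, geoWeight, if_neg (by omega)]; simp
      rw [this, h2]; simp
  · simp [alive, hvj]

end

end

/-! ### Late phase: one step as a thinning of the survivors. -/

section

open Classical

variable {n d : ℕ}

/-- An edge covers at most two vertices; linearity in the number of hits fails only for `k = 2`, by
a second difference. -/
theorem abs_thin_sub_sub_le {g : ℕ → ℝ} {q : ℝ} (hg : ∀ y, |g y| ≤ 1) (hq0 : 0 ≤ q) (hq1 : q ≤ 1)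
    {x x' k : ℕ} (hx : x' + k = x) (hk : k ≤ 2) (y : ℕ) :
    |thin g q x' y - thin g q x y - k * (thin g q (x - 1) y - thin g q x y)|
      ≤ 2 * q * (k * (k - 1)) := by
  subst hx
  interval_cases k
  · simp
  · simp
  · have h1 := abs_le.1 (abs_thin_succ_sub_le hg hq0 hq1 x' y)
    have h2 := abs_le.1 (abs_thin_succ_sub_le hg hq0 hq1 (x' + 1) y)
    have h3 : x' + 2 - 1 = x' + 1 := by omega
    rw [h3]
    push_cast
    rw [abs_le]
    constructor <;> linarith

section

variable {s r j : ℕ} {G : SimpleGraph (Fin n)} {A : Finset (Fin n)}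

theorem aliveCount_addEdge {e : Sym2 (Fin n)} (he : e ∈ addable d G) (hA : ∀ v ∈ A, j ≤ deg G v) :
    aliveCount A j (addEdge G e) + (A.filter fun v => deg G v = j ∧ v ∈ e).card
      = aliveCount A j G := by
  unfold aliveCount
  rw [← Finset.card_union_of_disjoint]
  · congr 1
    ext v
    simp only [Finset.mem_union, Finset.mem_filter, deg_addEdge he]
    by_cases hv : v ∈ e
    · simp only [hv, if_true]
      constructor
      · rintro (⟨h1, h2⟩ | ⟨h1, h2, -⟩)
        · have := hA v h1; omega
        · exact ⟨h1, h2⟩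
      · rintro ⟨h1, h2⟩
        exact Or.inr ⟨h1, h2, trivial⟩
    · simp [hv]
  · rw [Finset.disjoint_left]
    intro v h1 h2
    simp only [Finset.mem_filter, deg_addEdge he] at h1 h2
    have := h2.2.2
    simp only [this, if_true] at h1
    omega

theorem card_filter_alive_mem_le {e : Sym2 (Fin n)} (he : e ∈ addable d G) :
    (A.filter fun v => deg G v = j ∧ v ∈ e).card ≤ 2 := by
  rw [← card_filter_mem_of_addable he]
  apply Finset.card_le_card
  intro v hv
  simp only [Finset.mem_filter, Finset.mem_univ, true_and] at hv ⊢
  exact hv.2.2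

theorem favg_hits (A : Finset (Fin n)) (j : ℕ) :
    favg (addable d G) (fun e => ((A.filter fun v => deg G v = j ∧ v ∈ e).card : ℝ))
      = ∑ v ∈ A, alive j G v * hit d G v := by
  have h1 : ∀ e : Sym2 (Fin n), ((A.filter fun v => deg G v = j ∧ v ∈ e).card : ℝ)
      = ∑ v ∈ A, alive j G v * (if v ∈ e then 1 else 0) := by
    intro e
    rw [Finset.card_filter]
    push_cast
    apply Finset.sum_congr rfl
    intro v _
    unfold alive
    by_cases h1 : deg G v = j <;> by_cases h2 : v ∈ e <;> simp [h1, h2]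
  simp_rw [h1]
  rw [favg_sum]
  simp_rw [favg_const_mul, favg_mem]

/-- `κ(κ - 1)` counts ordered pairs of distinct survivors covered together, each having chance at
most the squared rate. -/
theorem favg_hits_mul_le (hd : 1 ≤ d) (hU : 2 * d ≤ (unsat d G).card) :
    favg (addable d G) (fun e => ((A.filter fun v => deg G v = j ∧ v ∈ e).card : ℝ)
        * ((A.filter fun v => deg G v = j ∧ v ∈ e).card - 1))
      ≤ (aliveCount A j G : ℝ) ^ 2 * rate d G ^ 2 := by
  set S := A.filter fun v => deg G v = j with hS
  have h1 : ∀ e : Sym2 (Fin n), ((A.filter fun v => deg G v = j ∧ v ∈ e).card : ℝ)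
        * ((A.filter fun v => deg G v = j ∧ v ∈ e).card - 1)
      = ∑ v ∈ S, ∑ w ∈ S.erase v, (if v ∈ e then (1 : ℝ) else 0) * (if w ∈ e then 1 else 0) := by
    intro e
    have h2 : ((A.filter fun v => deg G v = j ∧ v ∈ e).card : ℝ)
        = ∑ v ∈ S, if v ∈ e then (1 : ℝ) else 0 := by
      rw [Finset.sum_boole, hS, Finset.filter_filter]
    rw [h2, Finset.sum_mul]
    apply Finset.sum_congr rfl
    intro v hv
    rw [← Finset.mul_sum, ← Finset.add_sum_erase S _ hv]
    by_cases hve : v ∈ e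
    · rw [if_pos hve]; ring
    · rw [if_neg hve]; ring
  simp_rw [h1]
  rw [favg_sum]
  have h0 : 0 ≤ rate d G ^ 2 := by positivity
  calc _ ≤ ∑ v ∈ S, ∑ w ∈ S.erase v, rate d G ^ 2 := by
        apply Finset.sum_le_sum
        intro v _
        rw [favg_sum]
        apply Finset.sum_le_sum
        intro w hw
        exact favg_mem_mem_le hd hU (Finset.ne_of_mem_erase hw).symm
    _ ≤ ∑ v ∈ S, ∑ w ∈ S, rate d G ^ 2 := by
        apply Finset.sum_le_sum
        intro v _
        exact Finset.sum_le_sum_of_subset_of_nonneg (Finset.erase_subset _ _) fun _ _ _ => h0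
    _ = _ := by
        simp only [Finset.sum_const, nsmul_eq_mul]
        rw [aliveCount, ← hS]
        ring

/-- `pairPot` leaves out the diagonal `w = v`, which is responsible for the extra `aliveCount`. -/
theorem aliveCount_mul_lowCount_le {β : ℝ} (hβ : 1 ≤ β) :
    (aliveCount A j G : ℝ) * lowCount d G ≤ pairPot d j β A G + aliveCount A j G := by
  rw [aliveCount_eq, pairPot, Finset.sum_mul, ← Finset.sum_add_distrib]
  apply Finset.sum_le_sum
  intro v _
  rw [← Finset.mul_sum]
  have h1 : (lowCount d G : ℝ) ≤ ∑ w ∈ Finset.univ.erase v, geoWeight (d - 2) β (deg G w) + 1 := by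
    rw [lowCount, Finset.card_filter]
    push_cast
    rw [← Finset.add_sum_erase _ _ (Finset.mem_univ v), add_comm]
    apply add_le_add
    · apply Finset.sum_le_sum
      intro w _
      split_ifs with hw
      · rw [geoWeight, if_pos (by omega)]
        exact one_le_pow₀ hβ
      · exact geoWeight_nonneg hβ
    · split_ifs <;> norm_num
  have := mul_le_mul_of_nonneg_left h1 (alive_nonneg j G v)
  linarith

theorem aliveCount_le_lowCount (hj : j + 2 ≤ d) : aliveCount A j G ≤ lowCount d G := by
  apply Finset.card_le_card
  intro v hv
  simp only [Finset.mem_filter, Finset.mem_univ, true_and] at hv ⊢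
  omega

/-- One step of the process acts on binomial functionals of the number of alive vertices as a
thinning by `1 - 1 / r`. -/
theorem abs_graphStep_thin_sub_le {g : ℕ → ℝ} {q β : ℝ} (hg : ∀ y, |g y| ≤ 1) (hq0 : 0 ≤ q)
    (hq1 : q ≤ 1) (hβ : 1 ≤ β) (hj : j + 2 ≤ d) (h : Valid d s G)
    (hr : s + r = d * n / 2) (hrd : d * d ≤ r) (hA : ∀ v ∈ A, j ≤ deg G v) :
    |graphStep d (fun G => thin g q (aliveCount A j G) 0) G
        - thin g (q * (1 - 1 / r)) (aliveCount A j G) 0|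
      ≤ 20 * d ^ 3 * q / r ^ 2 * (pairPot d j β A G + aliveCount A j G) := by
  have hd : 1 ≤ d := by omega
  have hU := h.two_mul_le_card_unsat hd hr hrd
  have hE := addable_pos hd hU
  have hd1 : (1 : ℝ) ≤ d := by exact_mod_cast hd
  have hdd : 1 ≤ d * d := Nat.one_le_iff_ne_zero.2 (by positivity)
  have hr1 : (1 : ℝ) ≤ r := by exact_mod_cast hdd.trans hrd
  have hrpos : (0 : ℝ) < r := by linarith
  rw [graphStep, avgStep_eq hE]
  simp only [id]
  set x := aliveCount A j G with hx
  set δ := thin g q (x - 1) 0 - thin g q x 0 with hδ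
  set κ : Sym2 (Fin n) → ℕ := fun e => (A.filter fun v => deg G v = j ∧ v ∈ e).card with hκ
  have hx0 : (0 : ℝ) ≤ x := by positivity
  have hZ0 : (0 : ℝ) ≤ lowCount d G := by positivity
  have hrate := h.rate_le hr (by omega)
  have hrate0 := rate_nonneg (d := d) (G := G)
  -- Expansion in the number of hits
  have hexp : |favg (addable d G) (fun e => thin g q (aliveCount A j (addEdge G e)) 0)
      - (thin g q x 0 + favg (addable d G) (fun e => (κ e : ℝ)) * δ)|
      ≤ 2 * q * (x ^ 2 * (d / r) ^ 2) := by
    have e1 : favg (addable d G) (fun e => thin g q (aliveCount A j (addEdge G e)) 0)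
        - (thin g q x 0 + favg (addable d G) (fun e => (κ e : ℝ)) * δ)
        = favg (addable d G) (fun e => thin g q (aliveCount A j (addEdge G e)) 0
          - thin g q x 0 - κ e * δ) := by
      rw [favg_sub, favg_sub, favg_const hE]
      have : favg (addable d G) (fun e => (κ e : ℝ) * δ)
          = favg (addable d G) (fun e => (κ e : ℝ)) * δ := by
        rw [mul_comm, ← favg_const_mul]
        congr 1; funext e; ring
      rw [this]; ring
    have e2 : ∀ e ∈ addable d G, |thin g q (aliveCount A j (addEdge G e)) 0
          - thin g q x 0 - κ e * δ| ≤ 2 * q * (κ e * (κ e - 1)) := fun e he =>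
      abs_thin_sub_sub_le hg hq0 hq1 (aliveCount_addEdge he hA) (card_filter_alive_mem_le he) 0
    have e3 : favg (addable d G) (fun e => 2 * q * ((κ e : ℝ) * (κ e - 1)))
        ≤ 2 * q * (x ^ 2 * (d / r) ^ 2) := by
      rw [favg_const_mul]
      have h1 := favg_hits_mul_le (A := A) (j := j) hd hU
      have h2 : (x : ℝ) ^ 2 * rate d G ^ 2 ≤ x ^ 2 * (d / r) ^ 2 := by gcongr
      exact mul_le_mul_of_nonneg_left (h1.trans h2) (by linarith)
    rw [e1, abs_le]
    constructor
    · have h1 : favg (addable d G) (fun e => (-1) * (2 * q * ((κ e : ℝ) * (κ e - 1))))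
          ≤ favg (addable d G) (fun e => thin g q (aliveCount A j (addEdge G e)) 0
          - thin g q x 0 - κ e * δ) := favg_mono fun e he => by
        have := (abs_le.1 (e2 e he)).1
        linarith
      rw [favg_const_mul] at h1
      linarith
    · exact (favg_mono fun e he => (abs_le.1 (e2 e he)).2).trans e3
  -- The mean number of hits
  have hmean : |favg (addable d G) (fun e => (κ e : ℝ)) - x / r|
      ≤ x * (2 * d ^ 3 * (1 + lowCount d G) / r ^ 2) := by
    rw [hκ, favg_hits, hx, aliveCount_eq, Finset.sum_div, ← Finset.sum_sub_distrib, Finset.sum_mul]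
    refine (Finset.abs_sum_le_sum_abs _ _).trans (Finset.sum_le_sum fun v _ => ?_)
    rw [show alive j G v * hit d G v - alive j G v / r = alive j G v * (hit d G v - 1 / r) by ring,
      abs_mul, abs_of_nonneg (alive_nonneg j G v)]
    by_cases hv : deg G v = j
    · exact mul_le_mul_of_nonneg_left (h.abs_hit_sub_le hd hr hrd (by omega)) (alive_nonneg j G v)
    · simp [alive, hv]
  have hδb : |δ| ≤ 2 * q := by
    rcases Nat.eq_zero_or_pos x with h0 | h0
    · rw [hδ, h0]; simp; exact hq0
    · have := abs_thin_succ_sub_le hg hq0 hq1 (x - 1) 0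
      rw [Nat.sub_add_cancel h0, abs_sub_comm] at this
      exact this
  -- Taylor expansion in the parameter
  have hq0' : 0 ≤ q * (1 - 1 / (r : ℝ)) := by
    apply mul_nonneg hq0
    rw [sub_nonneg, div_le_one hrpos]; exact hr1
  have hq1' : q * (1 - 1 / (r : ℝ)) ≤ 1 := by
    have : 0 ≤ q * (1 / (r : ℝ)) := by positivity
    linarith
  have htay := abs_thin_taylor_le hg hq0 hq1 hq0' hq1' x 0
  have hdiff : q * (1 - 1 / (r : ℝ)) - q = - (q / r) := by ring
  -- The first-order effect of lowering `q` to `q(1 - 1/r)` equals the mean number `x / r` of hits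
  -- times the effect `δ` of losing one survivor.
  have hder : -(q / r) * thinDeriv g q x 0 = x / r * δ := by
    have := thinDeriv_mul (g := g) (q := q) x 0
    rw [hδ]
    field_simp
    linear_combination -this
  rw [hdiff, hder] at htay
  have hfin : favg (addable d G) (fun e => thin g q (aliveCount A j (addEdge G e)) 0)
        - thin g (q * (1 - 1 / r)) x 0
      = (favg (addable d G) (fun e => thin g q (aliveCount A j (addEdge G e)) 0)
      - (thin g q x 0 + favg (addable d G) (fun e => (κ e : ℝ)) * δ))
      + (favg (addable d G) (fun e => (κ e : ℝ)) - x / r) * δ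
      - (thin g (q * (1 - 1 / r)) x 0 - thin g q x 0 - x / r * δ) := by ring
  have hmul : |(favg (addable d G) (fun e => (κ e : ℝ)) - x / r) * δ|
      ≤ x * (2 * d ^ 3 * (1 + lowCount d G) / r ^ 2) * (2 * q) := by
    rw [abs_mul]
    gcongr
  rw [hfin]
  refine (abs_sub _ _).trans (le_trans (add_le_add ((abs_add_le _ _).trans
    (add_le_add hexp hmul)) htay) ?_)
  · have hxZ : (x : ℝ) ≤ lowCount d G := by exact_mod_cast aliveCount_le_lowCount hj
    have hpair := aliveCount_mul_lowCount_le (A := A) (j := j) (G := G) (d := d) hβ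
    rw [← hx] at hpair
    have hd2 : (d : ℝ) ^ 2 ≤ d ^ 3 := pow_le_pow_right₀ hd1 (by norm_num)
    have hd3 : (1 : ℝ) ≤ d ^ 3 := one_le_pow₀ hd1
    have hq2 : q ^ 2 ≤ q := by nlinarith
    have hxx : (x : ℝ) ^ 2 ≤ x * lowCount d G := by nlinarith
    set Z : ℝ := (lowCount d G : ℝ)
    set P := pairPot d j β A G
    have t1 : 2 * q * (x ^ 2 * (d / r) ^ 2) ≤ 2 * d ^ 3 * q / r ^ 2 * (P + x) := by
      calc 2 * q * (x ^ 2 * (d / r) ^ 2) = 2 * d ^ 2 * q / r ^ 2 * x ^ 2 := by field_simp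
        _ ≤ 2 * d ^ 3 * q / r ^ 2 * (P + x) := by gcongr; linarith
    have t2 : x * (2 * d ^ 3 * (1 + Z) / r ^ 2) * (2 * q)
        ≤ 4 * d ^ 3 * q / r ^ 2 * (2 * (P + x)) := by
      calc x * (2 * d ^ 3 * (1 + Z) / r ^ 2) * (2 * q)
          = 4 * d ^ 3 * q / r ^ 2 * (x * Z + x) := by ring
        _ ≤ _ := by
          gcongr
          have : 0 ≤ P := by
            apply Finset.sum_nonneg; intro v _
            apply Finset.sum_nonneg; intro w _
            exact mul_nonneg (alive_nonneg _ _ _) (geoWeight_nonneg hβ)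
          linarith
    have t3 : 4 * (x * -(q / r)) ^ 2 ≤ 4 * d ^ 3 * q / r ^ 2 * (P + x) := by
      calc 4 * (x * -(q / r)) ^ 2 = 4 * 1 * q ^ 2 / r ^ 2 * x ^ 2 := by ring
        _ ≤ 4 * d ^ 3 * q / r ^ 2 * (P + x) := by gcongr; linarith
    calc _ ≤ _ := add_le_add (add_le_add t1 t2) t3
      _ = 14 * (d ^ 3 * q / r ^ 2 * (P + x)) := by ring
      _ ≤ 20 * (d ^ 3 * q / r ^ 2 * (P + x)) := by
          have : 0 ≤ d ^ 3 * q / r ^ 2 * (P + x) := by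
            have : 0 ≤ P + x := by
              have : 0 ≤ (x : ℝ) * Z := by positivity
              linarith
            positivity
          linarith
      _ = _ := by ring

end

end

/-! ### Late phase: summing the one-step errors. -/

section

open Classical

variable {n d : ℕ}

theorem abs_iterate_sub_le {σ : Type*} {gr : σ → SimpleGraph (Fin n)}
    {upd : σ → Sym2 (Fin n) → σ} {Inv : ℕ → σ → Prop} {s : ℕ} (hI : Invariant d gr upd Inv s) {x : σ}
    (hx : Inv 0 x) (F E : ℕ → σ → ℝ)
    (h : ∀ k < s, ∀ y, Inv k y → |avgStep d gr upd (F (k + 1)) y - F k y| ≤ E k y) :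
    |(avgStep d gr upd)^[s] (F s) x - F 0 x|
      ≤ ∑ k ∈ Finset.range s, (avgStep d gr upd)^[k] (E k) x := by
  have h1 := iterate_le_add_sum hI hx F E fun k hk y hy => by
    have := (abs_le.1 (h k hk y hy)).2
    linarith
  have h2 := iterate_le_add_sum hI hx (fun k y => -1 * F k y) E fun k hk y hy => by
    have := (abs_le.1 (h k hk y hy)).1
    rw [avgStep_const_mul]
    linarith
  rw [iterate_const_mul] at h2
  rw [abs_le]
  constructor <;> linarith

section

variable {s T t₀ t j : ℕ} {G₀ : SimpleGraph (Fin n)} {A : Finset (Fin n)} {β : ℝ}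

theorem pairPot_nonneg (hβ : 1 ≤ β) (G : SimpleGraph (Fin n)) : 0 ≤ pairPot d j β A G :=
  Finset.sum_nonneg fun _ _ => Finset.sum_nonneg fun _ _ =>
    mul_nonneg (alive_nonneg _ _ _) (geoWeight_nonneg hβ)

theorem pairPot_le (hβ : 1 ≤ β) (G : SimpleGraph (Fin n)) :
    pairPot d j β A G ≤ aliveCount A j G * ∑ w, geoWeight (d - 2) β (deg G w) := by
  rw [pairPot, aliveCount_eq, Finset.sum_mul]
  apply Finset.sum_le_sum
  intro v _
  rw [← Finset.mul_sum]
  apply mul_le_mul_of_nonneg_left _ (alive_nonneg j G v)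
  exact Finset.sum_le_sum_of_subset_of_nonneg (Finset.erase_subset _ _) fun _ _ _ =>
    geoWeight_nonneg hβ

theorem aliveCount_eq_card (hA : ∀ v ∈ A, deg G₀ v = j) : aliveCount A j G₀ = A.card := by
  rw [aliveCount, Finset.filter_true_of_mem hA]

/-- The constant in the error terms for the last steps of the process. -/
noncomputable def lateConst (d : ℕ) : ℝ :=
  160 * d ^ 3 * Real.exp ((2 * (d ^ 3 + 1) + d ^ 2) + 1)

/-- In the last steps, the number of vertices of `A` that keep their degree is close to binomial. -/
theorem abs_iterate_aliveCount_sub_thin_le (hj : j + 2 ≤ d) (hG₀ : Valid d s G₀)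
    (hst : s + t₀ = d * n / 2) (hT : T + t = t₀) (ht : d * d ≤ t) (hβ : 1 ≤ β)
    (hβt : 1 / β * Real.log t₀ ≤ 1) (hA : ∀ v ∈ A, deg G₀ v = j) {g : ℕ → ℝ}
    (hg : ∀ y, |g y| ≤ 1) :
    |(graphStep d)^[T] (fun G => g (aliveCount A j G)) G₀ - thin g (t / t₀) A.card 0|
      ≤ lateConst d * ((t * A.card / t₀) *
        ((∑ w, geoWeight (d - 2) β (deg G₀ w)) * Real.log t₀ / t₀ + 1 / t)) := by
  have hd : 1 ≤ d := by omega
  have hdd : 1 ≤ d * d := Nat.one_le_iff_ne_zero.2 (by positivity)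
  have hd1 : (1 : ℝ) ≤ d := by exact_mod_cast hd
  have ht1' : 1 ≤ t := hdd.trans ht
  have ht1 : (1 : ℝ) ≤ t := by exact_mod_cast ht1'
  have hT' : (T : ℝ) + t = t₀ := by exact_mod_cast hT
  have hT0 : (0 : ℝ) ≤ T := by positivity
  have ht₀ : (1 : ℝ) ≤ t₀ := by linarith
  have hI := lateInvariant (n := n) (G₀ := G₀) hd hst hT ht
  have h0 := lateValid_zero hG₀
  have hAk : ∀ k G, LateValid d s G₀ k G → ∀ v ∈ A, j ≤ deg G v := by
    intro k G hG v hv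
    have := hG.mono v
    rw [hA v hv] at this
    exact this
  have hcast : ∀ k ≤ T, ((t₀ - k : ℕ) : ℝ) = (t₀ : ℝ) - k := by
    intro k hk
    rw [Nat.cast_sub (by omega)]
  have hβ0 : 0 < β := by linarith
  set C : ℝ := 2 * (d ^ 3 + 1) + d ^ 2 with hC
  set E := Real.exp (C + 1) with hE
  have hP : ∀ k ≤ T, (graphStep d)^[k] (pairPot d j β A) G₀
      ≤ pairPot d j β A G₀ * (E * (2 * ((t₀ : ℝ) - k) / t₀) ^ 2) := by
    intro k hk
    refine iterate_le_of_decay (a := 2) (η := 1 / β) (C := C) hI h0 hT ht1'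
      (pairPot_nonneg hβ) (by positivity) (by positivity) hβt ?_ hk
    intro l hl G hG
    have := graphStep_pairPot_le (r := t₀ - l) (A := A) (j := j) (by omega) (by omega) hG.valid
      (by omega) (by omega) hβ (hAk l G hG)
    rwa [hcast l hl.le] at this
  have hS : ∀ k ≤ T, (graphStep d)^[k] (fun G => (aliveCount A j G : ℝ)) G₀
      ≤ aliveCount A j G₀ * (E * (2 * ((t₀ : ℝ) - k) / t₀) ^ 1) := by
    intro k hk
    refine iterate_le_of_decay (a := 1) (η := 0) (C := C) (F := fun G => (aliveCount A j G : ℝ))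
      hI h0 hT ht1' (fun G => by positivity) le_rfl (by positivity) (by simp) ?_ hk
    intro l hl G hG
    have := graphStep_aliveCount_le (r := t₀ - l) (A := A) (j := j) (by omega) (by omega) hG.valid
      (by omega) (by omega) (hAk l G hG)
    rw [hcast l hl.le] at this
    refine this.trans ?_
    have h2 : ((d : ℝ) ^ 3 + 1) ≤ C := by
      have : (0 : ℝ) ≤ d ^ 3 := by positivity
      have : (0 : ℝ) ≤ d ^ 2 := by positivity
      rw [hC]; linarith
    gcongr
  -- The parameters `t / r`, with `r = t₀ - k`, satisfy `(t / (r - 1))(1 - 1/r) = t / r`. They run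
  -- from `t / t₀` to 1, where `thin g 1` returns `g`.
  have hmain := abs_iterate_sub_le hI h0
    (fun k G => thin g (t / ((t₀ : ℝ) - k)) (aliveCount A j G) 0)
    (fun k G => 40 * d ^ 3 * (t / ((t₀ : ℝ) - k) ^ 3) * (pairPot d j β A G + aliveCount A j G)) (by
      intro k hk G hG
      have hk1 : (k : ℝ) + 1 ≤ T := by exact_mod_cast hk
      have hr2 : (2 : ℝ) ≤ (t₀ : ℝ) - k := by linarith
      have hq1 : (t : ℝ) / ((t₀ : ℝ) - (k + 1 : ℕ)) ≤ 1 := by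
        push_cast
        rw [div_le_one (by linarith)]; linarith
      have hq0 : 0 ≤ (t : ℝ) / ((t₀ : ℝ) - (k + 1 : ℕ)) := by
        push_cast
        apply div_nonneg <;> linarith
      have h1 := abs_graphStep_thin_sub_le (r := t₀ - k) (A := A) hg hq0 hq1 hβ hj hG.valid
        (by omega) (by omega) (hAk k G hG)
      rw [hcast k hk.le] at h1
      have hP0 := pairPot_nonneg (d := d) (j := j) (A := A) hβ G
      push_cast at h1 ⊢
      set r := (t₀ : ℝ) - k with hr
      have hr' : (t₀ : ℝ) - (k + 1) = r - 1 := by rw [hr]; ring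
      rw [hr'] at h1 ⊢
      have hq : (t : ℝ) / (r - 1) * (1 - 1 / r) = t / r := by
        have : r - 1 ≠ 0 := by linarith
        field_simp
      rw [hq] at h1
      refine h1.trans ?_
      have hq2 : (t : ℝ) / (r - 1) ≤ 2 * t / r := by
        rw [div_le_div_iff₀ (by linarith) (by linarith)]
        nlinarith
      calc _ ≤ 20 * d ^ 3 * (2 * t / r) / r ^ 2 * (pairPot d j β A G + aliveCount A j G) := by
            gcongr
        _ = _ := by field_simp; ring)
  have e1 : (fun G => thin g (t / ((t₀ : ℝ) - T)) (aliveCount A j G) 0)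
      = fun G : SimpleGraph (Fin n) => g (aliveCount A j G) := by
    funext G
    have h2 : (t₀ : ℝ) - T = t := by linarith
    rw [h2, div_self (by linarith), thin_one, zero_add]
  have e2 : thin g (t / ((t₀ : ℝ) - (0 : ℕ))) (aliveCount A j G₀) 0 = thin g (t / t₀) A.card 0 := by
    rw [aliveCount_eq_card hA]; simp
  rw [e1, e2] at hmain
  refine hmain.trans ?_
  have hPA := pairPot_le (d := d) (j := j) (A := A) hβ G₀
  rw [aliveCount_eq_card hA] at hPA
  rw [aliveCount_eq_card hA] at hS
  set W := ∑ w, geoWeight (d - 2) β (deg G₀ w) with hW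
  have hW0 : 0 ≤ W := Finset.sum_nonneg fun w _ => geoWeight_nonneg hβ
  set a : ℝ := (A.card : ℝ) with ha
  have ha0 : 0 ≤ a := by positivity
  -- The mean of `pairPot` decays like `r²` and that of `aliveCount` like `r`; against the factor `t
  -- / r³` this leaves `1/r` and `1/r²`.
  have hb : ∀ k ∈ Finset.range T, (graphStep d)^[k] (fun G => 40 * d ^ 3 * (t / ((t₀ : ℝ) - k) ^ 3)
      * (pairPot d j β A G + aliveCount A j G)) G₀
      ≤ 40 * d ^ 3 * E * (4 * (t * a / t₀) * (W / t₀)) * (1 / ((t₀ : ℝ) - k))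
        + 40 * d ^ 3 * E * (2 * (t * a / t₀)) * (1 / ((t₀ : ℝ) - k) ^ 2) := by
    intro k hk
    have hk' := Finset.mem_range.1 hk
    have hk1 : (k : ℝ) + 1 ≤ T := by exact_mod_cast hk'
    have h1 := hP k hk'.le
    have h2 := hS k hk'.le
    have h3 := congrFun (iterate_add (d := d) (gr := id) (upd := addEdge) (F := pairPot d j β A)
      (H := fun G : SimpleGraph (Fin n) => (aliveCount A j G : ℝ)) k) G₀
    rw [graphStep, iterate_const_mul]
    have h4 : (avgStep d id addEdge)^[k] (fun G => pairPot d j β A G + aliveCount A j G) G₀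
        ≤ a * W * (E * (2 * ((t₀ : ℝ) - k) / t₀) ^ 2) + a * (E * (2 * ((t₀ : ℝ) - k) / t₀) ^ 1) := by
      refine h3.le.trans ?_
      rw [Pi.add_apply]
      refine add_le_add (h1.trans ?_) h2
      exact mul_le_mul_of_nonneg_right hPA (by positivity)
    have hr2 : (1 : ℝ) ≤ (t₀ : ℝ) - k := by linarith
    set r := (t₀ : ℝ) - k
    calc _ ≤ 40 * d ^ 3 * (t / r ^ 3) * (a * W * (E * (2 * r / t₀) ^ 2)
          + a * (E * (2 * r / t₀) ^ 1)) := by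
          exact mul_le_mul_of_nonneg_left h4 (by positivity)
      _ = _ := by field_simp; ring
  refine (Finset.sum_le_sum hb).trans ?_
  rw [Finset.sum_add_distrib, ← Finset.mul_sum, ← Finset.mul_sum]
  have hs1 := sum_inv_le hT ht1'
  have hs2 := sum_inv_sq_le hT ht1'
  have hlogt : 0 ≤ Real.log t := Real.log_natCast_nonneg t
  have hs1' : ∑ k ∈ Finset.range T, 1 / ((t₀ : ℝ) - k) ≤ Real.log t₀ := by linarith
  have hE0 : 0 < E := Real.exp_pos _
  have f1 := mul_le_mul_of_nonneg_left hs1' (by positivity :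
    0 ≤ 40 * d ^ 3 * E * (4 * (t * a / t₀) * (W / t₀)))
  have f2 := mul_le_mul_of_nonneg_left hs2 (by positivity :
    0 ≤ 40 * d ^ 3 * E * (2 * (t * a / t₀)))
  refine (add_le_add f1 f2).trans ?_
  have f3 : lateConst d = 160 * d ^ 3 * E := rfl
  rw [f3]
  have f4 : 0 ≤ 40 * d ^ 3 * E * (2 * (t * a / t₀)) * (1 / t) := by positivity
  have f5 : 160 * d ^ 3 * E * (t * a / t₀ * (W * Real.log t₀ / t₀ + 1 / t))
      = 40 * d ^ 3 * E * (4 * (t * a / t₀) * (W / t₀)) * Real.log t₀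
        + 2 * (40 * d ^ 3 * E * (2 * (t * a / t₀)) * (1 / t)) := by ring
  rw [f5]
  linarith

/-- The expected weight of the vertices of `B` still of degree at most `j` at the end. -/
theorem iterate_sum_geoWeight_le (hj : j < d) (hG₀ : Valid d s G₀)
    (hst : s + t₀ = d * n / 2) (hT : T + t = t₀) (ht : d * d ≤ t) (hβ : 1 ≤ β)
    (hβt : 1 / β * Real.log t₀ ≤ 1) (B : Finset (Fin n)) :
    (graphStep d)^[T] (fun G => ∑ v ∈ B, geoWeight j β (deg G v)) G₀
      ≤ lateConst d * ((∑ v ∈ B, geoWeight j β (deg G₀ v)) * (t / t₀)) := by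
  have hd : 1 ≤ d := by omega
  have hdd : 1 ≤ d * d := Nat.one_le_iff_ne_zero.2 (by positivity)
  have ht1' : 1 ≤ t := hdd.trans ht
  have hT' : (T : ℝ) + t = t₀ := by exact_mod_cast hT
  have hI := lateInvariant (n := n) (G₀ := G₀) hd hst hT ht
  have h0 := lateValid_zero hG₀
  have hcast : ∀ k ≤ T, ((t₀ - k : ℕ) : ℝ) = (t₀ : ℝ) - k := by
    intro k hk
    rw [Nat.cast_sub (by omega)]
  have hβ0 : 0 < β := by linarith
  have hV : ∀ G : SimpleGraph (Fin n), 0 ≤ ∑ v ∈ B, geoWeight j β (deg G v) := fun G =>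
    Finset.sum_nonneg fun v _ => geoWeight_nonneg hβ
  have h := iterate_le_of_decay (a := 1) (η := 1 / β) (C := d ^ 3 + 1) hI h0 hT ht1'
      hV (by positivity) (by positivity) hβt (by
      intro l hl G hG
      have := graphStep_geoWeight_le (r := t₀ - l) hd hj hG.valid
        (by omega) (by omega) hβ B
      rwa [hcast l hl.le] at this) le_rfl
  refine h.trans ?_
  have h2 : (t₀ : ℝ) - T = t := by linarith
  rw [h2, pow_one]
  have hd1 : (1 : ℝ) ≤ d ^ 3 := one_le_pow₀ (by exact_mod_cast hd)
  have h3 : 2 * Real.exp (d ^ 3 + 1 + 1) ≤ lateConst d := by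
    unfold lateConst
    have : Real.exp ((d : ℝ) ^ 3 + 1 + 1) ≤ Real.exp ((2 * (d ^ 3 + 1) + d ^ 2) + 1) := by
      apply Real.exp_le_exp.2
      have : (0 : ℝ) ≤ d ^ 2 := by positivity
      linarith
    have hpos := Real.exp_pos ((2 * ((d : ℝ) ^ 3 + 1) + d ^ 2) + 1)
    calc _ ≤ 2 * Real.exp ((2 * ((d : ℝ) ^ 3 + 1) + d ^ 2) + 1) := by gcongr
      _ ≤ _ := by
        apply mul_le_mul_of_nonneg_right _ hpos.le
        linarith
  have h4 : 0 ≤ (∑ v ∈ B, geoWeight j β (deg G₀ v)) * (t / t₀) :=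
    mul_nonneg (hV G₀) (by positivity)
  calc _ = 2 * Real.exp (d ^ 3 + 1 + 1) * ((∑ v ∈ B, geoWeight j β (deg G₀ v)) * (t / t₀)) := by
        ring
    _ ≤ _ := mul_le_mul_of_nonneg_right h3 h4

end

end

/-! ### Late phase: Poisson approximation from a concentrated starting graph. -/

section

open Classical

variable {n d : ℕ}

theorem sum_geoWeight_filter (m k : ℕ) (hk : k ≤ m + 1) (β : ℝ) (G : SimpleGraph (Fin n)) :
    ∑ v ∈ Finset.univ.filter (fun v => deg G v < k), geoWeight m β (deg G v)
      = ∑ i ∈ Finset.range k, β ^ (m - i) * degreeCount i G := by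
  have h1 : ∀ i ∈ Finset.range k, β ^ (m - i) * (degreeCount i G : ℝ)
      = ∑ v, if deg G v = i then geoWeight m β i else 0 := by
    intro i hi
    have hi' := Finset.mem_range.1 hi
    rw [degreeCount_eq, ← Finset.sum_filter, Finset.sum_const, nsmul_eq_mul, mul_comm, geoWeight,
      if_pos (by omega)]
  rw [Finset.sum_congr rfl h1, Finset.sum_comm, Finset.sum_filter]
  apply Finset.sum_congr rfl
  intro v _
  rw [Finset.sum_ite_eq]
  simp

theorem sum_geoWeight (m : ℕ) (β : ℝ) (G : SimpleGraph (Fin n)) :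
    ∑ v, geoWeight m β (deg G v) = ∑ i ∈ Finset.range (m + 1), β ^ (m - i) * degreeCount i G := by
  rw [← sum_geoWeight_filter m (m + 1) le_rfl]
  symm
  apply Finset.sum_subset (Finset.subset_univ _)
  intro v _ hv
  rw [geoWeight, if_neg]
  simpa [Nat.lt_succ_iff] using hv

/-- All degree counts of `G` are within relative error `δ` of the values expected with `t₀` edges
missing. -/
def Concentrated (d : ℕ) (K δ : ℝ) (t₀ : ℕ) (G : SimpleGraph (Fin n)) : Prop :=
  ∀ i < d, |(degreeCount i G : ℝ) * K ^ (d - 1 - i) - 2 * t₀ * ((d - 1).factorial / i.factorial)|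
    ≤ δ * t₀

/-- An upper bound for scaled degree counts. -/
noncomputable def countConst (d : ℕ) : ℝ := 2 * (d - 1).factorial + 1

section

variable {s T t₀ t j : ℕ} {G₀ : SimpleGraph (Fin n)} {K δ : ℝ}

theorem Concentrated.degreeCount_le (h : Concentrated d K δ t₀ G₀) (hK : 1 ≤ K) (hδ : δ ≤ 1)
    {i : ℕ} (hi : i < d) : (degreeCount i G₀ : ℝ) ≤ countConst d * t₀ / K ^ (d - 1 - i) := by
  have hK0 : 0 < K := by linarith
  rw [le_div_iff₀ (by positivity)]
  have h1 := (abs_le.1 (h i hi)).2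
  have h2 : ((d - 1).factorial : ℝ) / i.factorial ≤ (d - 1).factorial :=
    div_le_self (by positivity) (by exact_mod_cast Nat.one_le_of_lt (Nat.factorial_pos _))
  have h3 : (0 : ℝ) ≤ t₀ := by positivity
  have h4 : δ * t₀ ≤ 1 * t₀ := by gcongr
  have h5 : 2 * t₀ * (((d - 1).factorial : ℝ) / i.factorial) ≤ 2 * t₀ * (d - 1).factorial := by
    gcongr
  unfold countConst
  linarith

/-- The weight base must be at least `log t₀` for the decay estimates, and at most `K` so that the
rarer lower degrees do not dominate; `√K` serves both purposes. -/
theorem Concentrated.sum_geoWeight_le (h : Concentrated d K δ t₀ G₀) (hd : 2 ≤ d) (hK : 1 ≤ K)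
    (hδ : δ ≤ 1) : ∑ v, geoWeight (d - 2) (√K) (deg G₀ v) ≤ d * countConst d * t₀ / K := by
  have hK0 : 0 < K := by linarith
  have hβ : 1 ≤ √K := Real.one_le_sqrt.2 hK
  have hβK : √K ≤ K := by
    rw [Real.sqrt_le_left (by linarith)]
    nlinarith
  have hc : 0 ≤ countConst d := by unfold countConst; positivity
  rw [sum_geoWeight]
  calc _ ≤ ∑ i ∈ Finset.range (d - 2 + 1), countConst d * t₀ / K := by
        apply Finset.sum_le_sum
        intro i hi
        have hi' := Finset.mem_range.1 hi
        have h1 := h.degreeCount_le hK hδ (i := i) (by omega)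
        calc (√K) ^ (d - 2 - i) * (degreeCount i G₀ : ℝ)
            ≤ K ^ (d - 2 - i) * (countConst d * t₀ / K ^ (d - 1 - i)) := by gcongr
          _ = countConst d * t₀ / K := by
              rw [show d - 1 - i = (d - 2 - i) + 1 by omega, pow_succ]
              field_simp
    _ = ((d - 2 + 1 : ℕ) : ℝ) * (countConst d * t₀ / K) := by
        rw [Finset.sum_const, Finset.card_range, nsmul_eq_mul]
    _ ≤ d * (countConst d * t₀ / K) := by
        gcongr
        omega
    _ = _ := by ring

/-- Each degree further down is rarer by a factor `K` but weighs only `√K` more, which leaves a gain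
of `√K` over the vertices of degree `j`. -/
theorem Concentrated.sum_geoWeight_lt_le (h : Concentrated d K δ t₀ G₀) (hj : j < d) (hK : 1 ≤ K)
    (hδ : δ ≤ 1) :
    ∑ v ∈ Finset.univ.filter (fun v => deg G₀ v < j), geoWeight j (√K) (deg G₀ v)
      ≤ d * countConst d * t₀ / (K ^ (d - 1 - j) * √K) := by
  have hK0 : 0 < K := by linarith
  have hβ : 1 ≤ √K := Real.one_le_sqrt.2 hK
  have hβ0 : 0 < √K := by linarith
  have hc : 0 ≤ countConst d := by unfold countConst; positivity
  rw [sum_geoWeight_filter j j (by omega)]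
  calc _ ≤ ∑ i ∈ Finset.range j, countConst d * t₀ / (K ^ (d - 1 - j) * √K) := by
        apply Finset.sum_le_sum
        intro i hi
        have hi' := Finset.mem_range.1 hi
        have h1 := h.degreeCount_le hK hδ (i := i) (by omega)
        calc (√K) ^ (j - i) * (degreeCount i G₀ : ℝ)
            ≤ (√K) ^ (j - i) * (countConst d * t₀ / K ^ (d - 1 - i)) := by gcongr
          _ = countConst d * t₀ / (K ^ (d - 1 - j) * (√K) ^ (j - i)) := by
              have e1 : K ^ (d - 1 - i) = K ^ (d - 1 - j) * ((√K) ^ (j - i) * (√K) ^ (j - i)) := by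
                rw [← mul_pow, Real.mul_self_sqrt hK0.le, ← pow_add]
                congr 1; omega
              rw [e1]
              field_simp
          _ ≤ _ := by
              gcongr
              exact le_self_pow₀ hβ (by omega)
    _ = (j : ℝ) * (countConst d * t₀ / (K ^ (d - 1 - j) * √K)) := by
        rw [Finset.sum_const, Finset.card_range, nsmul_eq_mul]
    _ ≤ d * (countConst d * t₀ / (K ^ (d - 1 - j) * √K)) := by
        gcongr
    _ = _ := by ring

/-- The error made in one unit of mean in the last steps of the process. -/
noncomputable def lateError (d : ℕ) (K : ℝ) (t₀ t : ℕ) : ℝ :=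
  lateConst d * (d * countConst d * Real.log t₀ / K + 1 / t) + 4 * (t / t₀)

theorem Concentrated.abs_alive_sub_poi_le (h : Concentrated d K δ t₀ G₀) (hj : j + 2 ≤ d)
    (hG₀ : Valid d s G₀) (hst : s + t₀ = d * n / 2) (hT : T + t = t₀) (ht : d * d ≤ t)
    (hK : 1 ≤ K) (hδ : δ ≤ 1) (hβt : 1 / √K * Real.log t₀ ≤ 1) {A : Finset (Fin n)}
    (hA : ∀ v ∈ A, deg G₀ v = j) (i : ℕ) :
    |(graphStep d)^[T] (fun G => if aliveCount A j G = i then 1 else 0) G₀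
        - poi i (t * A.card / t₀)| ≤ t * A.card / t₀ * lateError d K t₀ t := by
  have hK0 : 0 < K := by linarith
  have hd : 1 ≤ d := by omega
  have hdd : 1 ≤ d * d := Nat.one_le_iff_ne_zero.2 (by positivity)
  have ht1 : (1 : ℝ) ≤ t := by exact_mod_cast hdd.trans ht
  have htt : (t : ℝ) ≤ t₀ := by exact_mod_cast (by omega : t ≤ t₀)
  have ht₀ : (0 : ℝ) < t₀ := by linarith
  have h1 := abs_iterate_aliveCount_sub_thin_le (g := fun k => if k = i then (1 : ℝ) else 0)
    hj hG₀ hst hT ht (Real.one_le_sqrt.2 hK) hβt hA (fun y => by split_ifs <;> norm_num)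
  have hq0 : 0 ≤ (t : ℝ) / t₀ := by positivity
  have hq1 : (t : ℝ) / t₀ ≤ 1 := by rw [div_le_one ht₀]; exact htt
  have h2 := abs_thin_sub_poiShift_le i hq0 hq1 A.card 0
  rw [poiShift_zero] at h2
  have e1 : (A.card : ℝ) * (t / t₀) = t * A.card / t₀ := by ring
  rw [e1] at h2
  have h3 := abs_add_le ((graphStep d)^[T] (fun G => if aliveCount A j G = i then (1 : ℝ) else 0) G₀
      - thin (fun k => if k = i then (1 : ℝ) else 0) (t / t₀) A.card 0)
    (thin (fun k => if k = i then (1 : ℝ) else 0) (t / t₀) A.card 0 - poi i (t * A.card / t₀))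
  rw [sub_add_sub_cancel] at h3
  refine h3.trans ((add_le_add h1 h2).trans ?_)
  have h4 := h.sum_geoWeight_le (by omega) hK hδ
  have hlog : 0 ≤ Real.log t₀ := Real.log_natCast_nonneg t₀
  have hlc : 0 ≤ lateConst d := by unfold lateConst; positivity
  have h5 : (∑ w, geoWeight (d - 2) (√K) (deg G₀ w)) * Real.log t₀ / t₀
      ≤ d * countConst d * Real.log t₀ / K := by
    calc _ ≤ d * countConst d * t₀ / K * Real.log t₀ / t₀ := by gcongr
      _ = _ := by field_simp
  unfold lateError
  calc _ ≤ lateConst d * (t * A.card / t₀ * (d * countConst d * Real.log t₀ / K + 1 / t))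
        + 4 * A.card * (t / t₀) ^ 2 := by gcongr
    _ = _ := by field_simp

theorem poi_param_eq (hjd : j < d) :
    ((d - 1).descFactorial (d - 1 - j) : ℝ) = (d - 1).factorial / j.factorial := by
  have h1 : (d - 1 - (d - 1 - j)).factorial * (d - 1).descFactorial (d - 1 - j)
      = (d - 1).factorial := Nat.factorial_mul_descFactorial (by omega)
  rw [show d - 1 - (d - 1 - j) = j by omega] at h1
  rw [eq_div_iff (by positivity), ← h1]
  push_cast; ring

/-- The Poisson parameter with `K` in place of `log n`. -/
noncomputable def param (d j : ℕ) (K : ℝ) (t : ℕ) : ℝ :=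
  2 * ((d - 1).factorial / j.factorial) * t / K ^ (d - 1 - j)

theorem Concentrated.abs_mul_degreeCount_sub_le (h : Concentrated d K δ t₀ G₀) (hj : j < d)
    (hK : 1 ≤ K) (ht : 0 < t₀) (hδ0 : 0 ≤ δ) :
    |t * (degreeCount j G₀ : ℝ) / t₀ - param d j K t| ≤ δ * param d j K t := by
  have hK0 : 0 < K := by linarith
  have ht₀ : (0 : ℝ) < t₀ := by exact_mod_cast ht
  have h1 : t * (degreeCount j G₀ : ℝ) / t₀ - param d j K t
      = ((degreeCount j G₀ : ℝ) * K ^ (d - 1 - j)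
        - 2 * t₀ * ((d - 1).factorial / j.factorial)) * (t / (t₀ * K ^ (d - 1 - j))) := by
    unfold param
    field_simp
  rw [h1, abs_mul, abs_of_nonneg (by positivity : (0 : ℝ) ≤ t / (t₀ * K ^ (d - 1 - j)))]
  have h2 : (1 : ℝ) ≤ (d - 1).factorial / j.factorial := by
    rw [one_le_div (by positivity)]
    exact_mod_cast Nat.factorial_le (by omega)
  calc _ ≤ δ * t₀ * (t / (t₀ * K ^ (d - 1 - j))) := by
        have := h j hj
        gcongr
    _ = δ * (1 * t / K ^ (d - 1 - j)) := by field_simp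
    _ ≤ δ * param d j K t := by
        unfold param
        gcongr
        linarith

/-- Degrees never decrease, so a vertex of degree `j` either kept this degree since the split or
came from below; the second kind will be negligible. -/
theorem LateValid.degreeCount_eq_add {k : ℕ} {G : SimpleGraph (Fin n)} (hG : LateValid d s G₀ k G) :
    degreeCount j G = aliveCount (Finset.univ.filter fun v => deg G₀ v = j) j G
      + ((Finset.univ.filter fun v => deg G₀ v < j).filter fun v => deg G v = j).card := by
  rw [degreeCount_eq, aliveCount, ← Finset.card_union_of_disjoint]
  · congr 1
    ext v
    simp only [Finset.mem_filter, Finset.mem_univ, true_and, Finset.mem_union]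
    have := hG.mono v
    constructor
    · intro h
      rcases lt_or_eq_of_le (h ▸ this) with h1 | h1
      · exact Or.inr ⟨h1, h⟩
      · exact Or.inl ⟨h1, h⟩
    · rintro (⟨-, h⟩ | ⟨-, h⟩) <;> exact h
  · rw [Finset.disjoint_left]
    intro v h1 h2
    simp only [Finset.mem_filter, Finset.mem_univ, true_and] at h1 h2
    omega

/-- Poisson approximation in the last steps, for a bounded parameter. -/
theorem Concentrated.abs_degreeCount_sub_poi_le (h : Concentrated d K δ t₀ G₀) (hj : j + 2 ≤ d)
    (hG₀ : Valid d s G₀) (hst : s + t₀ = d * n / 2) (hT : T + t = t₀) (ht : d * d ≤ t)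
    (hK : 1 ≤ K) (hδ0 : 0 ≤ δ) (hδ : δ ≤ 1) (hβt : 1 / √K * Real.log t₀ ≤ 1) (i : ℕ) :
    |(graphStep d)^[T] (fun G => if degreeCount j G = i then 1 else 0) G₀ - poi i (param d j K t)|
      ≤ param d j K t * (2 * lateError d K t₀ t + 2 * δ
        + lateConst d * (d * countConst d) / √K) := by
  have hK0 : 0 < K := by linarith
  have hβ : 1 ≤ √K := Real.one_le_sqrt.2 hK
  have hd : 1 ≤ d := by omega
  have hdd : 1 ≤ d * d := Nat.one_le_iff_ne_zero.2 (by positivity)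
  have ht1 : (1 : ℝ) ≤ t := by exact_mod_cast hdd.trans ht
  have ht₀ : (0 : ℝ) < t₀ := by exact_mod_cast (by omega : 0 < t₀)
  set A := Finset.univ.filter fun v => deg G₀ v = j with hA
  set B := Finset.univ.filter fun v => deg G₀ v < j with hB
  set lam := param d j K t with hlam
  have hlam0 : 0 ≤ lam := by rw [hlam]; unfold param; positivity
  have hcard : A.card = degreeCount j G₀ := rfl
  have h1 := h.abs_alive_sub_poi_le (A := A) hj hG₀ hst hT ht hK hδ hβt
    (fun v hv => by simpa [hA] using hv) i
  have h2 := h.abs_mul_degreeCount_sub_le (t := t) (j := j) (by omega) hK (by omega) hδ0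
  rw [hcard] at h1
  set μ := t * (degreeCount j G₀ : ℝ) / t₀ with hμ
  have hμ0 : 0 ≤ μ := by positivity
  have hμ2 : μ ≤ 2 * lam := by
    have := (abs_le.1 h2).2
    have : δ * lam ≤ 1 * lam := by gcongr
    linarith
  have hle0 : 0 ≤ lateError d K t₀ t := by
    unfold lateError lateConst countConst
    have : 0 ≤ Real.log t₀ := Real.log_natCast_nonneg t₀
    positivity
  have h3 : |poi i μ - poi i lam| ≤ 2 * (δ * lam) :=
    (abs_poi_sub_le i hlam0 hμ0).trans (by linarith)
  have hI := lateInvariant (n := n) (G₀ := G₀) hd hst hT ht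
  have h0 := lateValid_zero hG₀
  have hpt : ∀ G, LateValid d s G₀ T G →
      |(if degreeCount j G = i then (1 : ℝ) else 0) - (if aliveCount A j G = i then 1 else 0)|
        ≤ ∑ v ∈ B, geoWeight j (√K) (deg G v) := by
    intro G hG
    have e1 : degreeCount j G = aliveCount A j G + (B.filter fun v => deg G v = j).card :=
      hG.degreeCount_eq_add
    have e2 : ((B.filter fun v => deg G v = j).card : ℝ) ≤ ∑ v ∈ B, geoWeight j (√K) (deg G v) := by
      rw [Finset.card_filter]
      push_cast
      apply Finset.sum_le_sum
      intro v _
      split_ifs with hv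
      · rw [hv, geoWeight]; simp
      · exact geoWeight_nonneg hβ
    refine le_trans ?_ e2
    rcases Nat.eq_zero_or_pos (B.filter fun v => deg G v = j).card with hz | hz
    · rw [hz, add_zero] at e1
      rw [e1, hz]; simp
    · have : (1 : ℝ) ≤ (B.filter fun v => deg G v = j).card := by exact_mod_cast hz
      refine le_trans ?_ this
      split_ifs <;> norm_num
  have hV := iterate_sum_geoWeight_le (j := j) (by omega) hG₀ hst hT ht hβ hβt B
  have hV0 := h.sum_geoWeight_lt_le (j := j) (by omega) hK hδ
  have hf1 : (1 : ℝ) ≤ (d - 1).factorial / j.factorial := by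
    rw [one_le_div (by positivity)]
    exact_mod_cast Nat.factorial_le (by omega)
  have hlc : 0 ≤ lateConst d := by unfold lateConst; positivity
  have hcc : 0 ≤ countConst d := by unfold countConst; positivity
  have hV' : (graphStep d)^[T] (fun G => ∑ v ∈ B, geoWeight j (√K) (deg G v)) G₀
      ≤ lam * (lateConst d * (d * countConst d) / √K) := by
    refine hV.trans ?_
    have hβ0 : 0 < √K := by linarith
    calc _ ≤ lateConst d * (d * countConst d * t₀ / (K ^ (d - 1 - j) * √K) * (t / t₀)) := by
          gcongr
      _ = 1 * t / K ^ (d - 1 - j) * (lateConst d * (d * countConst d) / √K) := by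
          field_simp
      _ ≤ _ := by
          rw [hlam]
          unfold param
          gcongr
          linarith
  have hnew : |(graphStep d)^[T] (fun G => if degreeCount j G = i then (1 : ℝ) else 0) G₀
      - (graphStep d)^[T] (fun G => if aliveCount A j G = i then (1 : ℝ) else 0) G₀|
      ≤ (graphStep d)^[T] (fun G => ∑ v ∈ B, geoWeight j (√K) (deg G v)) G₀ := by
    have u1 := iterate_mono hI h0 (F := fun G => if degreeCount j G = i then (1 : ℝ) else 0)
      (H := (fun G => if aliveCount A j G = i then (1 : ℝ) else 0)
        + fun G => ∑ v ∈ B, geoWeight j (√K) (deg G v)) (fun G hG => by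
        have := (abs_le.1 (hpt G hG)).2
        simp only [Pi.add_apply]; linarith)
    have u2 := iterate_mono hI h0 (F := fun G => if aliveCount A j G = i then (1 : ℝ) else 0)
      (H := (fun G => if degreeCount j G = i then (1 : ℝ) else 0)
        + fun G => ∑ v ∈ B, geoWeight j (√K) (deg G v)) (fun G hG => by
        have := (abs_le.1 (hpt G hG)).1
        simp only [Pi.add_apply]; linarith)
    rw [iterate_add, Pi.add_apply] at u1 u2
    unfold graphStep
    rw [abs_le]
    constructor <;> linarith
  have h4 : μ * lateError d K t₀ t ≤ 2 * lam * lateError d K t₀ t := by gcongr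
  have habs := abs_le.1 (hnew.trans hV')
  have habs1 := abs_le.1 (h1.trans h4)
  have habs3 := abs_le.1 h3
  rw [abs_le]
  constructor <;> linarith

/-- An upper bound for the point probabilities in the last steps, for a large parameter. -/
theorem Concentrated.degreeCount_le_sum_poi (h : Concentrated d K δ t₀ G₀) (hj : j + 2 ≤ d)
    (hG₀ : Valid d s G₀) (hst : s + t₀ = d * n / 2) (hT : T + t = t₀) (ht : d * d ≤ t)
    (hK : 1 ≤ K) (hδ0 : 0 ≤ δ) (hδ : δ ≤ 1 / 2) (hβt : 1 / √K * Real.log t₀ ≤ 1) (i : ℕ) {L : ℝ}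
    (hL : 1 ≤ L) (hlam : 2 * L ≤ param d j K t) :
    ∃ μ, L - 1 ≤ μ ∧ μ ≤ L ∧
      (graphStep d)^[T] (fun G => if degreeCount j G = i then 1 else 0) G₀
        ≤ ∑ k ∈ Finset.range (i + 1), (poi k μ + L * lateError d K t₀ t) := by
  have hd : 1 ≤ d := by omega
  have hdd : 1 ≤ d * d := Nat.one_le_iff_ne_zero.2 (by positivity)
  have ht1 : (1 : ℝ) ≤ t := by exact_mod_cast hdd.trans ht
  have htt : (t : ℝ) ≤ t₀ := by exact_mod_cast (by omega : t ≤ t₀)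
  have ht₀ : (0 : ℝ) < t₀ := by linarith
  have h2 := h.abs_mul_degreeCount_sub_le (t := t) (j := j) (by omega) hK (by omega) hδ0
  have hD : L * t₀ / t ≤ degreeCount j G₀ := by
    have h3 := (abs_le.1 h2).1
    have h4 : δ * param d j K t ≤ 1 / 2 * param d j K t := by
      have : 0 ≤ param d j K t := by linarith
      gcongr
    have h5 : L ≤ t * (degreeCount j G₀ : ℝ) / t₀ := by linarith
    rw [le_div_iff₀ ht₀] at h5
    rw [div_le_iff₀ (by linarith)]
    linarith
  have hx0 : 0 ≤ L * t₀ / t := by positivity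
  -- As `t ≤ t₀`, rounding down keeps the mean `t * a / t₀` between `L - 1` and `L`. Following only
  -- `a` vertices keeps the approximation error bounded however large the parameter is.
  set a := ⌊L * t₀ / t⌋₊ with ha
  have haD : a ≤ degreeCount j G₀ := by
    rw [ha]
    exact Nat.floor_le_of_le hD
  obtain ⟨A, hAsub, hAcard⟩ := Finset.exists_subset_card_eq
    (s := Finset.univ.filter fun v => deg G₀ v = j) haD
  have hA : ∀ v ∈ A, deg G₀ v = j := fun v hv => by simpa using hAsub hv
  have hfl := Nat.floor_le hx0
  have hfl2 := Nat.lt_floor_add_one (L * t₀ / t)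
  rw [← ha] at hfl hfl2
  have hle0 : 0 ≤ lateError d K t₀ t := by
    unfold lateError lateConst countConst
    have : 0 ≤ Real.log t₀ := Real.log_natCast_nonneg t₀
    positivity
  have hμL : t * (A.card : ℝ) / t₀ ≤ L := by
    rw [hAcard, div_le_iff₀ ht₀]
    rw [le_div_iff₀ (by linarith)] at hfl
    linarith
  refine ⟨t * A.card / t₀, ?_, hμL, ?_⟩
  · rw [hAcard, le_div_iff₀ ht₀]
    rw [div_lt_iff₀ (by linarith)] at hfl2
    nlinarith
  · have hI := lateInvariant (n := n) (G₀ := G₀) hd hst hT ht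
    have h0 := lateValid_zero hG₀
    have u1 := iterate_mono hI h0 (F := fun G => if degreeCount j G = i then (1 : ℝ) else 0)
      (H := fun G => ∑ k ∈ Finset.range (i + 1), if aliveCount A j G = k then (1 : ℝ) else 0)
      (fun G _ => by
        -- If exactly `i` vertices have degree `j`, then at most `i` of the followed ones do.
        have hle : aliveCount A j G ≤ degreeCount j G := by
          rw [degreeCount_eq, aliveCount]
          exact Finset.card_le_card (Finset.filter_subset_filter _ (Finset.subset_univ A))
        rw [Finset.sum_ite_eq]
        split_ifs with g1 g2
        · rfl
        · exact absurd (Finset.mem_range.2 (by omega)) g2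
        · norm_num
        · rfl)
    rw [iterate_sum] at u1
    refine u1.trans (Finset.sum_le_sum fun k _ => ?_)
    have h1 := h.abs_alive_sub_poi_le hj hG₀ hst hT ht hK (by linarith) hβt hA k
    have h5 : t * (A.card : ℝ) / t₀ * lateError d K t₀ t ≤ L * lateError d K t₀ t := by gcongr
    have h6 := (abs_le.1 h1).2
    unfold graphStep at h6
    linarith

end

end

/-! ### Joining the two phases. -/

section

open Classical

variable {n d : ℕ}

section

variable {s t₀ : ℕ} {K m p e c : ℝ} {H : SimpleGraph (Fin n) → ℝ}

/-- On atypical states `H` exceeds `e` by at most one, so they add at most their probability. -/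
theorem iterate_graphStep_le_of_typical (hd : 1 ≤ d) (hst : s + t₀ = d * n / 2) (ht : d * d ≤ t₀)
    (hp : (timedStep d)^[s] (fun x : TimedGraph n => if Typical d K m x then 0 else 1)
      (TimedGraph.init n) ≤ p)
    (h : ∀ x : TimedGraph n, TimedValid d s x → Typical d K m x → H x.graph ≤ e)
    (h1 : ∀ G, Valid d s G → H G ≤ e + 1) : (graphStep d)^[s] H ⊥ ≤ e + p := by
  have hI := timedInvariant (n := n) hd hst ht
  have u := iterate_mono hI timedValid_init (F := fun x => H x.graph)
    (H := (fun _ => e) + fun x => if Typical d K m x then 0 else 1) (fun x hx => by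
      simp only [Pi.add_apply]
      split_ifs with hT
      · simpa using h x hx hT
      · exact h1 _ hx.valid)
  rw [iterate_add, Pi.add_apply, iterate_const,
    iterate_comp_gr (gr := TimedGraph.graph) (upd := TimedGraph.next d) (fun _ _ => rfl)] at u
  unfold timedStep at hp
  exact u.trans (by simpa using hp)

theorem abs_iterate_graphStep_sub_le_of_typical (hd : 1 ≤ d) (hst : s + t₀ = d * n / 2)
    (ht : d * d ≤ t₀)
    (hp : (timedStep d)^[s] (fun x : TimedGraph n => if Typical d K m x then 0 else 1)
      (TimedGraph.init n) ≤ p) (he : 0 ≤ e)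
    (h : ∀ x : TimedGraph n, TimedValid d s x → Typical d K m x → |H x.graph - c| ≤ e)
    (h1 : ∀ G, Valid d s G → |H G - c| ≤ 1) : |(graphStep d)^[s] H ⊥ - c| ≤ e + p := by
  have u1 := iterate_graphStep_le_of_typical (H := H) (e := c + e) hd hst ht hp
    (fun x hx hT => by linarith [(abs_le.1 (h x hx hT)).2])
    (fun G hG => by linarith [(abs_le.1 (h1 G hG)).2])
  have u2 := iterate_graphStep_le_of_typical (H := fun G => -1 * H G) (e := -c + e) hd hst ht hp
    (fun x hx hT => by linarith [(abs_le.1 (h x hx hT)).1])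
    (fun G hG => by linarith [(abs_le.1 (h1 G hG)).1])
  rw [graphStep, iterate_const_mul] at u2
  unfold graphStep at u1 ⊢
  rw [abs_le]
  constructor <;> linarith

end

theorem iterate_indicator_mem_Icc {s T t₀ t : ℕ} (hd : 1 ≤ d) (hst : s + t₀ = d * n / 2)
    (hT : T + t = t₀) (ht : d * d ≤ t) (j i : ℕ) {G : SimpleGraph (Fin n)} (hG : Valid d s G) :
    (graphStep d)^[T] (fun G => if degreeCount j G = i then 1 else 0) G ∈ Set.Icc (0 : ℝ) 1 := by
  have hI := lateInvariant (n := n) (G₀ := G) hd hst hT ht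
  have h0 := lateValid_zero hG
  have u0 := iterate_mono hI h0 (F := fun _ => 0)
    (H := fun G => if degreeCount j G = i then (1 : ℝ) else 0) (fun G _ => by positivity)
  have u1 := iterate_mono hI h0 (F := fun G => if degreeCount j G = i then (1 : ℝ) else 0)
    (H := fun _ => 1) (fun G _ => by split_ifs <;> norm_num)
  rw [iterate_const] at u0 u1
  exact ⟨u0, u1⟩

/-- The time falls short of `log n` by at most about `log t`, negligible against `log n` when `t` is
a power of `log n`. This justifies replacing `τ` by `log n`. -/
theorem TimedValid.log_sub_time_le {s t : ℕ} {x : TimedGraph n} (hx : TimedValid d s x)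
    (hd : 2 ≤ d) (hn : 1 ≤ n) (hst : s + t = d * n / 2) :
    Real.log n - x.time ≤ Real.log (2 * t + 3) := by
  have h := hx.le_time
  have e : ((d * n / 2 : ℕ) : ℝ) = s + t := by rw [← hst]; push_cast; ring
  have hN : n ≤ 2 * (d * n / 2) + 3 := by
    have : 2 * n ≤ d * n := Nat.mul_le_mul_right _ hd
    omega
  have hn0 : (0 : ℝ) < n := by exact_mod_cast hn
  have h1 : Real.log n ≤ Real.log (2 * (d * n / 2 : ℕ) + 3) :=
    Real.log_le_log hn0 (by exact_mod_cast hN)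
  rw [e, add_sub_cancel_left] at h
  rw [e] at h1
  linarith

/-- The relative error of the degree counts of a typical graph, in terms of a bound `l` for the
logarithm of the number of missing edges. -/
noncomputable def relError (d : ℕ) (K l : ℝ) : ℝ :=
  31 * d ^ 3 * (d - 1).factorial ^ 2 * ((1 + l) / K)

theorem Typical.concentrated {s t : ℕ} {m l : ℝ} {x : TimedGraph n} (h : Typical d (Real.log n) m x)
    (hv : TimedValid d s x) (hst : s + t = d * n / 2) (ht : Real.log n ≤ t) (hd : 2 ≤ d)
    (hn : 1 ≤ n) (hK : 1 ≤ Real.log n) (hm : m ≤ Real.log n) (hl : Real.log (2 * t + 3) ≤ l)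
    (hl1 : 8 * d ^ 3 * (d - 1).factorial * ((1 + l) / Real.log n) ≤ 1) :
    Concentrated d (Real.log n) (relError d (Real.log n) l) t x.graph := by
  intro i hi
  have h1 := hv.log_sub_time_le hd hn hst
  exact h.abs_degreeCount_mul_sub_le hv hst ht (by omega) hK hm (η := (1 + l) / Real.log n)
    (by gcongr; linarith) hl1 hi

/-- A constant in the bound for the probability of atypical graphs. -/
noncomputable def atypicalConst (d : ℕ) : ℝ :=
  (2 * d + d * (4 * (432 * d * 9 ^ d) + 2 * (9 * (2 * d + 4) * d ^ 2 * 3 ^ d)))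
    * Real.exp (3 * d ^ 3)

section

variable {j t t₀ i : ℕ} {l : ℝ}

/-- The conditions on the parameters under which the process is split at `t₀` missing edges. -/
structure Admissible (d n t t₀ : ℕ) (l : ℝ) : Prop where
  two_le : 2 ≤ d
  one_le_log : 1 ≤ Real.log n
  one_le : 1 ≤ n
  le_size : t₀ ≤ d * n / 2
  le : t ≤ t₀
  sq_le : d * d ≤ t
  log_size_le : Real.log ((d * n / 2 : ℕ) : ℝ) ≤ 2 * Real.log n
  loglog_le : (3 * d + 3 : ℕ) * Real.log (Real.log n) ≤ Real.log n
  pow_le : Real.log n ^ (4 * d + 3) ≤ t₀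
  log_le : Real.log (2 * t₀ + 3) ≤ l
  div_le : 8 * d ^ 3 * (d - 1).factorial * ((1 + l) / Real.log n) ≤ 1
  relError_le : relError d (Real.log n) l ≤ 1 / 2
  div_sqrt_le : 1 / √(Real.log n) * l ≤ 1

theorem Admissible.log_start_le (h : Admissible d n t t₀ l) : Real.log t₀ ≤ l := by
  refine le_trans ?_ h.log_le
  have := h.two_le
  have ht0 : 0 < t₀ := lt_of_lt_of_le (Nat.mul_pos (by omega) (by omega)) (h.sq_le.trans h.le)
  have : (0 : ℝ) < t₀ := by exact_mod_cast ht0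
  exact Real.log_le_log this (by linarith)

theorem Admissible.le_nonneg (h : Admissible d n t t₀ l) : 0 ≤ l :=
  (Real.log_natCast_nonneg t₀).trans h.log_start_le

theorem Admissible.relError_nonneg (h : Admissible d n t t₀ l) :
    0 ≤ relError d (Real.log n) l := by
  have := h.le_nonneg
  have := h.one_le_log
  unfold relError
  positivity

/-- The cutoff time for typical graphs. -/
noncomputable def cutTime (d n : ℕ) : ℝ :=
  Real.log n - (3 * d + 3 : ℕ) * Real.log (Real.log n)

theorem Admissible.iterate_not_typical_le (h : Admissible d n t t₀ l) :
    (timedStep d)^[d * n / 2 - t₀] (fun x : TimedGraph n =>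
      if Typical d (Real.log n) (cutTime d n) x then 0 else 1) (TimedGraph.init n)
      ≤ atypicalConst d / Real.log n := by
  have hK := h.one_le_log
  have hK0 : 0 < Real.log n := by linarith
  have hl := Real.log_nonneg hK
  have hn0 : (0 : ℝ) < n := by exact_mod_cast h.one_le
  have hd := h.two_le
  have hle := h.le_size
  refine DGraphs.iterate_not_typical_le (t := t₀) (by omega) hK (sub_nonneg.2 h.loglog_le)
    (sub_le_self _ (by positivity)) h.one_le (by omega) (h.sq_le.trans h.le) h.log_size_le ?_ h.pow_le
  rw [cutTime, Real.exp_sub, Real.exp_log hn0, mul_comm ((3 * d + 3 : ℕ) : ℝ), Real.exp_mul,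
    Real.exp_log hK0, Real.rpow_natCast]
  field_simp

theorem Admissible.concentrated (h : Admissible d n t t₀ l) {x : TimedGraph n}
    (hv : TimedValid d (d * n / 2 - t₀) x) (hx : Typical d (Real.log n) (cutTime d n) x) :
    Concentrated d (Real.log n) (relError d (Real.log n) l) t₀ x.graph := by
  have hK := h.one_le_log
  have hl := Real.log_nonneg hK
  have hle := h.le_size
  refine hx.concentrated hv (by omega) ((le_self_pow₀ hK (by omega)).trans h.pow_le) h.two_le
    h.one_le hK (sub_le_self _ (by positivity)) h.log_le h.div_le

theorem Admissible.degreeCountLaw_eq (h : Admissible d n t t₀ l) :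
    (degreeCountLaw d n j (d * n / 2 - t) i).toReal = (graphStep d)^[d * n / 2 - t₀]
      ((graphStep d)^[t₀ - t] fun G : SimpleGraph (Fin n) => if degreeCount j G = i then 1 else 0)
      ⊥ := by
  have h1 := h.le_size
  have h2 := h.le
  rw [degreeCountLaw_toReal, show d * n / 2 - t = (d * n / 2 - t₀) + (t₀ - t) by omega,
    Function.iterate_add_apply]

theorem Admissible.abs_degreeCountLaw_sub_poi_le (h : Admissible d n t t₀ l) (hj : j + 2 ≤ d) :
    |(degreeCountLaw d n j (d * n / 2 - t) i).toReal - poi i (param d j (Real.log n) t)|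
      ≤ param d j (Real.log n) t * (2 * lateError d (Real.log n) t₀ t
        + 2 * relError d (Real.log n) l + lateConst d * (d * countConst d) / √(Real.log n))
        + atypicalConst d / Real.log n := by
  have hK := h.one_le_log
  have hd := h.two_le
  have h1 := h.le_size
  have h2 := h.le
  have hδ := h.relError_nonneg
  have hp0 : 0 ≤ param d j (Real.log n) t := by unfold param; positivity
  have hle0 : 0 ≤ lateError d (Real.log n) t₀ t := by
    unfold lateError lateConst countConst
    have : 0 ≤ Real.log t₀ := Real.log_natCast_nonneg t₀
    positivity
  have hlc : 0 ≤ lateConst d := by unfold lateConst; positivity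
  have hcc : 0 ≤ countConst d := by unfold countConst; positivity
  rw [h.degreeCountLaw_eq]
  refine abs_iterate_graphStep_sub_le_of_typical (by omega) (by omega) (h.sq_le.trans h.le)
    h.iterate_not_typical_le (by positivity) (fun x hv hx => ?_) (fun G hG => ?_)
  · refine (h.concentrated hv hx).abs_degreeCount_sub_poi_le hj hv.valid (by omega) (by omega)
      h.sq_le hK hδ (by linarith [h.relError_le]) (le_trans ?_ h.div_sqrt_le) i
    gcongr
    exact h.log_start_le
  · have u := iterate_indicator_mem_Icc (by omega) (show d * n / 2 - t₀ + t₀ = d * n / 2 by omega)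
      (show t₀ - t + t = t₀ by omega) h.sq_le j i hG
    have v0 := poi_nonneg i hp0
    have v1 := poi_le_one i hp0
    rw [abs_le]
    constructor <;> linarith [u.1, u.2]

theorem Admissible.degreeCountLaw_le (h : Admissible d n t t₀ l) (hj : j + 2 ≤ d) {L ε : ℝ}
    (hL : 1 ≤ L) (hε : 0 ≤ ε) (hlam : 2 * L ≤ param d j (Real.log n) t)
    (hpoi : ∀ k ≤ i, ∀ μ, L - 1 ≤ μ → poi k μ ≤ ε) :
    (degreeCountLaw d n j (d * n / 2 - t) i).toReal
      ≤ (i + 1) * (ε + L * lateError d (Real.log n) t₀ t) + atypicalConst d / Real.log n := by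
  have hK := h.one_le_log
  have hd := h.two_le
  have h1 := h.le_size
  have h2 := h.le
  have hle0 : 0 ≤ lateError d (Real.log n) t₀ t := by
    unfold lateError lateConst countConst
    have : 0 ≤ Real.log t₀ := Real.log_natCast_nonneg t₀
    positivity
  rw [h.degreeCountLaw_eq]
  refine iterate_graphStep_le_of_typical (by omega) (by omega) (h.sq_le.trans h.le)
    h.iterate_not_typical_le (fun x hv hx => ?_) (fun G hG => ?_)
  · obtain ⟨μ, hμ, -, hle⟩ := (h.concentrated hv hx).degreeCount_le_sum_poi (i := i) hj hv.valid
      (by omega) (show t₀ - t + t = t₀ by omega) h.sq_le hK h.relError_nonneg h.relError_le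
      (le_trans (by gcongr; exact h.log_start_le) h.div_sqrt_le) hL hlam
    refine hle.trans ((Finset.sum_le_sum (g := fun _ => ε + L * lateError d (Real.log n) t₀ t)
      fun k hk => ?_).trans ?_)
    · have := hpoi k (Nat.lt_succ_iff.1 (Finset.mem_range.1 hk)) μ hμ
      linarith
    · rw [Finset.sum_const, Finset.card_range, nsmul_eq_mul]
      push_cast
      exact le_rfl
  · have u := iterate_indicator_mem_Icc (by omega) (show d * n / 2 - t₀ + t₀ = d * n / 2 by omega)
      (show t₀ - t + t = t₀ by omega) h.sq_le j i hG
    refine u.2.trans (le_add_of_nonneg_left (by positivity))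

end

end

/-! ### Choice of the split and asymptotics of the error terms. -/

/-- The number of missing edges at which the process is split. -/
noncomputable def splitSize (a n : ℕ) : ℕ := ⌈Real.log n ^ (a + 1)⌉₊

/-- An upper bound for the logarithm of `splitSize`. -/
noncomputable def logBound (a : ℕ) (K : ℝ) : ℝ := Real.log 7 + (a + 1 : ℕ) * Real.log K

/-- With `K = log n`, the logarithm of the split size is `O(log log n)`, hence `o(√(log n))`. -/
theorem tendsto_logBound_div_sqrt (a : ℕ) :
    Tendsto (fun K => 1 / √K * logBound a K) atTop (𝓝 0) := by
  have h1 := (isLittleO_log_rpow_atTop (r := 1 / 2) (by norm_num)).tendsto_div_nhds_zero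
  have h2 : Tendsto (fun K : ℝ => 1 / √K) atTop (𝓝 0) :=
    Real.tendsto_sqrt_atTop.const_div_atTop 1
  have h3 := (h2.mul_const (Real.log 7)).add (h1.const_mul ((a + 1 : ℕ) : ℝ))
  rw [zero_mul, mul_zero, add_zero] at h3
  refine h3.congr fun K => ?_
  rw [logBound, ← Real.sqrt_eq_rpow]
  ring

theorem tendsto_logBound_div (a : ℕ) : Tendsto (fun K => logBound a K / K) atTop (𝓝 0) := by
  have h2 : Tendsto (fun K : ℝ => 1 / √K) atTop (𝓝 0) :=
    Real.tendsto_sqrt_atTop.const_div_atTop 1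
  have h3 := (tendsto_logBound_div_sqrt a).mul h2
  rw [mul_zero] at h3
  refine h3.congr' ?_
  filter_upwards [eventually_gt_atTop 0] with K hK
  have e : √K * √K = K := Real.mul_self_sqrt hK.le
  calc _ = logBound a K / (√K * √K) := by field_simp
    _ = _ := by rw [e]

theorem tendsto_one_add_logBound_div (a : ℕ) :
    Tendsto (fun K => (1 + logBound a K) / K) atTop (𝓝 0) := by
  have h := (tendsto_inv_atTop_zero (𝕜 := ℝ)).add (tendsto_logBound_div a)
  rw [add_zero] at h
  refine h.congr fun K => ?_
  ring

theorem tendsto_relError (d a : ℕ) : Tendsto (fun K => relError d K (logBound a K)) atTop (𝓝 0) := by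
  have h := (tendsto_one_add_logBound_div a).const_mul (31 * (d : ℝ) ^ 3 * (d - 1).factorial ^ 2)
  rwa [mul_zero] at h

theorem tendsto_log_natCast : Tendsto (fun n : ℕ => Real.log n) atTop atTop :=
  Real.tendsto_log_atTop.comp tendsto_natCast_atTop_atTop

theorem eventually_splitSize_le (a : ℕ) : ∀ᶠ n : ℕ in atTop, splitSize a n ≤ n := by
  have h := (Real.isLittleO_pow_log_id_atTop (n := a + 1)).comp_tendsto
    (tendsto_natCast_atTop_atTop (R := ℝ))
  filter_upwards [h.bound one_pos] with n hn
  have : Real.log n ^ (a + 1) ≤ n := by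
    refine (le_abs_self _).trans ?_
    simpa using hn
  exact Nat.ceil_le.2 this

theorem log_two_mul_splitSize_add_le {a n : ℕ} (hK : 1 ≤ Real.log n) :
    Real.log (2 * splitSize a n + 3) ≤ logBound a (Real.log n) := by
  have hK0 : 0 < Real.log n := by linarith
  have h1 : (splitSize a n : ℝ) < Real.log n ^ (a + 1) + 1 := Nat.ceil_lt_add_one (by positivity)
  have h2 : 1 ≤ Real.log n ^ (a + 1) := one_le_pow₀ hK
  -- The constant 7 comes from `2(K^{a+1} + 1) + 3 ≤ 7 K^{a+1}`.
  rw [logBound, ← Real.log_pow, ← Real.log_mul (by norm_num) (by positivity)]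
  exact Real.log_le_log (by positivity) (by linarith)

section

variable {d a : ℕ} {γ : ℝ} {t : ℕ → ℕ}

theorem eventually_le_log_pow (hγa : γ ≤ a) (htγ : ∀ᶠ n : ℕ in atTop, (t n : ℝ) < Real.log n ^ γ) :
    ∀ᶠ n : ℕ in atTop, (t n : ℝ) ≤ Real.log n ^ a := by
  filter_upwards [htγ, tendsto_log_natCast.eventually_ge_atTop 1] with n hn hK
  refine hn.le.trans ?_
  rw [← Real.rpow_natCast]
  exact Real.rpow_le_rpow_of_exponent_le hK hγa

theorem eventually_admissible (hd : 2 ≤ d) (ha : 4 * d + 3 ≤ a) (ht : Tendsto t atTop atTop)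
    (hta : ∀ᶠ n : ℕ in atTop, (t n : ℝ) ≤ Real.log n ^ a) :
    ∀ᶠ n : ℕ in atTop, Admissible d n (t n) (splitSize a n) (logBound a (Real.log n)) := by
  have hlog := tendsto_log_natCast
  have hll : Tendsto (fun K : ℝ => (3 * d + 3 : ℕ) * (Real.log K / K)) atTop (𝓝 0) := by
    have := Real.isLittleO_log_id_atTop.tendsto_div_nhds_zero.const_mul ((3 * d + 3 : ℕ) : ℝ)
    rwa [mul_zero] at this
  have hdiv : Tendsto (fun K => 8 * (d : ℝ) ^ 3 * (d - 1).factorial * ((1 + logBound a K) / K))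
      atTop (𝓝 0) := by
    have := (tendsto_one_add_logBound_div a).const_mul (8 * (d : ℝ) ^ 3 * (d - 1).factorial)
    rwa [mul_zero] at this
  filter_upwards [hlog.eventually_ge_atTop 1, eventually_ge_atTop d, eventually_splitSize_le a,
    ht.eventually_ge_atTop (d * d), hta,
    hlog.eventually (hll.eventually_le_const one_pos),
    hlog.eventually (hdiv.eventually_le_const one_pos),
    hlog.eventually ((tendsto_relError d a).eventually_le_const (half_pos one_pos)),
    hlog.eventually ((tendsto_logBound_div_sqrt a).eventually_le_const one_pos)]
    with n hK hnd hsplit htn htan h1 h2 h3 h4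
  have hK0 : 0 < Real.log n := by linarith
  have hn0 : (0 : ℝ) < n := by exact_mod_cast (by omega : 0 < n)
  have hle : Real.log n ^ (a + 1) ≤ splitSize a n := Nat.le_ceil _
  have hdn : 2 * n ≤ d * n := Nat.mul_le_mul_right _ hd
  refine ⟨hd, hK, by omega, by omega, ?_, htn, ?_, ?_, ?_, log_two_mul_splitSize_add_le hK, h2, h3, h4⟩
  · have := htan.trans ((pow_le_pow_right₀ hK (Nat.le_succ a)).trans hle)
    exact_mod_cast this
  · have h5 : d * n / 2 ≤ n ^ 2 := by
      refine (Nat.div_le_self _ _).trans ?_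
      rw [pow_two]
      exact Nat.mul_le_mul_right _ hnd
    have h6 : 0 < d * n / 2 := by omega
    calc Real.log (d * n / 2 : ℕ) ≤ Real.log ((n : ℝ) ^ 2) :=
          Real.log_le_log (by exact_mod_cast h6) (by exact_mod_cast h5)
      _ = _ := by rw [Real.log_pow]; norm_num
  · rwa [← mul_div_assoc, div_le_one hK0] at h1
  · exact (pow_le_pow_right₀ hK (by omega)).trans hle

theorem tendsto_lateError (hd : 2 ≤ d) (ha : 4 * d + 3 ≤ a) (ht : Tendsto t atTop atTop)
    (hta : ∀ᶠ n : ℕ in atTop, (t n : ℝ) ≤ Real.log n ^ a) :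
    Tendsto (fun n : ℕ => lateError d (Real.log n) (splitSize a n) (t n)) atTop (𝓝 0) := by
  have hlog := tendsto_log_natCast
  have hlc : 0 ≤ lateConst d := by unfold lateConst; positivity
  have hcc : 0 ≤ countConst d := by unfold countConst; positivity
  have h1 : Tendsto (fun n : ℕ => lateConst d * (d * countConst d
      * (logBound a (Real.log n) / Real.log n) + 1 / (t n : ℝ)) + 4 * (1 / Real.log n))
      atTop (𝓝 0) := by
    have u1 := ((tendsto_logBound_div a).comp hlog).const_mul (d * countConst d)
    have u2 : Tendsto (fun n => 1 / (t n : ℝ)) atTop (𝓝 0) :=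
      ((tendsto_natCast_atTop_atTop (R := ℝ)).comp ht).const_div_atTop 1
    have u3 : Tendsto (fun n : ℕ => 1 / Real.log n) atTop (𝓝 0) :=
      hlog.const_div_atTop 1
    have := ((u1.add u2).const_mul (lateConst d)).add (u3.const_mul 4)
    simpa using this
  refine squeeze_zero' ?_ ?_ h1
  · filter_upwards [hlog.eventually_ge_atTop 1] with n hK
    unfold lateError
    have : 0 ≤ Real.log (splitSize a n) := Real.log_natCast_nonneg _
    positivity
  · filter_upwards [hlog.eventually_ge_atTop 1, eventually_admissible hd ha ht hta, hta]
      with n hK hn htn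
    have hK0 : 0 < Real.log n := by linarith
    have hle : Real.log n ^ (a + 1) ≤ splitSize a n := Nat.le_ceil _
    -- The exponent `a + 1` in `splitSize`, against `t ≤ (log n)^a`, is what makes `t / t₀` vanish.
    have h5 : (t n : ℝ) / splitSize a n ≤ 1 / Real.log n := by
      calc _ ≤ Real.log n ^ a / Real.log n ^ (a + 1) := by gcongr
        _ = _ := by rw [pow_succ]; field_simp
    unfold lateError
    rw [mul_div_assoc ((d : ℝ) * countConst d)]
    gcongr
    exact hn.log_start_le

theorem exists_poi_le (i : ℕ) {ε : ℝ} (hε : 0 < ε) :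
    ∃ L : ℝ, 1 ≤ L ∧ ∀ k ≤ i, ∀ μ, L - 1 ≤ μ → poi k μ ≤ ε := by
  have h : ∀ᶠ μ : ℝ in atTop, ∀ k ∈ Finset.range (i + 1), poi k μ ≤ ε := by
    rw [Filter.eventually_all_finset]
    exact fun k _ => (tendsto_poi_atTop k).eventually_le_const hε
  obtain ⟨M, hM⟩ := eventually_atTop.1 h
  exact ⟨max M 0 + 1, by linarith [le_max_right M 0], fun k hk μ hμ =>
    hM μ (by linarith [le_max_left M 0]) k (Finset.mem_range.2 (by omega))⟩

theorem param_eq_poissonParam {d j : ℕ} (hj : j < d) (t n : ℕ) :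
    param d j (Real.log n) t = poissonParam j d t n := by
  rw [param, poissonParam, poi_param_eq hj]

theorem tendsto_degreeCountLaw_sub_poi {j : ℕ} (hj : j + 2 ≤ d) (ha : 4 * d + 3 ≤ a)
    (ht : Tendsto t atTop atTop) (hta : ∀ᶠ n : ℕ in atTop, (t n : ℝ) ≤ Real.log n ^ a) (i : ℕ) :
    Tendsto (fun n : ℕ => (degreeCountLaw d n j (d * n / 2 - t n) i).toReal
      - poi i (param d j (Real.log n) (t n))) atTop (𝓝 0) := by
  have hd : 2 ≤ d := by omega
  have hlog := tendsto_log_natCast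
  rw [Metric.tendsto_nhds]
  intro ε hε
  simp_rw [dist_zero_right, Real.norm_eq_abs]
  have hi : (0 : ℝ) < i + 1 := by positivity
  have hi1 : (1 : ℝ) ≤ i + 1 := by linarith [(Nat.cast_nonneg i : (0 : ℝ) ≤ i)]
  set ε' := ε / (4 * (i + 1)) with hε'
  have hε0 : 0 < ε' := by positivity
  have hε1 : (i + 1) * ε' = ε / 4 := by rw [hε']; field_simp
  obtain ⟨L, hL, hpoi⟩ := exists_poi_le i hε0
  have e1 := tendsto_lateError hd ha ht hta
  have e2 := (tendsto_relError d a).comp hlog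
  have e3 := (Real.tendsto_sqrt_atTop.const_div_atTop (lateConst d * (d * countConst d))).comp hlog
  have e4 := hlog.const_div_atTop (atypicalConst d)
  have f1 := ((((e1.const_mul 2).add (e2.const_mul 2)).add e3).const_mul (2 * L)).add e4
  have f2 := ((e1.const_mul L).const_mul ((i : ℝ) + 1)).add e4
  simp only [mul_zero, add_zero] at f1 f2
  filter_upwards [eventually_admissible hd ha ht hta, f1.eventually_lt_const hε,
    f2.eventually_lt_const (half_pos hε)] with n hn g1 g2
  simp only [Function.comp_apply] at g1
  have hK := hn.one_le_log
  have hp0 : 0 ≤ param d j (Real.log n) (t n) := by unfold param; positivity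
  have hP0 : 0 ≤ (degreeCountLaw d n j (d * n / 2 - t n) i).toReal := ENNReal.toReal_nonneg
  -- The error bound is proportional to the parameter, so it tends to zero uniformly below `2L`;
  -- above `2L` both the probability and the Poisson weight are small.
  rcases le_or_gt (param d j (Real.log n) (t n)) (2 * L) with hlam | hlam
  · refine ((hn.abs_degreeCountLaw_sub_poi_le hj).trans ?_).trans_lt g1
    have := hn.relError_nonneg
    have hle0 : 0 ≤ lateError d (Real.log n) (splitSize a n) (t n) := by
      unfold lateError lateConst countConst
      have := Real.log_natCast_nonneg (splitSize a n)
      positivity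
    have hlc : 0 ≤ lateConst d := by unfold lateConst; positivity
    have hcc : 0 ≤ countConst d := by unfold countConst; positivity
    gcongr
  · have h1 := hn.degreeCountLaw_le hj hL hε0.le hlam.le hpoi
    have h2 := hpoi i le_rfl (param d j (Real.log n) (t n)) (by linarith)
    have h3 := poi_nonneg i hp0
    have h4 : ε' ≤ (i + 1) * ε' := le_mul_of_one_le_left hε0.le hi1
    rw [mul_add, hε1] at h1
    rw [abs_lt]
    constructor <;> linarith

end

end DGraphs

theorem theorem1p7 (d j : ℕ) (hd : 2 ≤ d) (hj : j ≤ d - 2) (γ : ℝ) (hγ : 0 < γ)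
    (t : ℕ → ℕ) (ht : Tendsto t atTop atTop)
    (htγ : ∀ᶠ n : ℕ in atTop, (t n : ℝ) < Real.log (n : ℝ) ^ γ) (i : ℕ) :
    Tendsto
      (fun n : ℕ =>
        (DGraphs.degreeCountLaw d n j (d * n / 2 - t n) i).toReal
          - Real.exp (-DGraphs.poissonParam j d (t n) n)
              * DGraphs.poissonParam j d (t n) n ^ i / (i.factorial : ℝ))
      atTop (𝓝 0) := by
  -- `4 * d + 3` makes the split large enough for typicality, and `⌈γ⌉₊` ensures `t ≤ (log n)^a`.
  set a := max (4 * d + 3) ⌈γ⌉₊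
  have hγa : γ ≤ a := (Nat.le_ceil γ).trans (by exact_mod_cast le_max_right _ _)
  have h := DGraphs.tendsto_degreeCountLaw_sub_poi (d := d) (a := a) (j := j) (by omega)
    (le_max_left _ _) ht (DGraphs.eventually_le_log_pow hγa htγ) i
  simpa only [DGraphs.param_eq_poissonParam (show j < d by omega), DGraphs.poi] using h
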